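/- Let $H$ be a hexagon with sides $a,C,b,A,c,B$ in cyclic order. All homotopies are in $H$ and keep each side setwise fixed. An \emph{arc} is an embedded closed interval with interior in the interior of $H$ and with end points in the interiors of two non-adjacent sides. Denote by $a,b,c,A,B,C$ also the homotopy classes of arcs parallel to these sides, and by $\alpha,\beta,\gamma$ the classes of the arcs joining $a$ to $A$, $b$ to $B$, $c$ to $C$. An \emph{arc system} is a set of homotopy classes of arcs that can be represented by pairwise disjoint arcs; an \emph{arc triple} is an arc system with three elements. A \emph{measured foliation} of $H$ is a non-empty finite family of foliated rectangles in $H$ with disjoint interiors, with transverse measures $w_k\,dt$, $w_k>0$, the leaves being properly embedded arcs between sides that are not homotopic to a point (the rectangles need not fill $H$; non-foliated regions are collapsed). $\mathcal{MF}$ is the set of measured foliations up to homotopy and up to cutting rectangles along leaves; $i(F,\partial)$ is the geometric intersection number, i.e. the infimum of the transverse measures of arcs in the class $\partial$ (over representatives of $F$). $\mathcal{MF}$ has the topology of convergence of all $i(\cdot,\partial)$, and $\mathcal{PMF}=\mathcal{MF}/\mathbb{R}_{>0}$ the quotient topology. For an arc triple $\partial=\{\partial_1,\partial_2,\partial_3\}$,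 $\mathcal{MF}_\partial$ is the set of $F$ with $\sum_j i(F,\partial_j)>0$ and without leaves parallel to some $\partial_j$, $\mathcal{PMF}_\partial$ is its image in $\mathcal{PMF}$, and $i_\partial=(i(\cdot,\partial_1),i(\cdot,\partial_2),i(\cdot,\partial_3))$. A map between subsets of real vector spaces, the first of which becomes with the origin a finite union of closed convex polyhedral cones, is called \emph{piecewise linear} if it is linear on each cone of some such finite decomposition. Then: 1. There are nine homotopy classes of arcs, and exactly 14 arc triples: $\{a,b,c\}$, $\{A,B,C\}$; $\{\alpha,b,c\}$, $\{a,\beta,c\}$, $\{a,b,\gamma\}$, $\{\alpha,B,C\}$, $\{A,\beta,C\}$, $\{A,B,\gamma\}$; $\{a,A,\beta\}$, $\{b,B,\alpha\}$, $\{c,C,\alpha\}$, $\{a,A,\gamma\}$, $\{b,B,\gamma\}$, $\{c,C,\beta\}$. All $i(F,\partial)$ are finite. 2. (Atlas.) For each arc triple $\partial$, $i_\partial$ is a homeomorphism from $\mathcal{MF}_\partial$ onto $\mathbb{R}^3_{\ge0}\setminus\{0\}$, and after normalization to sum $1$ it induces a homeomorphism from $\mathcal{PMF}_\partial$ onto the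 closed standard $2$-simplex. The interior of $\mathcal{PMF}_\partial$ in $\mathcal{PMF}$ is the set where all three coordinates are positive. The sets $\mathcal{MF}_\partial$ cover $\mathcal{MF}$, and the interiors of the 14 sets $\mathcal{PMF}_\partial$ cover $\mathcal{PMF}$. 3. (Coordinate changes.) For any two arc triples $\partial,\partial'$ the coordinate change $i_{\partial'}\circ i_\partial^{-1}$ on $i_\partial(\mathcal{MF}_\partial\cap\mathcal{MF}_{\partial'})$ is piecewise linear. Explicitly, writing $a$ for $i(F,a)$ etc.: - $\phi_1$, from $\{a,b,c\}$ to $\{\alpha,B,C\}$: the domain is $a=0$, and $(\alpha,B,C)=(b,b-c,0)$ if $b\ge c$, $(\alpha,B,C)=(c,0,c-b)$ if $b\le c$. - $\phi_2$, from $\{a,b,c\}$ to $\{\alpha,b,c\}$: the domain is $a\le b+c$; $b,c$ are unchanged, and $\alpha=\frac12(b+c-a)$ if $a,b,c$ satisfy the triangle inequalities, $\alpha=b-a$ if $b\ge a+c$, $\alpha=c-a$ if $c\ge a+b$. - $\phi_3$, from $\{a,b,c\}$ to $\{\beta,a,A\}$: the domain is the union of $a\ge b+c$, where $\beta=a-b$,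 $A=a-b-c$ ($a$ being unchanged), and of the boundary piece $b=0$, $a\le c$, where $\beta=c$, $A=0$. - $\phi_4$, from $\{\alpha,b,c\}$ to $\{\alpha,b,B\}$: the domain is $\alpha\ge c$; $\alpha,b$ are unchanged and $B=\alpha-c$. - $\phi_5$, from $\{A,B,C\}$ to $\{\alpha,b,c\}$: the domain is $A=0$, and $(\alpha,b,c)=(C,0,C-B)$ if $C\ge B$, $(\alpha,b,c)=(B,B-C,0)$ if $C\le B$. 4. (Piecewise-linear sphere.) There are a homeomorphism $P:\mathcal{MF}\to\mathbb{R}^3\setminus\{0\}$, homogeneous of degree $1$ and piecewise linear in the coordinates of every chart $\mathcal{MF}_\partial$, and the homeomorphism $\mathcal{PMF}\to S^2$, $[F]\mapsto P(F)/\|P(F)\|$, induced by it. 5. (Triangulation.) Sending a foliation to the function that assigns to each class of arcs the total transverse measure of the leaves parallel to it is a homeomorphism from $\mathcal{MF}$ onto the cone (without apex) over the simplicial complex $K$ of arc systems, and induces after normalization a homeomorphism from $\mathcal{PMF}$ onto the geometric realization of $K$. Every simplex of $K$ lies in one of the 14 triangles given by the arc triples. The functions $i(\cdot,\partial)$ and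 the map $P$ are linear in these weights on each cell. -/

import Mathlib

open scoped unitInterval Topology

noncomputable section

namespace Hexagon

/-! ### The hexagon and its sides -/

/-- The plane containing the hexagon (only its topology and its affine structure are used). -/
abbrev Plane : Type := ℝ × ℝ

/-- The six linear forms whose level sets `= 1` carry the sides, in cyclic order. -/
def form (k : Fin 6) (p : Plane) : ℝ :=
  ![p.1 + p.2, p.2, -p.1, -(p.1 + p.2), -p.2, p.1] k

/-- The closed hexagon `H`, with vertices `(1,0), (0,1), (-1,1), (-1,0), (0,-1), (1,-1)`. -/
def hexagon : Set Plane := {p | ∀ k, form k p ≤ 1}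

/-- The interior of the hexagon. -/
def inner : Set Plane := {p | ∀ k, form k p < 1}

/-- The (closed) sides of the hexagon, in cyclic order. In the usual names of the sides,
`0, 1, 2, 3, 4, 5` are `a, C, b, A, c, B`. -/
def side (k : Fin 6) : Set Plane := {p | p ∈ hexagon ∧ form k p = 1}

/-- A side without its two end points. -/
def openSide (k : Fin 6) : Set Plane := {p | form k p = 1 ∧ ∀ l, l ≠ k → form l p < 1}

/-- Two sides that are distinct and have no common vertex. -/
def NonAdjacent (i j : Fin 6) : Prop := i ≠ j ∧ i ≠ j + 1 ∧ j ≠ i + 1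

/-! ### Arcs and homotopies

All homotopies keep each side of the hexagon setwise fixed. -/

/-- `γ` and `δ` are homotopic in `H` through paths from side `i` to side `j`. -/
def HomotopicFrom (i j : Fin 6) (γ δ : C(I, Plane)) : Prop :=
  ∃ h : C(I × I, Plane), (∀ p, h p ∈ hexagon) ∧
    (∀ s, h (0, s) = γ s) ∧ (∀ s, h (1, s) = δ s) ∧
    ∀ u, h (u, 0) ∈ side i ∧ h (u, 1) ∈ side j

/-- A path from side `i` to side `j` that is homotopic to a point. -/
def NullHomotopicFrom (i j : Fin 6) (γ : C(I, Plane)) : Prop :=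
  ∃ p : Plane, HomotopicFrom i j γ (ContinuousMap.const I p)

/-- The path run backwards. -/
def reversePath (γ : C(I, Plane)) : C(I, Plane) := γ.comp ⟨σ, unitInterval.continuous_symm⟩

/-- Homotopy of paths with end points on sides, regardless of the direction in which the two
paths are run. -/
def Parallel (γ δ : C(I, Plane)) : Prop :=
  ∃ i j, HomotopicFrom i j γ δ ∨ HomotopicFrom i j γ (reversePath δ)

/-- An arc in the hexagon joining two non-adjacent sides. -/
structure Arc where
  path : C(I, Plane)
  src : Fin 6
  tgt : Fin 6
  nonAdjacent : NonAdjacent src tgt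
  injective : Function.Injective path
  path_zero : path 0 ∈ openSide src
  path_one : path 1 ∈ openSide tgt
  path_inner : ∀ s ∈ Set.Ioo (0 : I) 1, path s ∈ inner

/-- Homotopy classes of arcs joining two non-adjacent sides. -/
def ArcClass : Type := Quot fun γ δ : Arc => Parallel γ.path δ.path

/-- The homotopy class of an arc. -/
def Arc.toClass (γ : Arc) : ArcClass := Quot.mk _ γ

/-- A set of homotopy classes of arcs that can be represented by pairwise disjoint arcs. -/
def IsArcSystem (S : Set ArcClass) : Prop :=
  ∃ f : ArcClass → Arc, (∀ c ∈ S, (f c).toClass = c) ∧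
    S.Pairwise fun c d => Disjoint (Set.range (f c).path) (Set.range (f d).path)

/-- An arc triple (up to homotopy), with a numbering of its three arcs. -/
def IsArcTriple (d : Fin 3 → ArcClass) : Prop :=
  Function.Injective d ∧ IsArcSystem (Set.range d)

/-! ### The nine straight arcs -/

/-- The midpoint of a side. -/
def midpt (k : Fin 6) : Plane :=
  ![((1 / 2 : ℝ), (1 / 2 : ℝ)), (-1 / 2, 1), (-1, 1 / 2),
    (-1 / 2, -1 / 2), (1 / 2, -1), (1, -1 / 2)] k

theorem form_midpt_self (k : Fin 6) : form k (midpt k) = 1 := by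
  fin_cases k <;> norm_num [form, midpt]

theorem form_midpt_lt (k l : Fin 6) (h : l ≠ k) : form l (midpt k) < 1 := by
  fin_cases k <;> fin_cases l <;> first | exact absurd rfl h | norm_num [form, midpt]

theorem form_segment (k : Fin 6) (p q : Plane) (s : ℝ) :
    form k ((1 - s) • p + s • q) = (1 - s) * form k p + s * form k q := by
  fin_cases k <;> simp [form] <;> ring

/-- The straight arc joining the midpoints of two non-adjacent sides. -/
def chord (i j : Fin 6) (h : NonAdjacent i j) : Arc where
  path := ⟨fun s => (1 - (s : ℝ)) • midpt i + (s : ℝ) • midpt j, by fun_prop⟩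
  src := i
  tgt := j
  nonAdjacent := h
  injective := by
    intro s t hst
    have h1 := congrArg (form i) hst
    simp only [ContinuousMap.coe_mk, form_segment, form_midpt_self] at h1
    have h2 := form_midpt_lt j i h.1
    have h3 : ((s : ℝ) - t) * (1 - form i (midpt j)) = 0 := by linarith
    rcases mul_eq_zero.1 h3 with h4 | h4
    · exact Subtype.ext (by linarith)
    · linarith
  path_zero := by
    simpa [openSide, form_midpt_self] using fun l hl => form_midpt_lt i l hl
  path_one := by
    simpa [openSide, form_midpt_self] using fun l hl => form_midpt_lt j l hl
  path_inner := by
    intro s hs k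
    have h0 : (0 : ℝ) < s := hs.1
    have h1 : (s : ℝ) < 1 := hs.2
    simp only [ContinuousMap.coe_mk, form_segment]
    by_cases hk : k = i
    · subst hk
      have := form_midpt_lt j k h.1
      rw [form_midpt_self]
      nlinarith
    · have h2 := form_midpt_lt i k hk
      have h3 : form k (midpt j) ≤ 1 := by
        by_cases hj : k = j
        · subst hj; exact (form_midpt_self k).le
        · exact (form_midpt_lt j k hj).le
      nlinarith

/-- The arc parallel to the side `a` (joining the sides `B` and `C`). -/
def arc_a : ArcClass := (chord 5 1 (by unfold NonAdjacent; decide)).toClass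
/-- The arc parallel to the side `b` (joining the sides `C` and `A`). -/
def arc_b : ArcClass := (chord 1 3 (by unfold NonAdjacent; decide)).toClass
/-- The arc parallel to the side `c` (joining the sides `A` and `B`). -/
def arc_c : ArcClass := (chord 3 5 (by unfold NonAdjacent; decide)).toClass
/-- The arc parallel to the side `A` (joining the sides `b` and `c`). -/
def arc_A : ArcClass := (chord 2 4 (by unfold NonAdjacent; decide)).toClass
/-- The arc parallel to the side `B` (joining the sides `c` and `a`). -/
def arc_B : ArcClass := (chord 4 0 (by unfold NonAdjacent; decide)).toClass
/-- The arc parallel to the side `C` (joining the sides `a` and `b`). -/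
def arc_C : ArcClass := (chord 0 2 (by unfold NonAdjacent; decide)).toClass
/-- The arc joining the sides `a` and `A`. -/
def arc_α : ArcClass := (chord 0 3 (by unfold NonAdjacent; decide)).toClass
/-- The arc joining the sides `b` and `B`. -/
def arc_β : ArcClass := (chord 2 5 (by unfold NonAdjacent; decide)).toClass
/-- The arc joining the sides `c` and `C`. -/
def arc_γ : ArcClass := (chord 4 1 (by unfold NonAdjacent; decide)).toClass

/-! ### Measured foliations -/

/-- A foliated rectangle in the hexagon. Its leaves are the paths `s ↦ map (s, t)`, `0 < t < 1`;
they are pairwise disjoint properly embedded arcs, none of them homotopic to a point. The limits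
`t = 0` and `t = 1` may run through singular points, through corners or along the boundary. -/
structure Band where
  map : C(I × I, Plane)
  src : Fin 6
  tgt : Fin 6
  map_mem : ∀ p, map p ∈ hexagon
  injOn : Set.InjOn map (Set.univ ×ˢ Set.Ioo 0 1)
  map_zero : ∀ t ∈ Set.Ioo (0 : I) 1, map (0, t) ∈ openSide src
  map_one : ∀ t ∈ Set.Ioo (0 : I) 1, map (1, t) ∈ openSide tgt
  map_inner : ∀ s ∈ Set.Ioo (0 : I) 1, ∀ t ∈ Set.Ioo (0 : I) 1, map (s, t) ∈ inner
  essential : ∀ t ∈ Set.Ioo (0 : I) 1,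
    ¬ NullHomotopicFrom src tgt (map.comp (.prodMk (.id I) (.const I t)))

/-- The leaf of a band at height `t`. -/
def Band.leaf (R : Band) (t : I) : C(I, Plane) := R.map.comp (.prodMk (.id I) (.const I t))

/-- The part of the hexagon that is filled by the leaves of a band. -/
def Band.support (R : Band) : Set Plane := R.map '' (Set.univ ×ˢ Set.Ioo 0 1)

/-- A measured foliation of the hexagon, given by its foliated rectangles with disjoint interiors;
the transverse measure on the `k`-th rectangle is `width k * dt`. The rectangles need not fill the
hexagon (partial foliations: the regions that are not foliated are to be collapsed). A foliation
that fills the hexagon is cut into rectangles by its singular leaves and its leaves ending at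
corners. -/
structure MeasuredFoliation where
  n : ℕ
  n_pos : 0 < n
  band : Fin n → Band
  width : Fin n → ℝ
  width_pos : ∀ k, 0 < width k
  disjoint : Pairwise fun k l => Disjoint (band k).support (band l).support

namespace MeasuredFoliation

/-- `F'` is obtained from `F` by cutting bands of `F` along finitely many leaves. -/
def Subdivides (F' F : MeasuredFoliation) : Prop :=
  ∃ (p : Fin F'.n → Fin F.n) (lo hi : Fin F'.n → I),
    (∀ j, lo j < hi j) ∧
    (∀ j, ∀ s t t' : I, (t' : ℝ) = (1 - (t : ℝ)) * lo j + t * hi j →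
      (F'.band j).map (s, t) = (F.band (p j)).map (s, t')) ∧
    (∀ j, F'.width j = ((hi j : ℝ) - lo j) * F.width (p j)) ∧
    ∀ k, ∑ j with p j = k, ((hi j : ℝ) - lo j) = 1

/-- Homotopy of bands, through families of paths from side to side; the direction of the leaves
plays no role. -/
def BandHomotopic (R R' : Band) : Prop :=
  ∃ h : C(I × (I × I), Plane), (∀ p, h p ∈ hexagon) ∧
    (∀ p, h (0, p) = R.map p) ∧
    ((∀ p, h (1, p) = R'.map p) ∨ ∀ p : I × I, h (1, p) = R'.map (σ p.1, p.2)) ∧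
    ∀ u t, h (u, (0, t)) ∈ side R.src ∧ h (u, (1, t)) ∈ side R.tgt

/-- Homotopy of measured foliations: corresponding bands are homotopic and carry the same
transverse measure. -/
def Homotopic (F G : MeasuredFoliation) : Prop :=
  ∃ e : Fin F.n ≃ Fin G.n, ∀ k, F.width k = G.width (e k) ∧ BandHomotopic (F.band k) (G.band (e k))

/-- Multiplication of the transverse measure by a positive real number. -/
def scale (r : ℝ) (hr : 0 < r) (F : MeasuredFoliation) : MeasuredFoliation where
  n := F.n
  n_pos := F.n_pos
  band := F.band
  width k := r * F.width k
  width_pos k := mul_pos hr (F.width_pos k)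
  disjoint := F.disjoint

/-- The transverse measure of an arc: the number of its intersection points with a leaf,
integrated over all leaves with respect to the transverse measure (this is the total variation of
the transverse coordinate along the arc). -/
def transverseMeasure (F : MeasuredFoliation) (δ : Arc) : ENNReal :=
  ∑ k, ENNReal.ofReal (F.width k) *
    ∫⁻ t : I, ((δ.path ⁻¹' Set.range ((F.band k).leaf t)).encard : ENNReal)

/-- The leaf at height `t` of the `k`-th band is parallel to the arcs in the class `c`. -/
def LeafInClass (F : MeasuredFoliation) (k : Fin F.n) (t : I) (c : ArcClass) : Prop :=
  ∃ δ : Arc, δ.toClass = c ∧ Parallel ((F.band k).leaf t) δ.path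

/-- The total transverse measure of the leaves that are parallel to the arcs in the class `c`. -/
def leafMeasure (F : MeasuredFoliation) (c : ArcClass) : ℝ :=
  ∑ k, F.width k * (MeasureTheory.volume
    {t : I | t ∈ Set.Ioo (0 : I) 1 ∧ F.LeafInClass k t c}).toReal

end MeasuredFoliation

/-- The set of measured foliations up to homotopy (cutting a band along a leaf does not change the
foliation). -/
def MF : Type :=
  Quot fun F G : MeasuredFoliation => F.Subdivides G ∨ F.Homotopic G

/-- The class of a measured foliation. -/
def MeasuredFoliation.toMF (F : MeasuredFoliation) : MF := Quot.mk _ F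

/-- The geometric intersection number of (the class of) a measured foliation with a homotopy class
of arcs: the infimum of the transverse measures of the arcs in the class, over the representatives
of the foliation. -/
def inter (x : MF) (c : ArcClass) : ENNReal :=
  ⨅ (F : MeasuredFoliation) (_ : F.toMF = x) (δ : Arc) (_ : δ.toClass = c), F.transverseMeasure δ

/-- The geometric intersection number as a real number. -/
def coord (x : MF) (c : ArcClass) : ℝ := (inter x c).toReal

/-- The topology of convergence of the transverse measures on (homotopy classes of) arcs. -/
instance : TopologicalSpace MF := TopologicalSpace.induced inter inferInstance

/-- The set of projective classes of measured foliations. -/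
def PMF : Type :=
  Quot fun x y : MF => ∃ (F : MeasuredFoliation) (r : ℝ) (hr : 0 < r),
    F.toMF = x ∧ (F.scale r hr).toMF = y

/-- The quotient topology. -/
instance : TopologicalSpace PMF := inferInstanceAs (TopologicalSpace (Quot _))

/-- The projective class of a class of measured foliations. -/
def MF.toPMF (x : MF) : PMF := Quot.mk _ x

/-! ### Charts -/

/-- Some leaf of the foliation is parallel to the arcs in the class `c`. -/
def HasLeaf (x : MF) (c : ArcClass) : Prop :=
  ∃ F : MeasuredFoliation, F.toMF = x ∧
    ∃ (k : Fin F.n) (t : I), t ∈ Set.Ioo (0 : I) 1 ∧ F.LeafInClass k t c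

/-- The set of classes in good position with respect to the triple `d`. -/
def MFgood (d : Fin 3 → ArcClass) : Set MF :=
  {x | 0 < ∑ j, inter x (d j) ∧ ∀ j, ¬ HasLeaf x (d j)}

/-- The projective classes in good position with respect to the triple `d`. -/
def PMFgood (d : Fin 3 → ArcClass) : Set PMF := MF.toPMF '' MFgood d

/-- The coordinates given by a triple. -/
def chart (d : Fin 3 → ArcClass) (x : MF) : Fin 3 → ℝ := fun j => coord x (d j)

/-- The closed positive octant without the origin. -/
def octant : Set (Fin 3 → ℝ) := {v | (∀ j, 0 ≤ v j) ∧ v ≠ 0}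

/-! ### Piecewise-linear maps -/

/-- A closed convex polyhedral cone: a finite intersection of closed linear half-spaces. -/
def IsPolyhedralCone {V : Type*} [AddCommGroup V] [Module ℝ V] (C : Set V) : Prop :=
  ∃ s : Finset (V →ₗ[ℝ] ℝ), C = {v | ∀ l ∈ s, 0 ≤ l v}

/-- `D`, together with the origin, is a finite union of closed convex polyhedral cones, on each of
which `f` is linear. -/
def IsPiecewiseLinearOn {V W : Type*} [AddCommGroup V] [Module ℝ V] [AddCommGroup W] [Module ℝ W]
    (f : V → W) (D : Set V) : Prop :=
  ∃ (n : ℕ) (C : Fin n → Set V) (L : Fin n → V →ₗ[ℝ] W),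
    (∀ k, IsPolyhedralCone (C k)) ∧ D = (⋃ k, C k) \ {0} ∧ ∀ k, ∀ v ∈ C k, v ≠ 0 → f v = L k v

/-! ### The cell decomposition -/

/-- The cone over the simplicial complex whose vertices are the homotopy classes of arcs and whose
simplices are the arc systems, without its apex. -/
def arcCone : Set (ArcClass → ℝ) :=
  {w | (∀ c, 0 ≤ w c) ∧ w ≠ 0 ∧ IsArcSystem (Function.support w)}

/-- The geometric realization of the simplicial complex of arc systems. -/
def arcComplex : Set (ArcClass → ℝ) := {w | w ∈ arcCone ∧ ∑ᶠ c, w c = 1}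

end Hexagon

end

noncomputable section

namespace Hexagon

/-! ### Paths joining linked pairs of sides meet -/

/-! Everything reduces to nonnegative weights on nine symbols. The hexagon and its sides are convex,
so straight-line homotopies show that arcs and bands are classified by the unordered pair of
non-adjacent sides that they join, their kind (`homotopicFrom_iff`, `bandHomotopic_iff`). The one
topological input is that two paths joining linked pairs of sides meet: otherwise their difference
would be a nowhere vanishing map on a square that is forced to wind around the origin along the
boundary (`no_winding`). Conversely, explicit straight bands of kinds that are not linked are
disjoint, and straight representatives meet no more often than linking forces.

Bands of equal kind can therefore be merged into one straight band. A point of `MF` is the same as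
an admissible weight vector: nonnegative, nonzero, supported on kinds that do not cross
(`MeasuredFoliation.toMF_eq_std`, `wt_injective`). Its intersection number with a class is the sum
of the weights of the kinds crossing that class (`inter_eq`).

What remains is piecewise-linear algebra with the table of the crossing relation. Crossing kinds
never both have positive weight, so that many weights are positive parts of differences of
intersection numbers (`max_zero_sub`). This recovers all weights continuously from all intersection
numbers (`recover_isect`), hence the topology of `MF` is that of the weights (`isEmbedding_wt`). It
also inverts the charts of three arc triples, `sphereInv`, `fanInv` and `zigzagInv`; the symmetries
of the hexagon carry these to all 14 triples (`IsTriple.exists_isChartInverse`).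

The sphere comes from the three numbers i(a) - w(a), i(b) - w(b), i(c) - w(c): positive parts are
intersection numbers, negative parts are weights, and `sphereInv` is the inverse. Piecewise
linearity holds because intersection numbers are linear in the weights on each face of the complex
of arc systems, and a chart maps each face that avoids its triple injectively onto a polyhedral cone
(`isPiecewiseLinearOn_faces`). The projective statements follow by homogeneity, since `MF.toPMF` is
an open quotient map. -/

/-- A linear identification of the plane with `ℂ` that makes the hexagon regular. -/
def toComplex (p : Plane) : ℂ := ⟨p.1 + p.2, (p.2 - p.1) / √3⟩

theorem continuous_toComplex : Continuous toComplex := by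
  have : toComplex = fun p : Plane => ((p.1 + p.2 : ℝ) : ℂ) +
      ((p.2 - p.1) / √3 : ℝ) * Complex.I := by
    funext p; apply Complex.ext <;> simp [toComplex]
  rw [this]
  fun_prop

theorem toComplex_ne_zero {p : Plane} (hp : p ≠ 0) : toComplex p ≠ 0 := by
  intro h
  have h1 := congrArg Complex.re h
  have h2 := congrArg Complex.im h
  simp only [toComplex, Complex.zero_re, Complex.zero_im, div_eq_zero_iff] at h1 h2
  have h3 : √3 ≠ 0 := by positivity
  have h4 := h2.resolve_right h3
  exact hp (Prod.ext (by simp; linarith) (by simp; linarith))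

/-- In the regular picture the six forms are the scalar products with the directions kπ/3, so the
sign of `form k` becomes a condition on the argument. -/
theorem form_eq_cos (p : Plane) (z : ℂ) (h : Complex.exp z = toComplex p) (k : Fin 6) :
    form k p = Real.exp z.re * Real.cos (z.im - (k : ℕ) * (Real.pi / 3)) := by
  have h1 := congrArg Complex.re h
  have h2 := congrArg Complex.im h
  simp only [toComplex, Complex.exp_re, Complex.exp_im] at h1 h2
  have hs : √3 * √3 = 3 := Real.mul_self_sqrt (by norm_num)
  have h3 : √3 ≠ 0 := by positivity
  have h2' : Real.exp z.re * Real.sin z.im * √3 = p.2 - p.1 := by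
    rw [h2]; field_simp
  rw [Real.cos_sub]
  have e2 : (2 : ℝ) * (Real.pi / 3) = Real.pi - Real.pi / 3 := by ring
  have e3 : (3 : ℝ) * (Real.pi / 3) = Real.pi := by ring
  have e4 : (4 : ℝ) * (Real.pi / 3) = Real.pi / 3 + Real.pi := by ring
  have e5 : (5 : ℝ) * (Real.pi / 3) = 2 * Real.pi - Real.pi / 3 := by ring
  fin_cases k <;>
    simp [form, e2, e3, e4, e5, Real.cos_pi_sub, Real.sin_pi_sub, Real.cos_add_pi,
      Real.sin_add_pi, Real.cos_two_pi_sub, Real.sin_two_pi_sub] <;> linarith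

theorem abs_sub_le_of_cos_nonneg {θ a : ℝ} (hc : 0 ≤ Real.cos (θ - a))
    (h1 : a - 3 * (Real.pi / 2) < θ) (h2 : θ < a + 3 * (Real.pi / 2)) :
    |θ - a| ≤ Real.pi / 2 := by
  rw [abs_le]
  constructor
  · by_contra! h
    have := Real.cos_neg_of_pi_div_two_lt_of_lt (x := -(θ - a)) (by linarith)
      (by linarith)
    rw [Real.cos_neg] at this
    linarith
  · by_contra! h
    have := Real.cos_neg_of_pi_div_two_lt_of_lt (x := θ - a) (by linarith) (by linarith)
    linarith

/-- A nonnegative cosine excludes the angles at distance strictly between π/2 and π from `a`, and a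
continuous angle cannot jump over this gap. -/
theorem abs_sub_le_of_path {θ : I → ℝ} (hθ : Continuous θ) {a : ℝ}
    (hc : ∀ t, 0 ≤ Real.cos (θ t - a)) {t₀ : I} (h0 : |θ t₀ - a| ≤ Real.pi / 2) (t : I) :
    |θ t - a| ≤ Real.pi / 2 := by
  have hpi := Real.pi_pos
  have key : ∀ u, |θ u - a| ≤ Real.pi / 2 ∨ Real.pi ≤ |θ u - a| := by
    intro u
    by_contra! h
    have h1 := abs_lt.1 h.2
    have := abs_sub_le_of_cos_nonneg (hc u) (by linarith) (by linarith)
    linarith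
  by_contra h
  have h1 := (key t).resolve_left h
  have hcont : Continuous fun u => |θ u - a| := by fun_prop
  obtain ⟨u, hu⟩ := mem_range_of_exists_le_of_exists_ge hcont
    (c := 3 * (Real.pi / 4)) ⟨t₀, by linarith⟩ ⟨t, by linarith⟩
  rcases key u with h2 | h2 <;> simp only at hu <;> linarith

/-- This is used at a corner of the square, where two half-planes apply at once. An angle within π/2
of `a` is less than 3π/2 away from `b`, so no other branch of the second half-plane can be meant. -/
theorem abs_sub_le_of_turn {θ a b : ℝ} (ha : |θ - a| ≤ Real.pi / 2)
    (hc : 0 ≤ Real.cos (θ - b)) (h1 : a ≤ b) (h2 : b ≤ a + 2 * (Real.pi / 3)) :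
    |θ - b| ≤ Real.pi / 2 := by
  have hpi := Real.pi_pos
  have h3 := abs_le.1 ha
  exact abs_sub_le_of_cos_nonneg hc (by linarith) (by linarith)

-- These two instances serve to lift maps on the square through the complex exponential.
instance : LocallyPathConnectedSpace I := (convex_Icc (0 : ℝ) 1).locallyPathConnectedSpace

instance : ContractibleSpace I :=
  (convex_Icc (0 : ℝ) 1).contractibleSpace ⟨0, by simp⟩

theorem form_sub (k : Fin 6) (p q : Plane) : form k (p - q) = form k p - form k q := by
  fin_cases k <;> simp [form] <;> ring

/-- Lift the argument of `F` to the whole square and follow it around the boundary. Each edge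
confines it to a half-plane; the four half-planes turn forward by a full circle in total, which
contradicts the return to the initial value of the lift. -/
theorem no_winding (F : C(I × I, Plane)) (hF : ∀ x, F x ≠ 0) (i k j l : Fin 6)
    (hik : i < k) (hkj : k < j) (hjl : j < l)
    (hi : ∀ t, 0 ≤ form i (F (0, t))) (hl : ∀ s, form l (F (s, 1)) ≤ 0)
    (hj : ∀ t, 0 ≤ form j (F (1, t))) (hk : ∀ s, form k (F (s, 0)) ≤ 0) : False := by
  let Z : C(I × I, ℂ) := ⟨fun x => toComplex (F x), continuous_toComplex.comp F.continuous⟩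
  have hZ : ∀ x, Z x ≠ 0 := fun x => toComplex_ne_zero (hF x)
  obtain ⟨G, ⟨-, hG⟩, -⟩ := Complex.isCoveringMapOn_exp.existsUnique_continuousMap_lifts Z
    (a₀ := (0, 0)) (e₀ := Complex.log (Z (0, 0))) (Complex.exp_log (hZ _)) (fun a => hZ a)
  have hG' : ∀ x, Complex.exp (G x) = toComplex (F x) := fun x => congrFun hG x
  set θ : I × I → ℝ := fun x => (G x).im with hθ
  have hθc : Continuous θ := Complex.continuous_im.comp G.continuous
  have hpi := Real.pi_pos
  have pos : ∀ x k, 0 ≤ form k (F x) → 0 ≤ Real.cos (θ x - (k : ℕ) * (Real.pi / 3)) := by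
    intro x k h
    rw [form_eq_cos _ _ (hG' x)] at h
    exact nonneg_of_mul_nonneg_right h (Real.exp_pos _)
  have neg : ∀ x k, form k (F x) ≤ 0 → Real.cos (θ x - (k : ℕ) * (Real.pi / 3)) ≤ 0 := by
    intro x k h
    rw [form_eq_cos _ _ (hG' x)] at h
    by_contra! h'
    have := mul_pos (Real.exp_pos (G x).re) h'
    linarith
  -- angles of the four half planes, after a common translation
  obtain ⟨m, hm⟩ : ∃ m : ℤ, |θ (0, 0) - ((i : ℕ) * (Real.pi / 3) + m * (2 * Real.pi))| ≤
      Real.pi / 2 := by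
    refine ⟨round ((θ (0, 0) - (i : ℕ) * (Real.pi / 3)) / (2 * Real.pi)), ?_⟩
    set y := θ (0, 0) - (i : ℕ) * (Real.pi / 3) with hy
    have h1 := abs_le.1 (abs_sub_round (y / (2 * Real.pi)))
    have h2 : y = y / (2 * Real.pi) * (2 * Real.pi) := by field_simp
    have h3 := pos _ _ (hi 0)
    rw [← hy] at h3
    refine abs_sub_le_of_cos_nonneg ?_ ?_ ?_
    · rw [← sub_sub, ← hy, Real.cos_sub_int_mul_two_pi]
      exact h3
    · nlinarith
    · nlinarith
  set M : ℝ := m * (2 * Real.pi) with hM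
  have shift : ∀ x c, Real.cos (θ x - (c + M)) = Real.cos (θ x - c) := by
    intro x c
    rw [← sub_sub, hM, Real.cos_sub_int_mul_two_pi]
  have nat {u v : Fin 6} (h : u < v) : ((u : ℕ) : ℝ) + 1 ≤ (v : ℕ) := by exact_mod_cast h
  have hik' := nat hik
  have hkj' := nat hkj
  have hjl' := nat hjl
  have hl5 : ((l : ℕ) : ℝ) ≤ 5 := by exact_mod_cast (by omega : (l : ℕ) ≤ 5)
  have hi0 : (0 : ℝ) ≤ (i : ℕ) := by positivity
  have c1 : ∀ t, 0 ≤ Real.cos (θ (0, t) - ((i : ℕ) * (Real.pi / 3) + M)) := fun t => by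
    rw [shift]; exact pos _ _ (hi t)
  -- A condition `form l ≤ 0` is the half-plane in the opposite direction. Choosing l - 3 here and k
  -- + 3 in `c4` puts the centres in the order i ≤ l - 3 ≤ j ≤ k + 3, with consecutive gaps of at
  -- most two units of π/3.
  have c2 : ∀ s, 0 ≤ Real.cos (θ (s, 1) - (((l : ℕ) - 3) * (Real.pi / 3) + M)) := fun s => by
    rw [shift, show θ (s, 1) - ((l : ℕ) - 3 : ℝ) * (Real.pi / 3) =
      θ (s, 1) - (l : ℕ) * (Real.pi / 3) + Real.pi by ring, Real.cos_add_pi]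
    linarith [neg _ _ (hl s)]
  have c3 : ∀ t, 0 ≤ Real.cos (θ (1, t) - ((j : ℕ) * (Real.pi / 3) + M)) := fun t => by
    rw [shift]; exact pos _ _ (hj t)
  have c4 : ∀ s, 0 ≤ Real.cos (θ (s, 0) - (((k : ℕ) + 3) * (Real.pi / 3) + M)) := fun s => by
    rw [shift, show θ (s, 0) - ((k : ℕ) + 3 : ℝ) * (Real.pi / 3) =
      θ (s, 0) - (k : ℕ) * (Real.pi / 3) - Real.pi by ring, Real.cos_sub_pi]
    linarith [neg _ _ (hk s)]
  have a1 := abs_sub_le_of_path (θ := fun t => θ (0, t)) (by fun_prop) c1 hm 1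
  have b2 := abs_sub_le_of_turn a1 (c2 0) (by nlinarith) (by nlinarith)
  have a2 := abs_sub_le_of_path (θ := fun s => θ (s, 1)) (by fun_prop) c2 b2 1
  have b3 := abs_sub_le_of_turn a2 (c3 1) (by nlinarith) (by nlinarith)
  have a3 := abs_sub_le_of_path (θ := fun t => θ (1, t)) (by fun_prop) c3 b3 0
  have b4 := abs_sub_le_of_turn a3 (c4 1) (by nlinarith) (by nlinarith)
  have a4 := abs_sub_le_of_path (θ := fun s => θ (s, 0)) (by fun_prop) c4 b4 0
  -- The angle at the corner `(0, 0)` is now within π/2 both of iπ/3 and of (k + 3)π/3, up to the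
  -- same translation. Since i < k, these differ by at least 4π/3 > π.
  have h1 := abs_le.1 hm
  have h2 := abs_le.1 a4
  have h3 : ((k : ℕ) : ℝ) ≤ (i : ℕ) + 3 := by linarith
  nlinarith

/-- If the paths were disjoint, p(s) - q(t) would never vanish. On each edge of the square one of
the two points lies on a side of the hexagon, so the form of that side, which is at most 1
everywhere, has a definite sign on the difference. -/
theorem exists_common_point_of_lt (p q : C(I, Plane)) (hp : ∀ s, p s ∈ hexagon)
    (hq : ∀ s, q s ∈ hexagon) {i k j l : Fin 6} (hik : i < k) (hkj : k < j) (hjl : j < l)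
    (hi : form i (p 0) = 1) (hj : form j (p 1) = 1) (hk : form k (q 0) = 1)
    (hl : form l (q 1) = 1) : ∃ s t, p s = q t := by
  by_contra! h
  refine no_winding ⟨fun x => p x.1 - q x.2, by fun_prop⟩ (fun x => sub_ne_zero.2 (h x.1 x.2))
    i k j l hik hkj hjl ?_ ?_ ?_ ?_ <;> intro t <;> simp only [ContinuousMap.coe_mk, form_sub]
  · linarith [hq t i]
  · linarith [hp t l]
  · linarith [hq t j]
  · linarith [hp t k]

/-- Two pairs of sides `{i, j}` and `{k, l}` that separate each other on the boundary. -/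
def Linked (i j k l : Fin 6) : Prop :=
  (min i j < min k l ∧ min k l < max i j ∧ max i j < max k l) ∨
    (min k l < min i j ∧ min i j < max k l ∧ max k l < max i j)

instance (i j k l : Fin 6) : Decidable (Linked i j k l) := by unfold Linked; infer_instance

theorem reversePath_apply (p : C(I, Plane)) (s : I) : reversePath p s = p (σ s) := rfl

theorem exists_common_point (p q : C(I, Plane)) (hp : ∀ s, p s ∈ hexagon)
    (hq : ∀ s, q s ∈ hexagon) {i k j l : Fin 6} (h : Linked i j k l)
    (hi : form i (p 0) = 1) (hj : form j (p 1) = 1) (hk : form k (q 0) = 1)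
    (hl : form l (q 1) = 1) : ∃ s t, p s = q t := by
  wlog hij : i ≤ j generalizing p i j
  · obtain ⟨s, t, hst⟩ := this (reversePath p) (fun s => hp _) (i := j) (j := i)
      (by simpa only [Linked, min_comm, max_comm] using h)
      (by simpa [reversePath_apply] using hj) (by simpa [reversePath_apply] using hi)
      (le_of_not_ge hij)
    exact ⟨_, t, hst⟩
  wlog hkl : k ≤ l generalizing q k l
  · obtain ⟨s, t, hst⟩ := this (reversePath q) (fun s => hq _) (k := l) (l := k)
      (by simpa [reversePath_apply] using hl) (by simpa [reversePath_apply] using hk)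
      (by simpa only [Linked, min_comm, max_comm] using h)
      (le_of_not_ge hkl)
    exact ⟨s, _, hst⟩
  rw [Linked, min_eq_left hij, max_eq_right hij, min_eq_left hkl, max_eq_right hkl] at h
  rcases h with h | h
  · exact exists_common_point_of_lt p q hp hq h.1 h.2.1 h.2.2 hi hj hk hl
  · obtain ⟨s, t, hst⟩ := exists_common_point_of_lt q p hq hp h.1 h.2.1 h.2.2 hk hl hi hj
    exact ⟨t, s, hst.symm⟩

/-! ### Sides and the classification of arcs -/

theorem continuous_form (k : Fin 6) : Continuous (form k) := by
  have : form k = fun p : Plane => form k p := rfl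
  rw [this]
  fin_cases k <;> simp only [form] <;> simp <;> fun_prop

theorem form_le_one_of_openSide {k : Fin 6} {p : Plane} (hp : p ∈ openSide k) (l : Fin 6) :
    form l p ≤ 1 := by
  by_cases h : l = k
  · subst h; exact hp.1.le
  · exact (hp.2 l h).le

theorem openSide_subset_side (k : Fin 6) : openSide k ⊆ side k :=
  fun _ hp => ⟨form_le_one_of_openSide hp, hp.1⟩

theorem inner_subset_hexagon : inner ⊆ hexagon := fun _ hp k => (hp k).le

theorem eq_of_mem_openSide_of_mem_side {i j : Fin 6} {p : Plane} (hi : p ∈ openSide i)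
    (hj : p ∈ side j) : j = i := by
  by_contra h
  exact (hi.2 j h).ne hj.2

theorem segment_mem_hexagon {p q : Plane} (hp : p ∈ hexagon) (hq : q ∈ hexagon) (s : I) :
    (1 - (s : ℝ)) • p + (s : ℝ) • q ∈ hexagon := by
  intro k
  rw [form_segment]
  nlinarith [hp k, hq k, s.2.1, s.2.2]

theorem segment_mem_side {p q : Plane} {k : Fin 6} (hp : p ∈ side k) (hq : q ∈ side k) (s : I) :
    (1 - (s : ℝ)) • p + (s : ℝ) • q ∈ side k := by
  refine ⟨segment_mem_hexagon hp.1 hq.1 s, ?_⟩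
  rw [form_segment, hp.2, hq.2]
  ring

theorem isClosed_hexagon : IsClosed hexagon := by
  simp only [hexagon, Set.ofPred_forall]
  exact isClosed_iInter fun k => isClosed_le (continuous_form k) continuous_const

theorem isClosed_side (k : Fin 6) : IsClosed (side k) :=
  isClosed_hexagon.inter (isClosed_eq (continuous_form k) continuous_const)

instance : DecidableRel NonAdjacent := fun i j => by unfold NonAdjacent; infer_instance

theorem NonAdjacent.disjoint_side {i j : Fin 6} (h : NonAdjacent i j) {p : Plane}
    (hi : p ∈ side i) (hj : p ∈ side j) : False := by
  have h1 := hi.2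
  have h2 := hj.2
  have h3 := hi.1
  have h4 := h3 0
  have h5 := h3 1
  have h6 := h3 2
  have h7 := h3 3
  have h8 := h3 4
  have h9 := h3 5
  simp [form] at h4 h5 h6 h7 h8 h9
  revert h
  fin_cases i <;> fin_cases j <;> simp [form] at h1 h2 <;>
    first
      | (intro h; exact absurd h (by decide))
      | (intro _; linarith)

theorem exists_mem_side_inter {i j : Fin 6} (h : ¬ NonAdjacent i j) :
    ∃ p : Plane, p ∈ side i ∧ p ∈ side j := by
  have vert : ∀ k l : Fin 6, l = k + 1 → ∃ p : Plane, p ∈ side k ∧ p ∈ side l := by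
    intro k l hkl
    refine ⟨![(0, 1), (-1, 1), (-1, 0), (0, -1), (1, -1), (1, 0)] k, ?_⟩
    fin_cases k <;> fin_cases l <;>
      first
        | (exact absurd hkl (by decide))
        | (refine ⟨⟨fun m => ?_, ?_⟩, fun m => ?_, ?_⟩ <;>
            first
              | (fin_cases m <;> norm_num [form])
              | (norm_num [form]))
  simp only [NonAdjacent, not_and_or, not_not] at h
  rcases h with rfl | rfl | rfl
  · obtain ⟨p, hp, -⟩ := vert i _ rfl
    exact ⟨p, hp, hp⟩
  · obtain ⟨p, hp, hq⟩ := vert j _ rfl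
    exact ⟨p, hq, hp⟩
  · exact vert i _ rfl

/-! ### Homotopy classes of paths are pairs of sides -/

/-- A path in the hexagon from side `i` to side `j`. -/
def Joins (i j : Fin 6) (γ : C(I, Plane)) : Prop :=
  (∀ s, γ s ∈ hexagon) ∧ γ 0 ∈ side i ∧ γ 1 ∈ side j

/-- The straight-line homotopy stays in the hexagon and keeps the end points on their sides by
convexity, so homotopy retains nothing but the sides. -/
theorem homotopicFrom_iff {i j : Fin 6} {γ δ : C(I, Plane)} :
    HomotopicFrom i j γ δ ↔ Joins i j γ ∧ Joins i j δ := by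
  constructor
  · rintro ⟨h, hh, h0, h1, hs⟩
    refine ⟨⟨fun s => h0 s ▸ hh _, h0 0 ▸ (hs 0).1, h0 1 ▸ (hs 0).2⟩,
      ⟨fun s => h1 s ▸ hh _, h1 0 ▸ (hs 1).1, h1 1 ▸ (hs 1).2⟩⟩
  · rintro ⟨h1, h2⟩
    refine ⟨⟨fun x => (1 - (x.1 : ℝ)) • γ x.2 + (x.1 : ℝ) • δ x.2, by fun_prop⟩,
      fun x => segment_mem_hexagon (h1.1 _) (h2.1 _) _, fun s => by simp, fun s => by simp,
      fun u => ⟨segment_mem_side h1.2.1 h2.2.1 u, segment_mem_side h1.2.2 h2.2.2 u⟩⟩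

/-- A path can be shrunk exactly when its two sides have a common point, and non-adjacent sides have
none. -/
theorem nullHomotopicFrom_iff {i j : Fin 6} {γ : C(I, Plane)} :
    NullHomotopicFrom i j γ ↔ Joins i j γ ∧ ¬ NonAdjacent i j := by
  constructor
  · rintro ⟨p, h⟩
    rw [homotopicFrom_iff] at h
    exact ⟨h.1, fun hn => hn.disjoint_side h.2.2.1 h.2.2.2⟩
  · rintro ⟨h1, h2⟩
    obtain ⟨p, hi, hj⟩ := exists_mem_side_inter h2
    exact ⟨p, homotopicFrom_iff.2 ⟨h1, fun _ => hi.1, hi, hj⟩⟩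

/-- The first end of the arcs of each of the nine kinds: kind `k < 6` cuts off side `k`, kinds
`6, 7, 8` join opposite sides. -/
def end₁ : Fin 9 → Fin 6 := ![5, 0, 1, 2, 3, 4, 0, 2, 4]

/-- The second end of the arcs of each of the nine kinds. -/
def end₂ : Fin 9 → Fin 6 := ![1, 2, 3, 4, 5, 0, 3, 5, 1]

/-- The kind of the arcs joining two non-adjacent sides. -/
def kind (i j : Fin 6) : Fin 9 :=
  ![![0, 0, 1, 6, 5, 0], ![0, 0, 0, 2, 8, 0], ![1, 0, 0, 0, 3, 7], ![6, 2, 0, 0, 0, 4],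
    ![5, 8, 3, 0, 0, 0], ![0, 0, 7, 4, 0, 0]] i j

theorem nonAdjacent_ends : ∀ c, NonAdjacent (end₁ c) (end₂ c) := by decide

theorem kind_ends : ∀ c, kind (end₁ c) (end₂ c) = c := by decide

theorem kind_eq_kind_iff : ∀ i j, NonAdjacent i j → ∀ k l, NonAdjacent k l →
    (kind i j = kind k l ↔ (i = k ∧ j = l) ∨ (i = l ∧ j = k)) := by
  decide

/-- A path in the hexagon that starts inside side `i` and ends inside side `j`. -/
structure ProperlyJoins (i j : Fin 6) (γ : C(I, Plane)) : Prop where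
  mem : ∀ s, γ s ∈ hexagon
  zero : γ 0 ∈ openSide i
  one : γ 1 ∈ openSide j

theorem ProperlyJoins.joins {i j : Fin 6} {γ : C(I, Plane)} (h : ProperlyJoins i j γ) :
    Joins i j γ :=
  ⟨h.mem, openSide_subset_side _ h.zero, openSide_subset_side _ h.one⟩

theorem ProperlyJoins.eq_of_joins {i j k l : Fin 6} {γ : C(I, Plane)} (h : ProperlyJoins i j γ)
    (h' : Joins k l γ) : k = i ∧ l = j :=
  ⟨eq_of_mem_openSide_of_mem_side h.zero h'.2.1, eq_of_mem_openSide_of_mem_side h.one h'.2.2⟩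

theorem joins_reversePath {i j : Fin 6} {γ : C(I, Plane)} :
    Joins i j (reversePath γ) ↔ Joins j i γ := by
  simp only [Joins, reversePath_apply, unitInterval.symm_zero, unitInterval.symm_one]
  refine ⟨fun h => ⟨fun s => ?_, h.2.2, h.2.1⟩, fun h => ⟨fun s => h.1 _, h.2.2, h.2.1⟩⟩
  simpa using h.1 (σ s)

/-- An end point in the open part of a side lies on no other side, so the sides in a homotopy are
determined by the path; only its direction is free. -/
theorem ProperlyJoins.parallel_iff {i j k l : Fin 6} {γ δ : C(I, Plane)}
    (h : ProperlyJoins i j γ) (h' : ProperlyJoins k l δ) :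
    Parallel γ δ ↔ (i = k ∧ j = l) ∨ (i = l ∧ j = k) := by
  simp only [Parallel, homotopicFrom_iff, joins_reversePath]
  constructor
  · rintro ⟨i', j', ⟨h1, h2⟩ | ⟨h1, h2⟩⟩
    · obtain ⟨rfl, rfl⟩ := h.eq_of_joins h1
      exact Or.inl (h'.eq_of_joins h2)
    · obtain ⟨rfl, rfl⟩ := h.eq_of_joins h1
      exact Or.inr (h'.eq_of_joins h2).symm
  · rintro (⟨rfl, rfl⟩ | ⟨rfl, rfl⟩)
    · exact ⟨i, j, Or.inl ⟨h.joins, h'.joins⟩⟩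
    · exact ⟨i, j, Or.inr ⟨h.joins, h'.joins⟩⟩

theorem ProperlyJoins.parallel_iff_kind {i j k l : Fin 6} {γ δ : C(I, Plane)}
    (h : ProperlyJoins i j γ) (h' : ProperlyJoins k l δ) (hn : NonAdjacent i j)
    (hn' : NonAdjacent k l) : Parallel γ δ ↔ kind i j = kind k l := by
  rw [h.parallel_iff h', kind_eq_kind_iff _ _ hn _ _ hn']

theorem unitInterval_cases (s : I) : s = 0 ∨ s = 1 ∨ s ∈ Set.Ioo (0 : I) 1 := by
  rcases eq_or_lt_of_le (unitInterval.nonneg' : 0 ≤ s) with h | h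
  · exact Or.inl h.symm
  · rcases eq_or_lt_of_le (unitInterval.le_one' : s ≤ 1) with h' | h'
    · exact Or.inr (Or.inl h')
    · exact Or.inr (Or.inr ⟨h, h'⟩)

theorem Arc.properlyJoins (γ : Arc) : ProperlyJoins γ.src γ.tgt γ.path where
  mem s := by
    rcases unitInterval_cases s with rfl | rfl | h
    · exact form_le_one_of_openSide γ.path_zero
    · exact form_le_one_of_openSide γ.path_one
    · exact inner_subset_hexagon (γ.path_inner s h)
  zero := γ.path_zero
  one := γ.path_one

/-- The kind of an arc. -/
def Arc.kind (γ : Arc) : Fin 9 := Hexagon.kind γ.src γ.tgt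

theorem Arc.parallel_iff (γ δ : Arc) : Parallel γ.path δ.path ↔ γ.kind = δ.kind :=
  γ.properlyJoins.parallel_iff_kind δ.properlyJoins γ.nonAdjacent δ.nonAdjacent

/-- The class of the arcs of kind `c`. -/
def classOf (c : Fin 9) : ArcClass := (chord (end₁ c) (end₂ c) (nonAdjacent_ends c)).toClass

/-- The kind of the arcs in a class. -/
def ArcClass.kind : ArcClass → Fin 9 := Quot.lift Arc.kind fun γ δ h => (γ.parallel_iff δ).1 h

theorem Arc.kind_toClass (γ : Arc) : γ.toClass.kind = γ.kind := rfl

theorem Arc.toClass_eq_iff (γ δ : Arc) : γ.toClass = δ.toClass ↔ γ.kind = δ.kind :=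
  ⟨fun h => congrArg ArcClass.kind h, fun h => Quot.sound ((γ.parallel_iff δ).2 h)⟩

theorem kind_classOf (c : Fin 9) : (classOf c).kind = c := kind_ends c

theorem Arc.toClass_eq_classOf (γ : Arc) : γ.toClass = classOf γ.kind :=
  (Arc.toClass_eq_iff _ _).2 (kind_classOf _).symm

theorem classOf_kind (c : ArcClass) : classOf c.kind = c := by
  induction c using Quot.ind with
  | mk γ => exact γ.toClass_eq_classOf.symm

/-- The homotopy classes of arcs are determined by their kinds. -/
def classEquiv : ArcClass ≃ Fin 9 where
  toFun := ArcClass.kind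
  invFun := classOf
  left_inv := classOf_kind
  right_inv := kind_classOf

instance : Fintype ArcClass := Fintype.ofEquiv _ classEquiv.symm

/-! ### Bands -/

/-- The boundary leaves are only limits of leaves, hence the closed side instead of the open one. -/
theorem Band.map_zero_mem (R : Band) (t : I) : R.map (0, t) ∈ side R.src := by
  have h1 : t ∈ closure (Set.Ioo (0 : I) 1) := by
    rw [closure_Ioo (by simp)]; exact ⟨unitInterval.nonneg', unitInterval.le_one'⟩
  have hc : Continuous fun t : I => R.map (0, t) := by fun_prop
  exact closure_minimal (s := Set.Ioo (0 : I) 1) (t := (fun t : I => R.map (0, t)) ⁻¹' side R.src)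
    (fun t ht => openSide_subset_side _ (R.map_zero t ht)) ((isClosed_side _).preimage hc) h1

theorem Band.map_one_mem (R : Band) (t : I) : R.map (1, t) ∈ side R.tgt := by
  have h1 : t ∈ closure (Set.Ioo (0 : I) 1) := by
    rw [closure_Ioo (by simp)]; exact ⟨unitInterval.nonneg', unitInterval.le_one'⟩
  have hc : Continuous fun t : I => R.map (1, t) := by fun_prop
  exact closure_minimal (s := Set.Ioo (0 : I) 1) (t := (fun t : I => R.map (1, t)) ⁻¹' side R.tgt)
    (fun t ht => openSide_subset_side _ (R.map_one t ht)) ((isClosed_side _).preimage hc) h1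

theorem Band.properlyJoins (R : Band) {t : I} (ht : t ∈ Set.Ioo (0 : I) 1) :
    ProperlyJoins R.src R.tgt (R.leaf t) :=
  ⟨fun _ => R.map_mem _, R.map_zero t ht, R.map_one t ht⟩

theorem exists_mem_Ioo : ∃ t : I, t ∈ Set.Ioo (0 : I) 1 := exists_between zero_lt_one

theorem Band.nonAdjacent (R : Band) : NonAdjacent R.src R.tgt := by
  obtain ⟨t, ht⟩ := exists_mem_Ioo
  by_contra h
  exact R.essential t ht (nullHomotopicFrom_iff.2 ⟨(R.properlyJoins ht).joins, h⟩)

/-- The kind of the leaves of a band. -/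
def Band.kind (R : Band) : Fin 9 := Hexagon.kind R.src R.tgt

namespace MeasuredFoliation

theorem leafInClass_iff (F : MeasuredFoliation) (k : Fin F.n) {t : I}
    (ht : t ∈ Set.Ioo (0 : I) 1) (c : ArcClass) :
    F.LeafInClass k t c ↔ (F.band k).kind = c.kind := by
  have key : ∀ δ : Arc, Parallel ((F.band k).leaf t) δ.path ↔ (F.band k).kind = δ.kind :=
    fun δ => ((F.band k).properlyJoins ht).parallel_iff_kind δ.properlyJoins
      (F.band k).nonAdjacent δ.nonAdjacent
  constructor
  · rintro ⟨δ, rfl, h⟩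
    exact (key δ).1 h
  · intro h
    induction c using Quot.ind with
    | mk δ => exact ⟨δ, rfl, (key δ).2 h⟩

/-- All leaves of a band have the same kind, and the two boundary leaves form a null set, so a band
contributes its full width or nothing. -/
theorem leafMeasure_eq (F : MeasuredFoliation) (c : ArcClass) :
    F.leafMeasure c = ∑ k, if (F.band k).kind = c.kind then F.width k else 0 := by
  refine Finset.sum_congr rfl fun k _ => ?_
  split_ifs with h
  · have : {t : I | t ∈ Set.Ioo (0 : I) 1 ∧ F.LeafInClass k t c} = Set.Ioo 0 1 := by
      ext t
      exact ⟨fun ht => ht.1, fun ht => ⟨ht, (F.leafInClass_iff k ht c).2 h⟩⟩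
    rw [this]
    simp
  · have : {t : I | t ∈ Set.Ioo (0 : I) 1 ∧ F.LeafInClass k t c} = ∅ := by
      ext t
      simp only [Set.mem_ofPred_eq, Set.mem_empty_iff_false, iff_false, not_and]
      exact fun ht hc => h ((F.leafInClass_iff k ht c).1 hc)
    rw [this]
    simp

/-- Bands need not stay embedded during a homotopy, so linear interpolation is allowed and the pair
of sides is again the only invariant. -/
theorem bandHomotopic_iff (R R' : Band) : BandHomotopic R R' ↔ R.kind = R'.kind := by
  rw [Band.kind, Band.kind, kind_eq_kind_iff _ _ R.nonAdjacent _ _ R'.nonAdjacent]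
  constructor
  · rintro ⟨h, -, -, h1, hs⟩
    obtain ⟨t, ht⟩ := exists_mem_Ioo
    have hs := hs 1 t
    rcases h1 with h1 | h1
    · rw [h1, h1] at hs
      exact Or.inl ⟨eq_of_mem_openSide_of_mem_side (R'.map_zero t ht) hs.1,
        eq_of_mem_openSide_of_mem_side (R'.map_one t ht) hs.2⟩
    · rw [h1, h1] at hs
      simp only [unitInterval.symm_zero, unitInterval.symm_one] at hs
      exact Or.inr ⟨eq_of_mem_openSide_of_mem_side (R'.map_one t ht) hs.1,
        eq_of_mem_openSide_of_mem_side (R'.map_zero t ht) hs.2⟩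
  · rintro (⟨h1, h2⟩ | ⟨h1, h2⟩)
    · refine ⟨⟨fun x => (1 - (x.1 : ℝ)) • R.map x.2 + (x.1 : ℝ) • R'.map x.2, by fun_prop⟩,
        fun x => segment_mem_hexagon (R.map_mem _) (R'.map_mem _) _, fun p => by simp,
        Or.inl fun p => by simp, fun u t => ⟨?_, ?_⟩⟩
      · exact segment_mem_side (R.map_zero_mem t) (h1 ▸ R'.map_zero_mem t) u
      · exact segment_mem_side (R.map_one_mem t) (h2 ▸ R'.map_one_mem t) u
    · refine ⟨⟨fun x => (1 - (x.1 : ℝ)) • R.map x.2 + (x.1 : ℝ) • R'.map (σ x.2.1, x.2.2),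
          by fun_prop⟩,
        fun x => segment_mem_hexagon (R.map_mem _) (R'.map_mem _) _, fun p => by simp,
        Or.inr fun p => by simp, fun u t => ⟨?_, ?_⟩⟩
      · refine segment_mem_side (R.map_zero_mem t) (h1 ▸ ?_) u
        simpa using R'.map_one_mem t
      · refine segment_mem_side (R.map_one_mem t) (h2 ▸ ?_) u
        simpa using R'.map_zero_mem t

theorem Subdivides.kind_eq {F' F : MeasuredFoliation} {p : Fin F'.n → Fin F.n}
    {lo hi : Fin F'.n → I} (hlt : ∀ j, lo j < hi j)
    (hm : ∀ j, ∀ s t t' : I, (t' : ℝ) = (1 - (t : ℝ)) * lo j + t * hi j →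
      (F'.band j).map (s, t) = (F.band (p j)).map (s, t')) (j : Fin F'.n) :
    (F'.band j).kind = (F.band (p j)).kind := by
  obtain ⟨t, ht⟩ := exists_mem_Ioo
  have h0 := (lo j).2.1
  have h1 := (hi j).2.2
  have h2 : ((lo j : ℝ)) < hi j := hlt j
  have ht0 : (0 : ℝ) < t := ht.1
  have ht1 : (t : ℝ) < 1 := ht.2
  let t' : I := ⟨(1 - (t : ℝ)) * lo j + t * hi j, by nlinarith, by nlinarith⟩
  have h3 := hm j 0 t t' rfl
  have h4 := hm j 1 t t' rfl
  have h5 := (F'.band j).map_zero t ht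
  have h6 := (F'.band j).map_one t ht
  rw [h3] at h5
  rw [h4] at h6
  rw [Band.kind, Band.kind, eq_of_mem_openSide_of_mem_side h5 ((F.band (p j)).map_zero_mem _),
    eq_of_mem_openSide_of_mem_side h6 ((F.band (p j)).map_one_mem _)]

/-- Cutting preserves the kind of each piece, and the fractions of a band taken by its pieces add up
to 1. -/
theorem Subdivides.leafMeasure_eq {F' F : MeasuredFoliation} (h : F'.Subdivides F) :
    F'.leafMeasure = F.leafMeasure := by
  funext c
  obtain ⟨p, lo, hi, hlt, hm, hw, hsum⟩ := h
  rw [MeasuredFoliation.leafMeasure_eq, MeasuredFoliation.leafMeasure_eq,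
    ← Finset.sum_fiberwise (s := Finset.univ) (g := p)]
  refine Finset.sum_congr rfl fun k _ => ?_
  rw [← one_mul (if (F.band k).kind = c.kind then F.width k else 0), ← hsum k, Finset.sum_mul]
  refine Finset.sum_congr rfl fun j hj => ?_
  have hj' : p j = k := (Finset.mem_filter.1 hj).2
  subst hj'
  rw [kind_eq hlt hm j, hw j, mul_ite, mul_zero]

theorem Homotopic.leafMeasure_eq {F G : MeasuredFoliation} (h : F.Homotopic G) :
    F.leafMeasure = G.leafMeasure := by
  funext c
  obtain ⟨e, he⟩ := h
  rw [MeasuredFoliation.leafMeasure_eq, MeasuredFoliation.leafMeasure_eq,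
    ← Equiv.sum_comp e]
  refine Finset.sum_congr rfl fun k _ => ?_
  rw [(he k).1, (bandHomotopic_iff _ _).1 (he k).2]

theorem homotopic_of_kind {F G : MeasuredFoliation} (e : Fin F.n ≃ Fin G.n)
    (hw : ∀ k, F.width k = G.width (e k))
    (hk : ∀ k, (F.band k).kind = (G.band (e k)).kind) : F.Homotopic G :=
  ⟨e, fun k => ⟨hw k, (bandHomotopic_iff _ _).2 (hk k)⟩⟩

end MeasuredFoliation

/-! ### Weights as invariants, and the crossing relation -/

/-- The weights of a class of measured foliations: the total transverse measures of the families of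
parallel leaves. -/
def weight : MF → ArcClass → ℝ :=
  Quot.lift MeasuredFoliation.leafMeasure fun _ _ h =>
    h.elim MeasuredFoliation.Subdivides.leafMeasure_eq MeasuredFoliation.Homotopic.leafMeasure_eq

theorem weight_toMF (F : MeasuredFoliation) : weight F.toMF = F.leafMeasure := rfl

/-- Whether arcs of two kinds have to cross. -/
def Cross (b c : Fin 9) : Prop := Linked (end₁ b) (end₂ b) (end₁ c) (end₂ c)

instance : DecidableRel Cross := fun b c => by unfold Cross; infer_instance

theorem linked_iff_cross : ∀ i j, NonAdjacent i j → ∀ k l, NonAdjacent k l →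
    (Linked i j k l ↔ Cross (kind i j) (kind k l)) := by
  decide

theorem ProperlyJoins.exists_common_point {i j k l : Fin 6} {γ δ : C(I, Plane)}
    (h : ProperlyJoins i j γ) (h' : ProperlyJoins k l δ) (hn : NonAdjacent i j)
    (hn' : NonAdjacent k l) (hc : Cross (kind i j) (kind k l)) : ∃ s t, γ s = δ t :=
  Hexagon.exists_common_point γ δ h.mem h'.mem ((linked_iff_cross _ _ hn _ _ hn').2 hc)
    h.zero.1 h.one.1 h'.zero.1 h'.one.1

/-! ### Straight bands -/

/-- The affine parametrization of a side by `[0, 1]`. -/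
def sidePt (k : Fin 6) (u : ℝ) : Plane :=
  ![(1 - u, u), (-u, 1), (-1, 1 - u), (-(1 - u), -u), (u, -1), (1, u - 1)] k

theorem continuous_sidePt (k : Fin 6) : Continuous (sidePt k) := by
  have : sidePt k = fun u => sidePt k u := rfl
  rw [this]
  fin_cases k <;> simp only [sidePt] <;> simp <;> refine ⟨?_, ?_⟩ <;> fun_prop

theorem sidePt_mem_openSide (k : Fin 6) {u : ℝ} (h0 : 0 < u) (h1 : u < 1) :
    sidePt k u ∈ openSide k := by
  refine ⟨?_, fun l hl => ?_⟩
  · fin_cases k <;> simp [form, sidePt]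
  · fin_cases k <;> fin_cases l <;>
      first
        | exact absurd rfl hl
        | (simp [form, sidePt]; try linarith)

/-- Where the leaf at height `t` of the straight band of kind `c` starts. -/
def pos₁ (c : Fin 9) (t : ℝ) : ℝ := if c < 6 then (2 + t) / 3 else (1 + t) / 3

/-- Where the leaf at height `t` of the straight band of kind `c` ends. -/
def pos₂ (c : Fin 9) (t : ℝ) : ℝ := if c < 6 then (1 - t) / 3 else (2 - t) / 3

/-- The straight band of kind `c`; its leaves are straight segments. -/
def stdPt (c : Fin 9) (s t : ℝ) : Plane :=
  (1 - s) • sidePt (end₁ c) (pos₁ c t) + s • sidePt (end₂ c) (pos₂ c t)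

/-- A linear form that is constant on each leaf of the straight band of kind `c`. -/
def height (c : Fin 9) (p : Plane) : ℝ :=
  ![p.1 + p.2, p.2, -p.1, -(p.1 + p.2), -p.2, p.1, p.2 - p.1, -(p.1 + 2 * p.2),
    2 * p.1 + p.2] c

theorem height_segment (c : Fin 9) (p q : Plane) (s : ℝ) :
    height c ((1 - s) • p + s • q) = (1 - s) * height c p + s * height c q := by
  fin_cases c <;> simp [height] <;> ring

/-- The value of `height c` on a leaf of the straight band. -/
def level (c : Fin 9) (t : ℝ) : ℝ := if c < 6 then (2 + t) / 3 else (2 * t - 1) / 3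

theorem level_injective (c : Fin 9) : Function.Injective (level c) := by
  intro t t' h
  unfold level at h
  split_ifs at h <;> linarith

theorem height_start (c : Fin 9) (t : ℝ) :
    height c (sidePt (end₁ c) (pos₁ c t)) = level c t := by
  fin_cases c <;> simp [height, sidePt, end₁, pos₁, level] <;> ring

theorem height_end (c : Fin 9) (t : ℝ) :
    height c (sidePt (end₂ c) (pos₂ c t)) = level c t := by
  fin_cases c <;> simp [height, sidePt, end₂, pos₂, level] <;> ring

theorem height_stdPt (c : Fin 9) (s t : ℝ) : height c (stdPt c s t) = level c t := by
  rw [stdPt, height_segment, height_start, height_end]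
  ring

theorem pos₁_mem (c : Fin 9) {t : ℝ} (h0 : 0 < t) (h1 : t < 1) : 0 < pos₁ c t ∧ pos₁ c t < 1 := by
  unfold pos₁
  split_ifs <;> constructor <;> linarith

theorem pos₂_mem (c : Fin 9) {t : ℝ} (h0 : 0 < t) (h1 : t < 1) : 0 < pos₂ c t ∧ pos₂ c t < 1 := by
  unfold pos₂
  split_ifs <;> constructor <;> linarith

theorem continuous_stdPt (c : Fin 9) : Continuous fun x : I × I => stdPt c x.1 x.2 := by
  have h1 := continuous_sidePt (end₁ c)
  have h2 := continuous_sidePt (end₂ c)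
  have h3 : Continuous (pos₁ c) := by unfold pos₁; split_ifs <;> fun_prop
  have h4 : Continuous (pos₂ c) := by unfold pos₂; split_ifs <;> fun_prop
  unfold stdPt
  fun_prop

theorem start_mem (c : Fin 9) {t : I} (ht : t ∈ Set.Ioo (0 : I) 1) :
    sidePt (end₁ c) (pos₁ c t) ∈ openSide (end₁ c) :=
  have h := pos₁_mem c (show (0 : ℝ) < t from ht.1) (show (t : ℝ) < 1 from ht.2)
  sidePt_mem_openSide _ h.1 h.2

theorem end_mem (c : Fin 9) {t : I} (ht : t ∈ Set.Ioo (0 : I) 1) :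
    sidePt (end₂ c) (pos₂ c t) ∈ openSide (end₂ c) :=
  have h := pos₂_mem c (show (0 : ℝ) < t from ht.1) (show (t : ℝ) < 1 from ht.2)
  sidePt_mem_openSide _ h.1 h.2

theorem stdPt_mem_inner (c : Fin 9) {s t : I} (hs : s ∈ Set.Ioo (0 : I) 1)
    (ht : t ∈ Set.Ioo (0 : I) 1) : stdPt c s t ∈ inner := by
  intro k
  have hs0 : (0 : ℝ) < s := hs.1
  have hs1 : (s : ℝ) < 1 := hs.2
  have h1 := start_mem c ht
  have h2 := end_mem c ht
  rw [stdPt, form_segment]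
  by_cases hk : k = end₁ c
  · subst hk
    have h3 := h2.2 _ (nonAdjacent_ends c).1
    rw [h1.1]
    nlinarith
  · have h3 := h1.2 k hk
    have h4 := form_le_one_of_openSide h2 k
    nlinarith

theorem stdPt_injOn (c : Fin 9) {s s' t t' : I} (ht : t ∈ Set.Ioo (0 : I) 1)
    (h : stdPt c s t = stdPt c s' t') : s = s' ∧ t = t' := by
  have h1 := congrArg (height c) h
  rw [height_stdPt, height_stdPt] at h1
  have h2 : t = t' := Subtype.ext (level_injective c h1)
  subst h2
  refine ⟨?_, rfl⟩
  have h3 := congrArg (form (end₁ c)) h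
  rw [stdPt, stdPt, form_segment, form_segment, (start_mem c ht).1] at h3
  have h4 := (end_mem c ht).2 _ (nonAdjacent_ends c).1
  have h5 : ((s : ℝ) - s') * (1 - form (end₁ c) (sidePt (end₂ c) (pos₂ c t))) = 0 := by
    linarith
  rcases mul_eq_zero.1 h5 with h6 | h6
  · exact Subtype.ext (by linarith)
  · linarith

/-- The straight band of kind `c`. -/
def stdBand (c : Fin 9) : Band where
  map := ⟨_, continuous_stdPt c⟩
  src := end₁ c
  tgt := end₂ c
  map_mem := by
    have hc : IsClosed ((fun x : I × I => stdPt c x.1 x.2) ⁻¹' hexagon) :=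
      isClosed_hexagon.preimage (continuous_stdPt c)
    intro x
    have h1 : x ∈ closure (Set.Ioo (0 : I) 1 ×ˢ Set.Ioo (0 : I) 1) := by
      rw [closure_prod_eq, closure_Ioo (by simp)]
      exact ⟨⟨unitInterval.nonneg', unitInterval.le_one'⟩,
        ⟨unitInterval.nonneg', unitInterval.le_one'⟩⟩
    exact closure_minimal (fun y hy => show stdPt c y.1 y.2 ∈ hexagon from
      inner_subset_hexagon (stdPt_mem_inner c hy.1 hy.2)) hc h1
  injOn := by
    intro x hx y _ hxy
    have := stdPt_injOn c hx.2 hxy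
    exact Prod.ext this.1 this.2
  map_zero t ht := by simpa [stdPt] using start_mem c ht
  map_one t ht := by simpa [stdPt] using end_mem c ht
  map_inner s hs t ht := stdPt_mem_inner c hs ht
  essential t _ h := (nullHomotopicFrom_iff.1 h).2 (nonAdjacent_ends c)

theorem stdBand_kind (c : Fin 9) : (stdBand c).kind = c := kind_ends c

/-- Each side is divided into thirds: bands around a neighbouring side end in the third next to it,
long bands in the middle third. The band around side `k` fills the region where its form exceeds
2/3, and by linearity it suffices to check the ends of the other bands. -/
theorem form_stdPt_le (k c : Fin 9) (hk : k < 6) (hkc : c ≠ k) (hc : ¬ Cross k c) (s t : I) :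
    height k (stdPt c s t) ≤ 2 / 3 := by
  have ht0 := t.2.1
  have ht1 := t.2.2
  have h : height k (sidePt (end₁ c) (pos₁ c t)) ≤ 2 / 3 ∧
      height k (sidePt (end₂ c) (pos₂ c t)) ≤ 2 / 3 := by
    revert hk hkc hc
    fin_cases k <;> fin_cases c <;>
      first
        | (intro hk; exact absurd hk (by decide))
        | (intro _ hkc; exact absurd rfl hkc)
        | (intro _ _ hc; exact absurd (by decide) hc)
        | (intro _ _ _
           constructor <;> simp [height, sidePt, end₁, end₂, pos₁, pos₂] <;> linarith)
  rw [stdPt, height_segment]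
  nlinarith [h.1, h.2, s.2.1, s.2.2]

theorem cross_comm : ∀ b c, Cross b c ↔ Cross c b := by decide

theorem not_cross_self : ∀ c, ¬ Cross c c := by decide

theorem cross_of_long : ∀ b c : Fin 9, ¬ b < 6 → ¬ c < 6 → b ≠ c → Cross b c := by decide

/-- Two different long kinds always cross, so one of the two bands cuts off a side and the level 2/3
of the form of that side separates them. -/
theorem stdBand_disjoint {b c : Fin 9} (hbc : b ≠ c) (h : ¬ Cross b c) :
    Disjoint (stdBand b).support (stdBand c).support := by
  wlog hb : b < 6 generalizing b c
  · by_cases hc : c < 6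
    · exact (this hbc.symm (fun h' => h ((cross_comm _ _).1 h')) hc).symm
    · exact absurd (cross_of_long b c hb hc hbc) h
  rw [Set.disjoint_left]
  rintro x ⟨⟨s, t⟩, ht, rfl⟩ ⟨⟨s', t'⟩, -, hx⟩
  have h1 := form_stdPt_le b c hb hbc.symm h s' t'
  have h2 : stdPt c s' t' = stdPt b s t := hx
  rw [h2, height_stdPt, level, if_pos hb] at h1
  have h3 : (0 : ℝ) < t := ht.2.1
  linarith

/-- Along a middle leaf of a crossing kind the linear form `height b` is thus not constant, so that
this segment meets each leaf of the band `b` at most once. -/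
theorem height_ends_ne : ∀ b c : Fin 9, Cross b c →
    height b (sidePt (end₁ c) (pos₁ c (1 / 2))) ≠ height b (sidePt (end₂ c) (pos₂ c (1 / 2))) := by
  intro b c
  fin_cases b <;> fin_cases c <;>
    first
      | (intro h; exact absurd h (by decide))
      | (intro _; simp [height, sidePt, end₁, end₂, pos₁, pos₂]; norm_num)

/-! ### Cutting bands along leaves -/

/-- The affine interpolation between two points of the unit interval. -/
def lerp (lo hi t : I) : I :=
  ⟨(1 - (t : ℝ)) * lo + t * hi, by
    have := lo.2.1; have := hi.2.1; have := t.2.1; have := t.2.2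
    nlinarith [mul_nonneg (sub_nonneg.2 t.2.2) lo.2.1, mul_nonneg t.2.1 hi.2.1], by
    nlinarith [mul_nonneg (sub_nonneg.2 t.2.2) (sub_nonneg.2 lo.2.2),
      mul_nonneg t.2.1 (sub_nonneg.2 hi.2.2)]⟩

theorem lerp_mem_Ioo {lo hi : I} (h : lo < hi) {t : I} (ht : t ∈ Set.Ioo (0 : I) 1) :
    lerp lo hi t ∈ Set.Ioo lo hi := by
  have h2 : (lo : ℝ) < hi := h
  have ht0 : (0 : ℝ) < t := ht.1
  have ht1 : (t : ℝ) < 1 := ht.2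
  constructor
  · show (lo : ℝ) < (1 - (t : ℝ)) * lo + t * hi
    nlinarith
  · show (1 - (t : ℝ)) * lo + t * hi < (hi : ℝ)
    nlinarith

theorem Ioo_subset_Ioo_zero_one (lo hi : I) : Set.Ioo lo hi ⊆ Set.Ioo (0 : I) 1 :=
  Set.Ioo_subset_Ioo unitInterval.nonneg' unitInterval.le_one'

theorem lerp_mem {lo hi : I} (h : lo < hi) {t : I} (ht : t ∈ Set.Ioo (0 : I) 1) :
    lerp lo hi t ∈ Set.Ioo (0 : I) 1 :=
  Ioo_subset_Ioo_zero_one _ _ (lerp_mem_Ioo h ht)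

theorem lerp_injective {lo hi : I} (h : lo < hi) : Function.Injective (lerp lo hi) := by
  intro t t' he
  have h1 : (1 - (t : ℝ)) * lo + t * hi = (1 - (t' : ℝ)) * lo + t' * hi :=
    congrArg Subtype.val he
  have h2 : (lo : ℝ) < hi := h
  have h3 : ((t : ℝ) - t') * (hi - lo) = 0 := by linarith
  rcases mul_eq_zero.1 h3 with h4 | h4
  · exact Subtype.ext (by linarith)
  · linarith

theorem continuous_lerp (lo hi : I) : Continuous (lerp lo hi) := by
  unfold lerp
  fun_prop

/-- The restriction of a band to the leaves between two heights. -/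
def Band.sub (R : Band) (lo hi : I) (h : lo < hi) : Band where
  map := ⟨fun x => R.map (x.1, lerp lo hi x.2), by
    have := continuous_lerp lo hi
    fun_prop⟩
  src := R.src
  tgt := R.tgt
  map_mem _ := R.map_mem _
  injOn := by
    rintro ⟨s, t⟩ ht ⟨s', t'⟩ ht' he
    have h1 := R.injOn
      (show (s, lerp lo hi t) ∈ Set.univ ×ˢ Set.Ioo (0 : I) 1 from ⟨trivial, lerp_mem h ht.2⟩)
      (show (s', lerp lo hi t') ∈ Set.univ ×ˢ Set.Ioo (0 : I) 1 from ⟨trivial, lerp_mem h ht'.2⟩)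
      he
    have h2 : s = s' := congrArg Prod.fst h1
    have h3 : t = t' := lerp_injective h (congrArg Prod.snd h1)
    rw [h2, h3]
  map_zero _ ht := R.map_zero _ (lerp_mem h ht)
  map_one _ ht := R.map_one _ (lerp_mem h ht)
  map_inner s hs _ ht := R.map_inner s hs _ (lerp_mem h ht)
  essential _ _ hn := (nullHomotopicFrom_iff.1 hn).2 R.nonAdjacent

theorem Band.sub_kind (R : Band) {lo hi : I} (h : lo < hi) : (R.sub lo hi h).kind = R.kind := rfl

theorem Band.sub_map (R : Band) {lo hi : I} (h : lo < hi) (s t t' : I)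
    (ht : (t' : ℝ) = (1 - (t : ℝ)) * lo + t * hi) : (R.sub lo hi h).map (s, t) = R.map (s, t') := by
  have : t' = lerp lo hi t := Subtype.ext ht
  rw [this]
  rfl

theorem Band.mem_sub_support (R : Band) {lo hi : I} (h : lo < hi) {x : Plane}
    (hx : x ∈ (R.sub lo hi h).support) : ∃ s t, t ∈ Set.Ioo lo hi ∧ R.map (s, t) = x := by
  obtain ⟨⟨s, t⟩, ht, rfl⟩ := hx
  exact ⟨s, lerp lo hi t, lerp_mem_Ioo h ht.2, rfl⟩

theorem Band.sub_support_subset (R : Band) {lo hi : I} (h : lo < hi) :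
    (R.sub lo hi h).support ⊆ R.support := by
  intro x hx
  obtain ⟨s, t, ht, rfl⟩ := R.mem_sub_support h hx
  exact ⟨(s, t), ⟨trivial, Ioo_subset_Ioo_zero_one _ _ ht⟩, rfl⟩

theorem Band.sub_disjoint (R : Band) {lo hi lo' hi' : I} (h : lo < hi) (h' : lo' < hi')
    (hle : hi ≤ lo') : Disjoint (R.sub lo hi h).support (R.sub lo' hi' h').support := by
  rw [Set.disjoint_left]
  intro x hx hx'
  obtain ⟨s, t, ht, rfl⟩ := R.mem_sub_support h hx
  obtain ⟨s', t', ht', he⟩ := R.mem_sub_support h' hx'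
  have h1 := R.injOn
    (show (s', t') ∈ Set.univ ×ˢ Set.Ioo (0 : I) 1 from
      ⟨trivial, Ioo_subset_Ioo_zero_one _ _ ht'⟩)
    (show (s, t) ∈ Set.univ ×ˢ Set.Ioo (0 : I) 1 from
      ⟨trivial, Ioo_subset_Ioo_zero_one _ _ ht⟩) he
  have h2 : t' = t := congrArg Prod.snd h1
  subst h2
  exact absurd (ht.2.trans_le hle) (not_lt_of_ge ht'.1.le)

/-! ### Normal form of a measured foliation -/

/-- Leaves of crossing kinds would have a common point, while the supports of different bands are
disjoint. -/
theorem MeasuredFoliation.not_cross (F : MeasuredFoliation) (k l : Fin F.n) :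
    ¬ Cross (F.band k).kind (F.band l).kind := by
  intro h
  obtain ⟨t, ht⟩ := exists_mem_Ioo
  obtain ⟨s, s', hs⟩ := ((F.band k).properlyJoins ht).exists_common_point
    ((F.band l).properlyJoins ht) (F.band k).nonAdjacent (F.band l).nonAdjacent h
  have hkl : k ≠ l := by
    rintro rfl
    exact not_cross_self _ h
  exact Set.disjoint_left.1 (F.disjoint hkl) ⟨(s, t), ⟨trivial, ht⟩, rfl⟩
    ⟨(s', t), ⟨trivial, ht⟩, hs.symm⟩

/-- A foliation by straight bands of distinct kinds that do not cross. -/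
def straight {n : ℕ} (hn : 0 < n) (κ : Fin n → Fin 9) (v : Fin n → ℝ) (hv : ∀ k, 0 < v k)
    (hκ : ∀ k l, k ≠ l → κ k ≠ κ l ∧ ¬ Cross (κ k) (κ l)) : MeasuredFoliation where
  n := n
  n_pos := hn
  band k := stdBand (κ k)
  width := v
  width_pos := hv
  disjoint k l hkl := stdBand_disjoint (hκ k l hkl).1 (hκ k l hkl).2

/-- Bands of the same kind can be joined to a single straight band. -/
theorem MeasuredFoliation.toMF_eq_straight (F : MeasuredFoliation) {n : ℕ} (hn : 0 < n)
    (κ : Fin n → Fin 9) (v : Fin n → ℝ) (hv : ∀ k, 0 < v k)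
    (hκ : ∀ k l, k ≠ l → κ k ≠ κ l ∧ ¬ Cross (κ k) (κ l))
    (p : Fin F.n → Fin n) (hp : ∀ k, κ (p k) = (F.band k).kind)
    (hsum : ∀ j, v j = ∑ k with p k = j, F.width k) :
    F.toMF = (straight hn κ v hv hκ).toMF := by
  -- The bands of one kind are stacked in the order of their indices: `below k` is the total width
  -- of those that come before band `k`, and dividing by the total width `v (p k)` gives the heights
  -- at which the straight band is cut.
  let below : Fin F.n → ℝ := fun k => ∑ l with p l = p k ∧ l < k, F.width l
  have hbelow0 : ∀ k, 0 ≤ below k := fun k => Finset.sum_nonneg fun l _ => (F.width_pos l).le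
  have hins : ∀ k, below k + F.width k =
      ∑ m ∈ insert k ({m | p m = p k ∧ m < k} : Finset (Fin F.n)), F.width m := fun k => by
    rw [Finset.sum_insert (by simp), add_comm]
  have hstep : ∀ k l, p k = p l → k < l → below k + F.width k ≤ below l := by
    intro k l hkl h
    rw [hins]
    refine Finset.sum_le_sum_of_subset_of_nonneg (fun m hm => ?_) fun m _ _ => (F.width_pos m).le
    rcases Finset.mem_insert.1 hm with rfl | hm
    · simp [hkl, h]
    · have := (Finset.mem_filter.1 hm).2
      simp [this.1, hkl, this.2.trans h]
  have htop : ∀ k, below k + F.width k ≤ v (p k) := by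
    intro k
    rw [hins, hsum]
    refine Finset.sum_le_sum_of_subset_of_nonneg (fun m hm => ?_) fun m _ _ => (F.width_pos m).le
    rcases Finset.mem_insert.1 hm with rfl | hm
    · simp
    · simp [(Finset.mem_filter.1 hm).2.1]
  let lo : Fin F.n → I := fun k => ⟨below k / v (p k), div_nonneg (hbelow0 k) (hv _).le,
    (div_le_one (hv _)).2 (by linarith [htop k, F.width_pos k])⟩
  let hi : Fin F.n → I := fun k => ⟨(below k + F.width k) / v (p k),
    div_nonneg (by linarith [hbelow0 k, F.width_pos k]) (hv _).le,
    (div_le_one (hv _)).2 (htop k)⟩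
  have hlt : ∀ k, lo k < hi k := fun k =>
    show below k / v (p k) < (below k + F.width k) / v (p k) from
      div_lt_div_of_pos_right (by linarith [F.width_pos k]) (hv _)
  have hdiff : ∀ k, (hi k : ℝ) - lo k = F.width k / v (p k) := fun k => by
    simp only [hi, lo]
    ring
  have hord : ∀ k l, p k = p l → k < l → hi k ≤ lo l := by
    intro k l hkl h
    show (below k + F.width k) / v (p k) ≤ below l / v (p l)
    rw [hkl]
    exact div_le_div_of_nonneg_right (hstep k l hkl h) (hv _).le
  -- The intermediate foliation has the widths of `F` and is made of slices of straight bands. It is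
  -- homotopic to `F` band by band, since only kinds matter, and it is a subdivision of the straight
  -- foliation.
  let G : MeasuredFoliation :=
    { n := F.n
      n_pos := F.n_pos
      band := fun k => (stdBand (κ (p k))).sub (lo k) (hi k) (hlt k)
      width := F.width
      width_pos := F.width_pos
      disjoint := by
        intro k l hkl
        by_cases h : p k = p l
        · show Disjoint ((stdBand (κ (p k))).sub (lo k) (hi k) (hlt k)).support
            ((stdBand (κ (p l))).sub (lo l) (hi l) (hlt l)).support
          rw [h]
          rcases lt_or_gt_of_ne hkl with h' | h'
          · exact Band.sub_disjoint _ _ _ (hord k l h h')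
          · exact (Band.sub_disjoint _ _ _ (hord l k h.symm h')).symm
        · exact (stdBand_disjoint (hκ _ _ h).1 (hκ _ _ h).2).mono
            (Band.sub_support_subset _ _) (Band.sub_support_subset _ _) }
  have hkind : ∀ k, (F.band k).kind =
      ((stdBand (κ (p k))).sub (lo k) (hi k) (hlt k)).kind := fun k => by
    rw [Band.sub_kind, stdBand_kind, hp]
  have h1 : F.Homotopic G :=
    MeasuredFoliation.homotopic_of_kind (Equiv.refl _) (fun _ => rfl) hkind
  have h2 : G.Subdivides (straight hn κ v hv hκ) := by
    refine ⟨p, lo, hi, hlt, fun k s t t' ht => Band.sub_map _ (hlt k) s t t' ht, fun k => ?_,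
      fun j => ?_⟩
    · show F.width k = ((hi k : ℝ) - lo k) * v (p k)
      rw [hdiff, div_mul_cancel₀ _ (hv _).ne']
    · change Fin n at j
      calc ∑ k with p k = j, ((hi k : ℝ) - lo k)
          = ∑ k with p k = j, F.width k / v j := by
            refine Finset.sum_congr rfl fun k hk => ?_
            rw [hdiff, (Finset.mem_filter.1 hk).2]
        _ = 1 := by rw [← Finset.sum_div, ← hsum, div_self (hv j).ne']
  have e1 : F.toMF = G.toMF := Quot.sound (Or.inr h1)
  have e2 : G.toMF = (straight hn κ v hv hκ).toMF := Quot.sound (Or.inl h2)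
  exact e1.trans e2

/-- Weights of arc kinds, not all zero, positive only on kinds that do not cross each other. -/
structure Admissible (w : Fin 9 → ℝ) : Prop where
  nonneg : ∀ c, 0 ≤ w c
  ne_zero : w ≠ 0
  not_cross : ∀ b c, w b ≠ 0 → w c ≠ 0 → ¬ Cross b c

theorem MeasuredFoliation.admissible (F : MeasuredFoliation) :
    Admissible fun c => F.leafMeasure (classOf c) := by
  have hne : ∀ c, F.leafMeasure (classOf c) ≠ 0 → ∃ k, (F.band k).kind = c := by
    intro c hc
    rw [F.leafMeasure_eq, kind_classOf] at hc
    obtain ⟨k, -, hk⟩ := Finset.exists_ne_zero_of_sum_ne_zero hc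
    exact ⟨k, by_contra fun h => hk (if_neg h)⟩
  refine ⟨fun c => ?_, fun h => ?_, fun b c hb hc => ?_⟩
  · simp only [F.leafMeasure_eq]
    exact Finset.sum_nonneg fun k _ => by split_ifs <;> simp [(F.width_pos k).le]
  · have h1 := congrFun h (F.band ⟨0, F.n_pos⟩).kind
    simp only [F.leafMeasure_eq, kind_classOf, Pi.zero_apply] at h1
    rw [Finset.sum_eq_zero_iff_of_nonneg
      (fun k _ => by split_ifs <;> simp [(F.width_pos k).le])] at h1
    have h2 := h1 ⟨0, F.n_pos⟩ (Finset.mem_univ _)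
    rw [if_pos rfl] at h2
    exact (F.width_pos _).ne' h2
  · obtain ⟨k, rfl⟩ := hne b hb
    obtain ⟨l, rfl⟩ := hne c hc
    exact F.not_cross k l

/-- The kinds of positive weight. -/
def weightSupport (w : Fin 9 → ℝ) : Finset (Fin 9) := {c | w c ≠ 0}

theorem weightSupport_symm_ne (w : Fin 9 → ℝ) (k : Fin (weightSupport w).card) :
    w ((weightSupport w).equivFin.symm k).1 ≠ 0 :=
  (Finset.mem_filter.1 ((weightSupport w).equivFin.symm k).2).2

/-- The straight foliation with given weights. -/
def stdFoliation (w : Fin 9 → ℝ) (hw : Admissible w) : MeasuredFoliation :=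
  straight (n := (weightSupport w).card)
    (by
      rw [Finset.card_pos]
      obtain ⟨c, hc⟩ := Function.ne_iff.1 hw.ne_zero
      exact ⟨c, Finset.mem_filter.2 ⟨Finset.mem_univ _, hc⟩⟩)
    (fun k => ((weightSupport w).equivFin.symm k).1)
    (fun k => w ((weightSupport w).equivFin.symm k).1)
    (fun k => lt_of_le_of_ne (hw.nonneg _) (weightSupport_symm_ne w k).symm)
    (fun k l hkl => ⟨fun h => hkl ((weightSupport w).equivFin.symm.injective (Subtype.ext h)),
      hw.not_cross _ _ (weightSupport_symm_ne w k) (weightSupport_symm_ne w l)⟩)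

/-- Only kinds of nonzero weight carry a band; the condition `f R 0 = 0` allows the sum to run over
all nine kinds. -/
theorem stdFoliation_sum {M : Type*} [AddCommMonoid M] (w : Fin 9 → ℝ) (hw : Admissible w)
    (f : Band → ℝ → M) (hf : ∀ R, f R 0 = 0) :
    ∑ k, f ((stdFoliation w hw).band k) ((stdFoliation w hw).width k) =
      ∑ c, f (stdBand c) (w c) := by
  have h1 : ∑ k, f ((stdFoliation w hw).band k) ((stdFoliation w hw).width k) =
      ∑ c : weightSupport w, f (stdBand c) (w c) :=
    Equiv.sum_comp (weightSupport w).equivFin.symm fun c : weightSupport w => f (stdBand c) (w c)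
  rw [h1, Finset.sum_coe_sort (weightSupport w) fun c => f (stdBand c) (w c), weightSupport,
    Finset.sum_filter]
  refine Finset.sum_congr rfl fun c _ => ?_
  by_cases h : w c = 0
  · rw [if_neg (not_not.2 h), h, hf]
  · rw [if_pos h]

theorem leafMeasure_stdFoliation (w : Fin 9 → ℝ) (hw : Admissible w) (c : ArcClass) :
    (stdFoliation w hw).leafMeasure c = w c.kind := by
  rw [MeasuredFoliation.leafMeasure_eq,
    stdFoliation_sum w hw (fun R x => if R.kind = c.kind then x else 0) (by simp)]
  simp [stdBand_kind]

/-- Normal form: the class of a foliation depends only on its weights, because its bands can be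
merged kind by kind. -/
theorem MeasuredFoliation.toMF_eq_std (F : MeasuredFoliation) :
    F.toMF = (stdFoliation _ F.admissible).toMF := by
  have hW : ∀ c, F.leafMeasure (classOf c) = ∑ k with (F.band k).kind = c, F.width k := by
    intro c
    rw [F.leafMeasure_eq, kind_classOf, Finset.sum_filter]
  have hmem : ∀ k, (F.band k).kind ∈ weightSupport fun c => F.leafMeasure (classOf c) := by
    intro k
    refine Finset.mem_filter.2 ⟨Finset.mem_univ _, ?_⟩
    exact (hW _).trans_ne (Finset.sum_pos (fun l _ => F.width_pos l) ⟨k, by simp⟩).ne'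
  refine F.toMF_eq_straight _ _ _ _ _
    (fun k => (weightSupport fun c => F.leafMeasure (classOf c)).equivFin ⟨_, hmem k⟩)
    (fun k => by rw [Equiv.symm_apply_apply]) (fun j => ?_)
  refine (hW _).trans (Finset.sum_congr (Finset.filter_congr fun k _ => ?_) fun _ _ => rfl)
  rw [← Equiv.eq_symm_apply, Subtype.ext_iff]

/-! ### Intersection numbers -/

/-- The leaf of a band at height `t`, as an arc. -/
def Band.leafArc (R : Band) (t : I) (ht : t ∈ Set.Ioo (0 : I) 1) : Arc where
  path := R.leaf t
  src := R.src
  tgt := R.tgt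
  nonAdjacent := R.nonAdjacent
  injective s s' h := congrArg Prod.fst (R.injOn
    (show (s, t) ∈ Set.univ ×ˢ Set.Ioo (0 : I) 1 from ⟨trivial, ht⟩)
    (show (s', t) ∈ Set.univ ×ˢ Set.Ioo (0 : I) 1 from ⟨trivial, ht⟩) h)
  path_zero := R.map_zero t ht
  path_one := R.map_one t ht
  path_inner s hs := R.map_inner s hs t ht

/-- The height of the middle leaf. -/
def mid : I := ⟨1 / 2, by norm_num, by norm_num⟩

theorem mid_mem : mid ∈ Set.Ioo (0 : I) 1 :=
  ⟨show (0 : ℝ) < 1 / 2 by norm_num, show (1 / 2 : ℝ) < 1 by norm_num⟩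

/-- The middle leaf of the straight band of kind `c`. -/
def stdArc (c : Fin 9) : Arc := (stdBand c).leafArc mid mid_mem

theorem stdArc_toClass (c : Fin 9) : (stdArc c).toClass = classOf c := by
  rw [Arc.toClass_eq_classOf]
  exact congrArg classOf (kind_ends c)

/-- The matrix of the crossing relation. -/
def crossing (b c : Fin 9) : ℝ := if Cross b c then 1 else 0

/-- Every interior leaf of a kind crossing that of `δ` meets `δ` at least once. The boundary leaves,
about which nothing is claimed, have measure zero. -/
theorem MeasuredFoliation.le_transverseMeasure (F : MeasuredFoliation) (δ : Arc) :
    ENNReal.ofReal (∑ b, F.leafMeasure (classOf b) * crossing b δ.kind) ≤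
      F.transverseMeasure δ := by
  have h1 : ∑ b, F.leafMeasure (classOf b) * crossing b δ.kind =
      ∑ k, F.width k * crossing (F.band k).kind δ.kind := by
    simp only [F.leafMeasure_eq, kind_classOf, Finset.sum_mul, ite_mul, zero_mul]
    rw [Finset.sum_comm]
    simp
  rw [h1, ENNReal.ofReal_sum_of_nonneg fun k _ => mul_nonneg (F.width_pos k).le
    (by unfold crossing; split_ifs <;> norm_num)]
  refine Finset.sum_le_sum fun k _ => ?_
  rw [ENNReal.ofReal_mul (F.width_pos k).le]
  gcongr
  unfold crossing
  split_ifs with h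
  · have h2 : ∫⁻ _ : I, (1 : ENNReal) = 1 := by simp
    rw [ENNReal.ofReal_one, ← h2]
    refine MeasureTheory.lintegral_mono_ae ?_
    have h3 : ∀ᵐ t : I, t ≠ 0 := MeasureTheory.Measure.ae_ne _ _
    have h4 : ∀ᵐ t : I, t ≠ 1 := MeasureTheory.Measure.ae_ne _ _
    filter_upwards [h3, h4] with t h0 h1
    have ht : t ∈ Set.Ioo (0 : I) 1 := ((unitInterval_cases t).resolve_left h0).resolve_left h1
    obtain ⟨s, s', hs⟩ := ((F.band k).properlyJoins ht).exists_common_point δ.properlyJoins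
      (F.band k).nonAdjacent δ.nonAdjacent h
    have h5 : (1 : ℕ∞) ≤ (δ.path ⁻¹' Set.range ((F.band k).leaf t)).encard := by
      rw [Set.one_le_encard_iff_nonempty]
      exact ⟨s', s, hs⟩
    exact_mod_cast h5
  · simp

/-- Straight position attains the minimum. In the crossing case a leaf and the middle leaf meet at
most once; otherwise they are disjoint, except for the single height `mid` when the two kinds
coincide. -/
theorem lintegral_stdBand_le (b c : Fin 9) :
    ∫⁻ t : I, (((stdArc c).path ⁻¹' Set.range ((stdBand b).leaf t)).encard : ENNReal) ≤
      ENNReal.ofReal (crossing b c) := by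
  unfold crossing
  split_ifs with h
  · have h2 : ∫⁻ _ : I, (1 : ENNReal) = 1 := by simp
    rw [ENNReal.ofReal_one, ← h2]
    refine MeasureTheory.lintegral_mono fun t => ?_
    have h5 : ((stdArc c).path ⁻¹' Set.range ((stdBand b).leaf t)).encard ≤ 1 := by
      rw [Set.encard_le_one_iff]
      rintro s s' ⟨u, hu⟩ ⟨u', hu'⟩
      have e1 : stdPt b u t = stdPt c s (1 / 2) := hu
      have e2 : stdPt b u' t = stdPt c s' (1 / 2) := hu'
      have e3 := congrArg (height b) e1
      have e4 := congrArg (height b) e2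
      rw [height_stdPt, stdPt, height_segment] at e3 e4
      have e5 := height_ends_ne b c h
      have e6 : ((s : ℝ) - s') * (height b (sidePt (end₁ c) (pos₁ c (1 / 2))) -
          height b (sidePt (end₂ c) (pos₂ c (1 / 2)))) = 0 := by linarith
      rcases mul_eq_zero.1 e6 with e7 | e7
      · exact Subtype.ext (by linarith)
      · exact absurd (by linarith) e5
    simpa using ENat.toENNReal_le.2 h5
  · rw [ENNReal.ofReal_zero, nonpos_iff_eq_zero]
    refine MeasureTheory.lintegral_eq_zero_of_ae_eq_zero ?_
    have h3 : ∀ᵐ t : I, t ≠ 0 := MeasureTheory.Measure.ae_ne _ _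
    have h4 : ∀ᵐ t : I, t ≠ 1 := MeasureTheory.Measure.ae_ne _ _
    have h5 : ∀ᵐ t : I, t ≠ mid := MeasureTheory.Measure.ae_ne _ _
    filter_upwards [h3, h4, h5] with t h0 h1 hmid
    have ht : t ∈ Set.Ioo (0 : I) 1 := ((unitInterval_cases t).resolve_left h0).resolve_left h1
    have h6 : (stdArc c).path ⁻¹' Set.range ((stdBand b).leaf t) = ∅ := by
      rw [Set.eq_empty_iff_forall_notMem]
      rintro s ⟨u, hu⟩
      by_cases hbc : b = c
      · subst hbc
        exact hmid (stdPt_injOn b ht (s' := s) (t' := mid) hu).2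
      · exact Set.disjoint_left.1 (stdBand_disjoint hbc h) ⟨(u, t), ⟨trivial, ht⟩, hu⟩
          ⟨(s, mid), ⟨trivial, mid_mem⟩, rfl⟩
    rw [h6]
    simp

theorem transverseMeasure_stdFoliation_le (w : Fin 9 → ℝ) (hw : Admissible w) (c : Fin 9) :
    (stdFoliation w hw).transverseMeasure (stdArc c) ≤
      ENNReal.ofReal (∑ b, w b * crossing b c) := by
  rw [MeasuredFoliation.transverseMeasure, stdFoliation_sum w hw (fun R x => ENNReal.ofReal x *
    ∫⁻ t : I, (((stdArc c).path ⁻¹' Set.range (R.leaf t)).encard : ENNReal)) (by simp),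
    ENNReal.ofReal_sum_of_nonneg fun b _ => mul_nonneg (hw.nonneg b)
      (by unfold crossing; split_ifs <;> norm_num)]
  refine Finset.sum_le_sum fun b _ => ?_
  rw [ENNReal.ofReal_mul (hw.nonneg b)]
  gcongr
  exact lintegral_stdBand_le b c

/-! ### Foliation classes as admissible weight vectors -/

/-- The weights of a class of measured foliations, indexed by the kinds of arcs. -/
def wt (x : MF) (c : Fin 9) : ℝ := weight x (classOf c)

theorem wt_admissible (x : MF) : Admissible (wt x) := by
  induction x using Quot.ind with
  | mk F => exact F.admissible

theorem toMF_std_wt (x : MF) : (stdFoliation (wt x) (wt_admissible x)).toMF = x := by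
  induction x using Quot.ind with
  | mk F => exact F.toMF_eq_std.symm

theorem wt_toMF_std (w : Fin 9 → ℝ) (hw : Admissible w) : wt (stdFoliation w hw).toMF = w := by
  funext c
  exact (leafMeasure_stdFoliation w hw _).trans (by rw [kind_classOf])

theorem wt_injective : Function.Injective wt := by
  intro x y h
  rw [← toMF_std_wt x, ← toMF_std_wt y]
  congr 2

/-- The straight foliation and the straight arc attain the lower bound that holds for all
representatives, because the weights do not depend on the representative. -/
theorem inter_eq (x : MF) (c : ArcClass) :
    inter x c = ENNReal.ofReal (∑ b, wt x b * crossing b c.kind) := by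
  apply le_antisymm
  · refine iInf₂_le_of_le _ (toMF_std_wt x) (iInf₂_le_of_le (stdArc c.kind) ?_
      (transverseMeasure_stdFoliation_le _ _ _))
    rw [stdArc_toClass, classOf_kind]
  · refine le_iInf₂ fun F hF => le_iInf₂ fun δ hδ => ?_
    subst hF hδ
    exact F.le_transverseMeasure δ

theorem coord_eq (x : MF) (c : ArcClass) : coord x c = ∑ b, wt x b * crossing b c.kind := by
  rw [coord, inter_eq, ENNReal.toReal_ofReal]
  exact Finset.sum_nonneg fun b _ => mul_nonneg ((wt_admissible x).nonneg b)
    (by unfold crossing; split_ifs <;> norm_num)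

theorem hasLeaf_iff (x : MF) (c : ArcClass) : HasLeaf x c ↔ wt x c.kind ≠ 0 := by
  constructor
  · rintro ⟨F, rfl, k, t, ht, h⟩
    rw [F.leafInClass_iff k ht] at h
    rw [wt, classOf_kind, weight_toMF, F.leafMeasure_eq]
    refine (Finset.sum_pos' (fun l _ => ?_) ⟨k, Finset.mem_univ _, ?_⟩).ne'
    · split_ifs <;> simp [(F.width_pos l).le]
    · rw [if_pos h]
      exact F.width_pos k
  · intro h
    induction x using Quot.ind with
    | mk F =>
      have h1 : F.leafMeasure c ≠ 0 := by
        have : wt (Quot.mk _ F) c.kind = F.leafMeasure (classOf c.kind) := rfl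
        rwa [this, classOf_kind] at h
      rw [F.leafMeasure_eq] at h1
      obtain ⟨k, -, hk⟩ := Finset.exists_ne_zero_of_sum_ne_zero h1
      obtain ⟨t, ht⟩ := exists_mem_Ioo
      exact ⟨F, rfl, k, t, ht, (F.leafInClass_iff k ht c).2 (by_contra fun h => hk (if_neg h))⟩

/-- Arcs that cross cannot be made disjoint; conversely the middle leaves of the straight bands
realize all classes of `S` at once. -/
theorem isArcSystem_iff (S : Set ArcClass) :
    IsArcSystem S ↔ ∀ c ∈ S, ∀ d ∈ S, ¬ Cross c.kind d.kind := by
  constructor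
  · rintro ⟨f, hf, hd⟩ c hc d hdS h
    have hcd : c ≠ d := by
      rintro rfl
      exact not_cross_self _ h
    rw [← hf c hc, ← hf d hdS, Arc.kind_toClass, Arc.kind_toClass] at h
    obtain ⟨s, t, hst⟩ := (f c).properlyJoins.exists_common_point (f d).properlyJoins
      (f c).nonAdjacent (f d).nonAdjacent h
    exact Set.disjoint_left.1 (hd hc hdS hcd) ⟨s, rfl⟩ ⟨t, hst.symm⟩
  · intro h
    refine ⟨fun c => stdArc c.kind, fun c _ => ?_, fun c hc d hd hcd => ?_⟩
    · rw [stdArc_toClass, classOf_kind]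
    · have hne : c.kind ≠ d.kind := fun h => hcd (classEquiv.injective h)
      refine (stdBand_disjoint hne (h c hc d hd)).mono ?_ ?_ <;>
        exact Set.range_subset_iff.2 fun s => ⟨(s, mid), ⟨trivial, mid_mem⟩, rfl⟩

/-! ### Weights and intersection numbers -/

/-- The intersection numbers of the foliation with given weights. -/
def isect (w : Fin 9 → ℝ) (c : Fin 9) : ℝ := ∑ b, w b * crossing b c

/-- The crossing relation as a table. -/
def crossTable : Fin 9 → Fin 9 → Bool :=
  ![![false, true, false, false, false, true, true, false, false],
    ![true, false, true, false, false, false, false, false, true],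
    ![false, true, false, true, false, false, false, true, false],
    ![false, false, true, false, true, false, true, false, false],
    ![false, false, false, true, false, true, false, false, true],
    ![true, false, false, false, true, false, false, true, false],
    ![true, false, false, true, false, false, false, true, true],
    ![false, false, true, false, false, true, true, false, true],
    ![false, true, false, false, true, false, true, true, false]]

theorem cross_iff_crossTable : ∀ b c, Cross b c ↔ crossTable b c = true := by decide

theorem crossing_eq (b c : Fin 9) : crossing b c = if crossTable b c then 1 else 0 := by
  simp only [crossing, cross_iff_crossTable]

theorem isect_table (w : Fin 9 → ℝ) :
    isect w 0 = w 1 + w 5 + w 6 ∧ isect w 1 = w 0 + w 2 + w 8 ∧ isect w 2 = w 1 + w 3 + w 7 ∧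
    isect w 3 = w 2 + w 4 + w 6 ∧ isect w 4 = w 3 + w 5 + w 8 ∧ isect w 5 = w 0 + w 4 + w 7 ∧
    isect w 6 = w 0 + w 3 + w 7 + w 8 ∧ isect w 7 = w 2 + w 5 + w 6 + w 8 ∧
    isect w 8 = w 1 + w 4 + w 6 + w 7 := by
  have h : ∀ c, isect w c = w 0 * crossing 0 c + w 1 * crossing 1 c + w 2 * crossing 2 c +
      w 3 * crossing 3 c + w 4 * crossing 4 c + w 5 * crossing 5 c + w 6 * crossing 6 c +
      w 7 * crossing 7 c + w 8 * crossing 8 c := by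
    intro c
    simp [isect, Fin.sum_univ_succ]
    ring_nf
  simp only [h, crossing_eq]
  refine ⟨?_, ?_, ?_, ?_, ?_, ?_, ?_, ?_, ?_⟩ <;> simp [crossTable]

theorem Admissible.eq_zero {w : Fin 9 → ℝ} (hw : Admissible w) (b c : Fin 9)
    (h : crossTable b c = true) : w b = 0 ∨ w c = 0 := by
  by_contra! h'
  exact hw.not_cross b c h'.1 h'.2 ((cross_iff_crossTable b c).2 h)

theorem Admissible.eq_zero_table {w : Fin 9 → ℝ} (hw : Admissible w) :
    ((w 0 = 0 ∨ w 1 = 0) ∧ (w 0 = 0 ∨ w 5 = 0) ∧ (w 0 = 0 ∨ w 6 = 0)) ∧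
    ((w 1 = 0 ∨ w 2 = 0) ∧ (w 1 = 0 ∨ w 8 = 0)) ∧
    ((w 2 = 0 ∨ w 3 = 0) ∧ (w 2 = 0 ∨ w 7 = 0)) ∧
    ((w 3 = 0 ∨ w 4 = 0) ∧ (w 3 = 0 ∨ w 6 = 0)) ∧
    ((w 4 = 0 ∨ w 5 = 0) ∧ (w 4 = 0 ∨ w 8 = 0)) ∧
    (w 5 = 0 ∨ w 7 = 0) ∧ (w 6 = 0 ∨ w 7 = 0) ∧ (w 6 = 0 ∨ w 8 = 0) ∧ (w 7 = 0 ∨ w 8 = 0) := by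
  refine ⟨⟨?_, ?_, ?_⟩, ⟨?_, ?_⟩, ⟨?_, ?_⟩, ⟨?_, ?_⟩, ⟨?_, ?_⟩, ?_, ?_, ?_, ?_⟩ <;>
    exact hw.eq_zero _ _ rfl

theorem admissible_of_table {w : Fin 9 → ℝ} (h0 : ∀ c, 0 ≤ w c) (hne : w ≠ 0)
    (h : ((w 0 = 0 ∨ w 1 = 0) ∧ (w 0 = 0 ∨ w 5 = 0) ∧ (w 0 = 0 ∨ w 6 = 0)) ∧
    ((w 1 = 0 ∨ w 2 = 0) ∧ (w 1 = 0 ∨ w 8 = 0)) ∧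
    ((w 2 = 0 ∨ w 3 = 0) ∧ (w 2 = 0 ∨ w 7 = 0)) ∧
    ((w 3 = 0 ∨ w 4 = 0) ∧ (w 3 = 0 ∨ w 6 = 0)) ∧
    ((w 4 = 0 ∨ w 5 = 0) ∧ (w 4 = 0 ∨ w 8 = 0)) ∧
    (w 5 = 0 ∨ w 7 = 0) ∧ (w 6 = 0 ∨ w 7 = 0) ∧ (w 6 = 0 ∨ w 8 = 0) ∧ (w 7 = 0 ∨ w 8 = 0)) :
    Admissible w := by
  refine ⟨h0, hne, fun b c hb hc hbc => ?_⟩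
  wlog hlt : b ≤ c generalizing b c
  · exact this c b hc hb ((cross_comm _ _).1 hbc) (le_of_not_ge hlt)
  rw [cross_iff_crossTable] at hbc
  obtain ⟨⟨h1, h2, h3⟩, ⟨h4, h5⟩, ⟨h6, h7⟩, ⟨h8, h9⟩, ⟨h10, h11⟩, h12, h13, h14, h15⟩ := h
  revert hbc hlt hb hc
  fin_cases b <;> fin_cases c <;> intro hb hc hlt hbc <;>
    first
      | exact absurd hlt (by decide)
      | exact absurd hbc (by decide)
      | exact h1.elim hb hc
      | exact h2.elim hb hc
      | exact h3.elim hb hc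
      | exact h4.elim hb hc
      | exact h5.elim hb hc
      | exact h6.elim hb hc
      | exact h7.elim hb hc
      | exact h8.elim hb hc
      | exact h9.elim hb hc
      | exact h10.elim hb hc
      | exact h11.elim hb hc
      | exact h12.elim hb hc
      | exact h13.elim hb hc
      | exact h14.elim hb hc
      | exact h15.elim hb hc

/-- The weights in terms of the intersection numbers. -/
def recover (i : Fin 9 → ℝ) : Fin 9 → ℝ :=
  ![max 0 (i 5 - i 8), max 0 (i 0 - i 7), max 0 (i 1 - i 6), max 0 (i 2 - i 8),
    max 0 (i 3 - i 7), max 0 (i 4 - i 6), i 0 - max 0 (i 0 - i 7) - max 0 (i 4 - i 6),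
    i 2 - max 0 (i 0 - i 7) - max 0 (i 2 - i 8), i 4 - max 0 (i 2 - i 8) - max 0 (i 4 - i 6)]

/-- The basic device: if `x` excludes each subtracted weight, the difference is either `x` itself or
nonpositive. Applied to intersection numbers it isolates a single weight. -/
theorem max_zero_sub {x p q r : ℝ} (hx : 0 ≤ x) (hp : 0 ≤ p) (hq : 0 ≤ q) (hr : 0 ≤ r)
    (h1 : x = 0 ∨ p = 0) (h2 : x = 0 ∨ q = 0) (h3 : x = 0 ∨ r = 0) :
    max 0 (x - p - q - r) = x := by
  by_cases hx0 : x = 0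
  · rw [hx0]
    exact max_eq_left (by linarith)
  · rw [h1.resolve_left hx0, h2.resolve_left hx0, h3.resolve_left hx0]
    simpa using hx

/-- For each kind around a side there are two intersection numbers whose difference is its weight
minus weights of kinds that cross it. The weights of the long kinds are then obtained by
subtraction. -/
theorem recover_isect {w : Fin 9 → ℝ} (hw : Admissible w) : recover (isect w) = w := by
  obtain ⟨e0, e1, e2, e3, e4, e5, e6, e7, e8⟩ := isect_table w
  have hn := hw.nonneg
  obtain ⟨⟨h1, h2, h3⟩, ⟨h4, h5⟩, ⟨h6, h7⟩, ⟨h8, h9⟩, ⟨h10, h11⟩, h12, h13, h14, h15⟩ :=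
    hw.eq_zero_table
  have r0 : max 0 (isect w 5 - isect w 8) = w 0 := by
    rw [show isect w 5 - isect w 8 = w 0 - w 1 - w 6 - 0 by linarith]
    exact max_zero_sub (hn 0) (hn 1) (hn 6) le_rfl h1 h3 (Or.inr rfl)
  have r1 : max 0 (isect w 0 - isect w 7) = w 1 := by
    rw [show isect w 0 - isect w 7 = w 1 - w 2 - w 8 - 0 by linarith]
    exact max_zero_sub (hn 1) (hn 2) (hn 8) le_rfl h4 h5 (Or.inr rfl)
  have r2 : max 0 (isect w 1 - isect w 6) = w 2 := by
    rw [show isect w 1 - isect w 6 = w 2 - w 3 - w 7 - 0 by linarith]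
    exact max_zero_sub (hn 2) (hn 3) (hn 7) le_rfl h6 h7 (Or.inr rfl)
  have r3 : max 0 (isect w 2 - isect w 8) = w 3 := by
    rw [show isect w 2 - isect w 8 = w 3 - w 4 - w 6 - 0 by linarith]
    exact max_zero_sub (hn 3) (hn 4) (hn 6) le_rfl h8 h9 (Or.inr rfl)
  have r4 : max 0 (isect w 3 - isect w 7) = w 4 := by
    rw [show isect w 3 - isect w 7 = w 4 - w 5 - w 8 - 0 by linarith]
    exact max_zero_sub (hn 4) (hn 5) (hn 8) le_rfl h10 h11 (Or.inr rfl)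
  have r5 : max 0 (isect w 4 - isect w 6) = w 5 := by
    rw [show isect w 4 - isect w 6 = w 5 - w 0 - w 7 - 0 by linarith]
    exact max_zero_sub (hn 5) (hn 0) (hn 7) le_rfl h2.symm h12 (Or.inr rfl)
  funext c
  rw [recover, r0, r1, r2, r3, r4, r5]
  fin_cases c <;> simp <;> linarith

theorem continuous_recover : Continuous recover := by
  refine continuous_pi fun c => ?_
  fin_cases c <;> simp [recover] <;> fun_prop

/-! ### The piecewise-linear sphere -/

/-- The sphere coordinates of the foliation with given weights. -/
def sphereMap : (Fin 9 → ℝ) →ₗ[ℝ] (Fin 3 → ℝ) where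
  toFun w := ![isect w 0 - w 0, isect w 2 - w 2, isect w 4 - w 4]
  map_add' v w := by
    funext j
    fin_cases j <;> simp [isect_table] <;> ring
  map_smul' r w := by
    funext j
    fin_cases j <;> simp [isect_table] <;> ring

theorem sphereMap_apply (w : Fin 9 → ℝ) :
    sphereMap w = ![isect w 0 - w 0, isect w 2 - w 2, isect w 4 - w 4] := rfl

/-- The weight of the arcs around one side of a hexagon, in terms of the intersection numbers with
the arcs around the three sides of the other colour. -/
def cornerWeight (x y z : ℝ) : ℝ := max 0 (min (min y z) ((y + z - x) / 2))

/-- The foliation with given sphere coordinates. -/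
def sphereInv (v : Fin 3 → ℝ) : Fin 9 → ℝ :=
  let x := max 0 (v 0)
  let y := max 0 (v 1)
  let z := max 0 (v 2)
  ![max 0 (-v 0), cornerWeight z x y, max 0 (-v 1), cornerWeight x y z, max 0 (-v 2),
    cornerWeight y z x, max 0 (x - y - z), max 0 (y - z - x), max 0 (z - x - y)]

theorem continuous_sphereInv : Continuous sphereInv := by
  refine continuous_pi fun c => ?_
  fin_cases c <;> simp [sphereInv, cornerWeight] <;> fun_prop

theorem cornerWeight_of_le {x y z : ℝ} (h : y + z ≤ x) : cornerWeight x y z = 0 :=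
  max_eq_left ((min_le_right _ _).trans (by linarith))

theorem cornerWeight_left {x y z : ℝ} (hx : 0 ≤ x) (hy : 0 ≤ y) (h : x + y ≤ z) :
    cornerWeight x y z = y := by
  rw [cornerWeight, min_eq_left (a := y) (by linarith), min_eq_left (by linarith),
    max_eq_right hy]

theorem cornerWeight_right {x y z : ℝ} (hx : 0 ≤ x) (hz : 0 ≤ z) (h : z + x ≤ y) :
    cornerWeight x y z = z := by
  rw [cornerWeight, min_eq_right (a := y) (by linarith), min_eq_left (by linarith),
    max_eq_right hz]

theorem cornerWeight_of_triangle {x y z : ℝ} (h1 : x ≤ y + z) (h2 : y ≤ z + x) (h3 : z ≤ x + y) :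
    cornerWeight x y z = (y + z - x) / 2 := by
  rw [cornerWeight, min_eq_right (le_min (by linarith) (by linarith)),
    max_eq_right (by linarith)]

/-- At most one of α, β, γ is nonzero. If none is, the triangle inequalities hold and the system is
solved by halving; if one is, the corresponding triangle inequality fails and the cap `min y z` or
the floor 0 takes effect. -/
theorem cornerWeight_eq {x y z A B C α β γ : ℝ} (hA : 0 ≤ A) (hB : 0 ≤ B) (hC : 0 ≤ C)
    (hα : 0 ≤ α) (hβ : 0 ≤ β) (hγ : 0 ≤ γ) (hx : x = C + B + α) (hy : y = C + A + β)
    (hz : z = A + B + γ) (h1 : A = 0 ∨ α = 0) (h2 : B = 0 ∨ β = 0) (h3 : C = 0 ∨ γ = 0)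
    (h4 : α = 0 ∨ β = 0) (h5 : α = 0 ∨ γ = 0) (h6 : β = 0 ∨ γ = 0) : cornerWeight x y z = A := by
  by_cases hα0 : α = 0
  · by_cases hβ0 : β = 0
    · by_cases hγ0 : γ = 0
      · rw [cornerWeight_of_triangle] <;> linarith
      · have := h3.resolve_right hγ0
        rw [cornerWeight_left] <;> linarith
    · have := h2.resolve_right hβ0
      have := h6.resolve_left hβ0
      rw [cornerWeight_right] <;> linarith
  · have := h1.resolve_right hα0
    have := h4.resolve_left hα0
    have := h5.resolve_left hα0
    rw [cornerWeight_of_le] <;> linarith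

theorem max_zero_sum_sub {x y z w : ℝ} (hx : 0 ≤ x) (hy : 0 ≤ y) (hz : 0 ≤ z) (hw : 0 ≤ w)
    (h1 : w = 0 ∨ x = 0) (h2 : w = 0 ∨ y = 0) (h3 : w = 0 ∨ z = 0) :
    max 0 (x + y + z - w) = x + y + z := by
  by_cases h : w = 0
  · rw [max_eq_right] <;> linarith
  · have := h1.resolve_left h
    have := h2.resolve_left h
    have := h3.resolve_left h
    rw [max_eq_left] <;> linarith

/-- Existence for the chart {a, b, c}: given the three intersection numbers, the formulas yield
nonnegative weights with the required sums and exclusions. The cases are the three failures of the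
triangle inequality and the triangle region. -/
theorem hexagon_weights {x y z : ℝ} (hx : 0 ≤ x) (hy : 0 ≤ y) (hz : 0 ≤ z) :
    ∃ A B C α β γ : ℝ, cornerWeight x y z = A ∧ cornerWeight y z x = B ∧ cornerWeight z x y = C ∧
      max 0 (x - y - z) = α ∧ max 0 (y - z - x) = β ∧ max 0 (z - x - y) = γ ∧
      0 ≤ A ∧ 0 ≤ B ∧ 0 ≤ C ∧ 0 ≤ α ∧ 0 ≤ β ∧ 0 ≤ γ ∧
      x = C + B + α ∧ y = C + A + β ∧ z = A + B + γ ∧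
      (A = 0 ∨ α = 0) ∧ (B = 0 ∨ β = 0) ∧ (C = 0 ∨ γ = 0) ∧
      (α = 0 ∨ β = 0) ∧ (α = 0 ∨ γ = 0) ∧ (β = 0 ∨ γ = 0) := by
  refine ⟨_, _, _, _, _, _, rfl, rfl, rfl, rfl, rfl, rfl, ?_⟩
  by_cases h1 : y + z ≤ x
  · rw [cornerWeight_of_le h1, cornerWeight_left hy hz h1,
      cornerWeight_right hz hy (by linarith), max_eq_right (by linarith),
      max_eq_left (by linarith), max_eq_left (by linarith)]
    grind
  by_cases h2 : z + x ≤ y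
  · rw [cornerWeight_of_le h2, cornerWeight_left hz hx h2,
      cornerWeight_right hx hz (by linarith), max_eq_right (a := 0) (b := y - z - x) (by linarith),
      max_eq_left (by linarith), max_eq_left (by linarith)]
    grind
  by_cases h3 : x + y ≤ z
  · rw [cornerWeight_of_le h3, cornerWeight_left hx hy h3,
      cornerWeight_right hy hx (by linarith), max_eq_right (a := 0) (b := z - x - y) (by linarith),
      max_eq_left (by linarith), max_eq_left (by linarith)]
    grind
  · rw [cornerWeight_of_triangle (by linarith) (by linarith) (by linarith),
      cornerWeight_of_triangle (by linarith) (by linarith) (by linarith),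
      cornerWeight_of_triangle (by linarith) (by linarith) (by linarith),
      max_eq_left (by linarith), max_eq_left (by linarith), max_eq_left (by linarith)]
    grind

theorem sphereMap_sphereInv (v : Fin 3 → ℝ) : sphereMap (sphereInv v) = v := by
  obtain ⟨A, B, C, α, β, γ, h1, h2, h3, h4, h5, h6, h⟩ := hexagon_weights
    (le_max_left 0 (v 0)) (le_max_left 0 (v 1)) (le_max_left 0 (v 2))
  have hs : sphereInv v = ![max 0 (-v 0), C, max 0 (-v 1), A, max 0 (-v 2), B, α, β, γ] := by
    rw [sphereInv, h1, h2, h3, h4, h5, h6]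
  have t := isect_table (sphereInv v)
  rw [sphereMap_apply, t.1, t.2.2.1, t.2.2.2.2.1, hs]
  funext j
  fin_cases j <;> simp <;> grind

/-- A positive weight of a, b or c comes from a negative coordinate; the corresponding intersection
number is then 0, so the kinds crossing that arc get weight 0. -/
theorem sphereInv_admissible {v : Fin 3 → ℝ} (hv : v ≠ 0) : Admissible (sphereInv v) := by
  obtain ⟨A, B, C, α, β, γ, h1, h2, h3, h4, h5, h6, h⟩ := hexagon_weights
    (le_max_left 0 (v 0)) (le_max_left 0 (v 1)) (le_max_left 0 (v 2))
  have hs : sphereInv v = ![max 0 (-v 0), C, max 0 (-v 1), A, max 0 (-v 2), B, α, β, γ] := by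
    rw [sphereInv, h1, h2, h3, h4, h5, h6]
  refine admissible_of_table (fun c => ?_) (fun h0 => hv ?_) ?_
  · rw [hs]
    fin_cases c <;> simp <;> grind
  · rw [← sphereMap_sphereInv v, h0, map_zero]
  · rw [hs]
    simp
    grind

/-- A kind with positive weight has intersection number 0. So the positive and negative parts of
each coordinate separate intersection number and weight, and the other six weights follow from the
three intersection numbers. -/
theorem sphereInv_sphereMap {w : Fin 9 → ℝ} (hw : Admissible w) : sphereInv (sphereMap w) = w := by
  obtain ⟨e0, e1, e2, e3, e4, e5, e6, e7, e8⟩ := isect_table w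
  have hn := hw.nonneg
  obtain ⟨⟨h1, h2, h3⟩, ⟨h4, h5⟩, ⟨h6, h7⟩, ⟨h8, h9⟩, ⟨h10, h11⟩, h12, h13, h14, h15⟩ :=
    hw.eq_zero_table
  have s0 : sphereMap w 0 = isect w 0 - w 0 := rfl
  have s1 : sphereMap w 1 = isect w 2 - w 2 := rfl
  have s2 : sphereMap w 2 = isect w 4 - w 4 := rfl
  have x0 : max 0 (sphereMap w 0) = isect w 0 := by
    rw [s0, e0]
    exact max_zero_sum_sub (hn 1) (hn 5) (hn 6) (hn 0) h1 h2 h3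
  have r0 : max 0 (-sphereMap w 0) = w 0 := by
    rw [s0, e0, show -(w 1 + w 5 + w 6 - w 0) = w 0 - w 1 - w 5 - w 6 by ring]
    exact max_zero_sub (hn 0) (hn 1) (hn 5) (hn 6) h1 h2 h3
  have x1 : max 0 (sphereMap w 1) = isect w 2 := by
    rw [s1, e2]
    exact max_zero_sum_sub (hn 1) (hn 3) (hn 7) (hn 2) h4.symm h6 h7
  have r2 : max 0 (-sphereMap w 1) = w 2 := by
    rw [s1, e2, show -(w 1 + w 3 + w 7 - w 2) = w 2 - w 1 - w 3 - w 7 by ring]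
    exact max_zero_sub (hn 2) (hn 1) (hn 3) (hn 7) h4.symm h6 h7
  have x2 : max 0 (sphereMap w 2) = isect w 4 := by
    rw [s2, e4]
    exact max_zero_sum_sub (hn 3) (hn 5) (hn 8) (hn 4) h8.symm h10 h11
  have r4 : max 0 (-sphereMap w 2) = w 4 := by
    rw [s2, e4, show -(w 3 + w 5 + w 8 - w 4) = w 4 - w 3 - w 5 - w 8 by ring]
    exact max_zero_sub (hn 4) (hn 3) (hn 5) (hn 8) h8.symm h10 h11
  have r6 : max 0 (isect w 0 - isect w 2 - isect w 4) = w 6 := by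
    rw [show isect w 0 - isect w 2 - isect w 4 = w 6 - 2 * w 3 - w 7 - w 8 by
      linarith]
    exact max_zero_sub (hn 6) (mul_nonneg zero_le_two (hn 3)) (hn 7) (hn 8)
      (by simpa using h9.symm) h13 h14
  have r7 : max 0 (isect w 2 - isect w 4 - isect w 0) = w 7 := by
    rw [show isect w 2 - isect w 4 - isect w 0 = w 7 - 2 * w 5 - w 8 - w 6 by
      linarith]
    exact max_zero_sub (hn 7) (mul_nonneg zero_le_two (hn 5)) (hn 8) (hn 6)
      (by simpa using h12.symm) h15 h13.symm
  have r8 : max 0 (isect w 4 - isect w 0 - isect w 2) = w 8 := by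
    rw [show isect w 4 - isect w 0 - isect w 2 = w 8 - 2 * w 1 - w 6 - w 7 by
      linarith]
    exact max_zero_sub (hn 8) (mul_nonneg zero_le_two (hn 1)) (hn 6) (hn 7)
      (by simpa using h5.symm) h14.symm h15.symm
  have r3 : cornerWeight (isect w 0) (isect w 2) (isect w 4) = w 3 :=
    cornerWeight_eq (hn 3) (hn 5) (hn 1) (hn 6) (hn 7) (hn 8) (by linarith)
      (by linarith) (by linarith) h9 h12 h5 h13 h14
      h15
  have r5 : cornerWeight (isect w 2) (isect w 4) (isect w 0) = w 5 :=
    cornerWeight_eq (hn 5) (hn 1) (hn 3) (hn 7) (hn 8) (hn 6) (by linarith)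
      (by linarith) (by linarith) h12 h5 h9 h15 h13.symm
      h14.symm
  have r1 : cornerWeight (isect w 4) (isect w 0) (isect w 2) = w 1 :=
    cornerWeight_eq (hn 1) (hn 3) (hn 5) (hn 8) (hn 6) (hn 7) (by linarith)
      (by linarith) (by linarith) h5 h9 h12 h14.symm h15.symm
      h13
  funext c
  rw [sphereInv, x0, x1, x2, r0, r1, r2, r3, r4, r5, r6, r7, r8]
  fin_cases c <;> rfl

/-! ### Arc triples -/

/-- The sets of kinds of the arc triples. -/
def triples : List (Finset (Fin 9)) :=
  [{0, 2, 4}, {3, 5, 1}, {6, 2, 4}, {0, 7, 4}, {0, 2, 8}, {6, 5, 1}, {3, 7, 1}, {3, 5, 8},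
    {0, 3, 7}, {2, 5, 6}, {4, 1, 6}, {0, 3, 8}, {2, 5, 8}, {4, 1, 7}]

/-- The rotation of the hexagon by one side. -/
def rotate : Equiv.Perm (Fin 9) where
  toFun := ![1, 2, 3, 4, 5, 0, 8, 6, 7]
  invFun := ![5, 0, 1, 2, 3, 4, 7, 8, 6]
  left_inv := by decide
  right_inv := by decide

/-- A reflection of the hexagon. -/
def reflect : Equiv.Perm (Fin 9) where
  toFun := ![0, 5, 4, 3, 2, 1, 6, 8, 7]
  invFun := ![0, 5, 4, 3, 2, 1, 6, 8, 7]
  left_inv := by decide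
  right_inv := by decide

theorem crossTable_rotate : ∀ b c, crossTable (rotate b) (rotate c) = crossTable b c := by decide

theorem crossTable_reflect : ∀ b c, crossTable (reflect b) (reflect c) = crossTable b c := by
  decide

theorem triples_nodup : triples.Nodup := by decide

set_option maxRecDepth 10000 in
theorem card_of_mem_triples : ∀ t ∈ triples, t.card = 3 := by decide

set_option maxRecDepth 10000 in
theorem not_cross_of_mem_triples :
    ∀ t ∈ triples, ∀ b ∈ t, ∀ c ∈ t, crossTable b c = false := by decide

-- Triples are maximal arc systems. This is why a foliation without leaves parallel to the triple
-- has some positive coordinate.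
set_option maxRecDepth 10000 in
theorem exists_cross_of_mem_triples :
    ∀ t ∈ triples, ∀ b, b ∉ t → ∃ c ∈ t, crossTable b c = true := by decide

-- For each kind some triple lies entirely across it. Positivity of all three coordinates follows
-- for any foliation having leaves of that kind, so the interiors of the charts cover.
set_option maxRecDepth 10000 in
theorem exists_triple_cross : ∀ b, ∃ t ∈ triples, ∀ c ∈ t, crossTable b c = true := by decide

-- The dihedral group of the hexagon has three orbits of triples: three alternate sides, a fan of
-- arcs ending on a common side, and a zigzag.
set_option maxRecDepth 10000 in
theorem triples_symmetric : ∀ t ∈ triples, ∃ n < 6, ∃ m < 2,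
    ∃ e ∈ [({0, 2, 4} : Finset (Fin 9)), {6, 2, 4}, {0, 7, 3}],
      t = e.image (rotate^[n] ∘ reflect^[m]) := by decide

set_option maxRecDepth 10000 in
theorem exists_triple_superset : ∀ s : Finset (Fin 9),
    (∀ b ∈ s, ∀ c ∈ s, crossTable b c = false) → ∃ t ∈ triples, s ⊆ t := by decide

theorem mem_triples_iff {s : Finset (Fin 9)} :
    s ∈ triples ↔ s.card = 3 ∧ ∀ b ∈ s, ∀ c ∈ s, ¬ Cross b c := by
  constructor
  · intro h
    refine ⟨card_of_mem_triples s h, fun b hb c hc hbc => ?_⟩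
    rw [cross_iff_crossTable, not_cross_of_mem_triples s h b hb c hc] at hbc
    exact absurd hbc (by decide)
  · rintro ⟨h1, h2⟩
    obtain ⟨t, ht, hst⟩ := exists_triple_superset s fun b hb c hc => by
      rw [← Bool.not_eq_true, ← cross_iff_crossTable]
      exact h2 b hb c hc
    rwa [Finset.eq_of_subset_of_card_le hst (by rw [card_of_mem_triples t ht, h1])]

/-- Three distinct kinds of arcs that do not cross. -/
def IsTriple (d : Fin 3 → Fin 9) : Prop := Function.Injective d ∧ ∀ i j, ¬ Cross (d i) (d j)

theorem IsTriple.image_mem {d : Fin 3 → Fin 9} (hd : IsTriple d) :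
    Finset.univ.image d ∈ triples := by
  rw [mem_triples_iff, Finset.card_image_of_injective _ hd.1]
  refine ⟨rfl, fun b hb c hc => ?_⟩
  obtain ⟨i, -, rfl⟩ := Finset.mem_image.1 hb
  obtain ⟨j, -, rfl⟩ := Finset.mem_image.1 hc
  exact hd.2 i j

theorem IsTriple.exists_cross {d : Fin 3 → Fin 9} (hd : IsTriple d) {b : Fin 9}
    (hb : ∀ j, b ≠ d j) : ∃ j, Cross b (d j) := by
  obtain ⟨c, hc, h⟩ := exists_cross_of_mem_triples _ hd.image_mem b (by
    simpa using fun j h => hb j h.symm)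
  obtain ⟨j, -, rfl⟩ := Finset.mem_image.1 hc
  exact ⟨j, (cross_iff_crossTable _ _).2 h⟩

theorem exists_isTriple {t : Finset (Fin 9)} (ht : t ∈ triples) :
    ∃ d, IsTriple d ∧ Set.range d = t := by
  obtain ⟨hc, hn⟩ := mem_triples_iff.1 ht
  have hm : ∀ j, ((t.equivFinOfCardEq hc).symm j : Fin 9) ∈ t := fun j => Subtype.coe_prop _
  refine ⟨fun j => ((t.equivFinOfCardEq hc).symm j : Fin 9),
    ⟨Subtype.coe_injective.comp (Equiv.injective _), fun i j => hn _ (hm i) _ (hm j)⟩, ?_⟩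
  ext c
  constructor
  · rintro ⟨j, rfl⟩
    exact hm j
  · intro h
    exact ⟨t.equivFinOfCardEq hc ⟨c, h⟩, by simp⟩

/-! ### Charts -/

/-- `g` is a continuous inverse of the intersection numbers with the arcs of kinds `d`. -/
structure IsChartInverse (d : Fin 3 → Fin 9) (g : (Fin 3 → ℝ) → Fin 9 → ℝ) : Prop where
  continuous : Continuous g
  admissible : ∀ v ∈ octant, Admissible (g v)
  eq_zero : ∀ v ∈ octant, ∀ j, g v (d j) = 0
  isect_eq : ∀ v ∈ octant, ∀ j, isect (g v) (d j) = v j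
  apply_isect : ∀ w, Admissible w → (∀ j, w (d j) = 0) → g (fun j => isect w (d j)) = w

/-- On the octant there are no negative parts, so the inverse of the sphere coordinates is also the
inverse of the chart {a, b, c}. -/
theorem isChartInverse_sphereInv : IsChartInverse ![0, 2, 4] sphereInv where
  continuous := continuous_sphereInv
  admissible v hv := sphereInv_admissible hv.2
  eq_zero v hv j := by fin_cases j <;> simpa [sphereInv] using hv.1 _
  isect_eq v hv j := by
    have h := congrFun (sphereMap_sphereInv v) j
    rw [sphereMap_apply] at h
    have h0 : ∀ j, sphereInv v (![0, 2, 4] j) = 0 := fun j => by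
      fin_cases j <;> simpa [sphereInv] using hv.1 _
    have h1 := h0 0
    have h2 := h0 1
    have h3 := h0 2
    fin_cases j <;> simp at h h1 h2 h3 ⊢ <;> linarith
  apply_isect w hw h := by
    refine Eq.trans ?_ (sphereInv_sphereMap hw)
    congr 1
    have h1 := h 0
    have h2 := h 1
    have h3 := h 2
    rw [sphereMap_apply]
    simp at h1 h2 h3
    funext j
    fin_cases j <;> simp [h1, h2, h3]

/-- The inverse of the chart `{α, b, c}`. -/
def fanInv (v : Fin 3 → ℝ) : Fin 9 → ℝ :=
  ![v 0 - min (v 0) (v 1) - min (v 0) (v 2) + min (min (v 0) (v 1)) (v 2),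
    v 1 - min (v 0) (v 1), 0, min (min (v 0) (v 1)) (v 2), 0, v 2 - min (v 0) (v 2), 0,
    min (v 0) (v 1) - min (min (v 0) (v 1)) (v 2), min (v 0) (v 2) - min (min (v 0) (v 1)) (v 2)]

/-- Here `r` is the weight of the kinds crossing both of two arcs, `p` and `q` that of the kinds
crossing only one. If the latter exclude each other, the minimum of the two intersection numbers is
`r`. -/
theorem min_add_add {p q r : ℝ} (hp : 0 ≤ p) (hq : 0 ≤ q) (h : p = 0 ∨ q = 0) :
    min (r + p) (r + q) = r := by
  rcases h with rfl | rfl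
  · rw [add_zero]; exact min_eq_left (by linarith)
  · rw [add_zero]; exact min_eq_right (by linarith)

theorem add_eq_zero_or {p q r : ℝ} (hp : p = 0 ∨ r = 0) (hq : q = 0 ∨ r = 0) :
    p + q = 0 ∨ r = 0 := by
  rcases hp with hp | hp
  · rcases hq with hq | hq
    · left; rw [hp, hq, add_zero]
    · exact Or.inr hq
  · exact Or.inr hp

theorem fan_weights {x y z : ℝ} (hx : 0 ≤ x) (hy : 0 ≤ y) (hz : 0 ≤ z) :
    ∃ a A B C β γ : ℝ, x - min x y - min x z + min (min x y) z = a ∧ min (min x y) z = A ∧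
      z - min x z = B ∧ y - min x y = C ∧ min x y - min (min x y) z = β ∧
      min x z - min (min x y) z = γ ∧ 0 ≤ a ∧ 0 ≤ A ∧ 0 ≤ B ∧ 0 ≤ C ∧ 0 ≤ β ∧ 0 ≤ γ ∧
      x = a + β + γ + A ∧ y = β + A + C ∧ z = γ + A + B ∧ (a = 0 ∨ C = 0) ∧ (a = 0 ∨ B = 0) ∧
      (C = 0 ∨ γ = 0) ∧ (B = 0 ∨ β = 0) ∧ (β = 0 ∨ γ = 0) := by
  refine ⟨_, _, _, _, _, _, rfl, rfl, rfl, rfl, rfl, rfl, ?_⟩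
  rcases le_total x y with h1 | h1 <;> rcases le_total x z with h2 | h2 <;>
    rcases le_total y z with h3 | h3 <;> simp only [min_eq_left, min_eq_right, h1, h2, h3] <;>
    grind

/-- Pairwise and triple minima of the coordinates are the weights of the kinds crossing several arcs
of the fan at once; the remaining weights follow by inclusion and exclusion. -/
theorem isChartInverse_fanInv : IsChartInverse ![6, 2, 4] fanInv := by
  have key : ∀ v ∈ octant, Admissible (fanInv v) ∧ (∀ j, fanInv v (![6, 2, 4] j) = 0) ∧
      ∀ j, isect (fanInv v) (![6, 2, 4] j) = v j := by
    intro v hv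
    obtain ⟨a, A, B, C, β, γ, h1, h2, h3, h4, h5, h6, h⟩ :=
      fan_weights (hv.1 0) (hv.1 1) (hv.1 2)
    have hs : fanInv v = ![a, C, 0, A, 0, B, 0, β, γ] := by
      rw [fanInv, h1, h3, h4, h5, h6, h2]
    have t := isect_table (fanInv v)
    have hi : ∀ j, isect (fanInv v) (![6, 2, 4] j) = v j := by
      intro j
      fin_cases j
      · refine t.2.2.2.2.2.2.1.trans ?_
        rw [hs]
        simp
        linarith
      · refine t.2.2.1.trans ?_
        rw [hs]
        simp
        linarith
      · refine t.2.2.2.2.1.trans ?_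
        rw [hs]
        simp
        linarith
    refine ⟨admissible_of_table (fun c => ?_) (fun h0 => hv.2 ?_) ?_, fun j => ?_, hi⟩
    · rw [hs]
      fin_cases c <;> simp <;> grind
    · funext j
      rw [← hi j, h0]
      simp [isect]
    · rw [hs]
      simp
      grind
    · rw [hs]
      fin_cases j <;> rfl
  refine ⟨?_, fun v hv => (key v hv).1, fun v hv => (key v hv).2.1, fun v hv => (key v hv).2.2,
    fun w hw h => ?_⟩
  · refine continuous_pi fun c => ?_
    fin_cases c <;> simp [fanInv] <;> fun_prop
  · have w6 : w 6 = 0 := h 0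
    have w2 : w 2 = 0 := h 1
    have w4 : w 4 = 0 := h 2
    have t := isect_table w
    have e0 : isect w 6 = w 7 + w 3 + (w 0 + w 8) := by linarith [t.2.2.2.2.2.2.1]
    have e1 : isect w 2 = w 7 + w 3 + w 1 := by linarith [t.2.2.1]
    have e0' : isect w 6 = w 8 + w 3 + (w 0 + w 7) := by linarith
    have e2 : isect w 4 = w 8 + w 3 + w 5 := by linarith [t.2.2.2.2.1]
    have hn := hw.nonneg
    have m1 : min (isect w 6) (isect w 2) = w 7 + w 3 := by
      rw [e0, e1]
      exact min_add_add (add_nonneg (hn _) (hn _)) (hn _)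
        (add_eq_zero_or (hw.eq_zero _ _ rfl) (hw.eq_zero _ _ rfl))
    have m2 : min (isect w 6) (isect w 4) = w 8 + w 3 := by
      rw [e0', e2]
      exact min_add_add (add_nonneg (hn _) (hn _)) (hn _)
        (add_eq_zero_or (hw.eq_zero _ _ rfl) (hw.eq_zero _ _ rfl))
    have m3 : min (min (isect w 6) (isect w 2)) (isect w 4) = w 3 := by
      rw [m1, e2, show w 7 + w 3 = w 3 + w 7 by ring,
        show w 8 + w 3 + w 5 = w 3 + (w 8 + w 5) by ring]
      exact min_add_add (hn _) (add_nonneg (hn _) (hn _))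
        (add_eq_zero_or (hw.eq_zero 8 7 rfl) (hw.eq_zero 5 7 rfl)).symm
    have hv : fanInv (fun j => isect w (![6, 2, 4] j)) =
        ![isect w 6 - min (isect w 6) (isect w 2) - min (isect w 6) (isect w 4) +
          min (min (isect w 6) (isect w 2)) (isect w 4),
          isect w 2 - min (isect w 6) (isect w 2), 0,
          min (min (isect w 6) (isect w 2)) (isect w 4), 0,
          isect w 4 - min (isect w 6) (isect w 4), 0,
          min (isect w 6) (isect w 2) - min (min (isect w 6) (isect w 2)) (isect w 4),
          min (isect w 6) (isect w 4) - min (min (isect w 6) (isect w 2)) (isect w 4)] := rfl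
    rw [hv, m3, m2, m1, e0, e1, e2]
    funext c
    fin_cases c <;> simp [w6, w2, w4]
    ring

/-- The weight of the long arcs crossing all three arcs of a zigzag. -/
def zigzagWeight (x y z : ℝ) : ℝ := max 0 (min (min x z) (min y (x + z - y)))

/-- The inverse of the chart `{a, β, A}`. -/
def zigzagInv (v : Fin 3 → ℝ) : Fin 9 → ℝ :=
  ![0, max 0 (v 0 - v 1), v 2 - zigzagWeight (v 0) (v 1) (v 2) - max 0 (v 2 - v 1), 0,
    max 0 (v 2 - v 1), v 0 - zigzagWeight (v 0) (v 1) (v 2) - max 0 (v 0 - v 1),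
    zigzagWeight (v 0) (v 1) (v 2), 0, max 0 (v 1 - v 0 - v 2)]

theorem zigzagWeight_of_le {x y z : ℝ} (h : x + z ≤ y) : zigzagWeight x y z = 0 :=
  max_eq_left ((min_le_right _ _).trans ((min_le_right _ _).trans (by linarith)))

theorem zigzagWeight_middle {x y z : ℝ} (h1 : x ≤ y) (h2 : z ≤ y) (h3 : y ≤ x + z) :
    zigzagWeight x y z = x + z - y := by
  rw [zigzagWeight, min_eq_right (b := x + z - y) (by linarith),
    min_eq_right (le_min (by linarith) (by linarith)), max_eq_right (by linarith)]

theorem zigzagWeight_left {x y z : ℝ} (h0 : 0 ≤ x) (h1 : x ≤ y) (h2 : y ≤ z) :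
    zigzagWeight x y z = x := by
  rw [zigzagWeight, min_eq_left (a := x) (b := z) (by linarith),
    min_eq_left (le_min (by linarith) (by linarith)), max_eq_right h0]

theorem zigzagWeight_right {x y z : ℝ} (h0 : 0 ≤ z) (h1 : z ≤ y) (h2 : y ≤ x) :
    zigzagWeight x y z = z := by
  rw [zigzagWeight, min_eq_right (a := x) (b := z) (by linarith),
    min_eq_left (le_min (by linarith) (by linarith)), max_eq_right h0]

theorem zigzagWeight_bottom {x y z : ℝ} (h0 : 0 ≤ y) (h1 : y ≤ x) (h2 : y ≤ z) :
    zigzagWeight x y z = y := by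
  rw [zigzagWeight, min_eq_left (a := y) (by linarith),
    min_eq_right (le_min (by linarith) (by linarith)), max_eq_right h0]

theorem zigzag_weights {x y z : ℝ} (hx : 0 ≤ x) (hy : 0 ≤ y) (hz : 0 ≤ z) :
    ∃ b c α B C γ : ℝ, z - zigzagWeight x y z - max 0 (z - y) = b ∧ max 0 (z - y) = c ∧
      zigzagWeight x y z = α ∧ x - zigzagWeight x y z - max 0 (x - y) = B ∧
      max 0 (x - y) = C ∧ max 0 (y - x - z) = γ ∧ 0 ≤ b ∧ 0 ≤ c ∧ 0 ≤ α ∧ 0 ≤ B ∧ 0 ≤ C ∧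
      0 ≤ γ ∧ x = α + B + C ∧ y = α + b + γ + B ∧ z = α + b + c ∧ (C = 0 ∨ b = 0) ∧
      (C = 0 ∨ γ = 0) ∧ (c = 0 ∨ B = 0) ∧ (c = 0 ∨ γ = 0) ∧ (α = 0 ∨ γ = 0) := by
  refine ⟨_, _, _, _, _, _, rfl, rfl, rfl, rfl, rfl, rfl, ?_⟩
  by_cases h : x + z ≤ y
  · rw [zigzagWeight_of_le h, max_eq_left (by linarith), max_eq_left (by linarith),
      max_eq_right (by linarith)]
    grind
  rw [max_eq_left (a := 0) (b := y - x - z) (by linarith)]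
  rcases le_total x y with h1 | h1 <;> rcases le_total y z with h2 | h2
  · rw [zigzagWeight_left hx h1 h2, max_eq_right (by linarith), max_eq_left (by linarith)]
    grind
  · rw [zigzagWeight_middle h1 h2 (by linarith), max_eq_left (by linarith),
      max_eq_left (by linarith)]
    grind
  · rw [zigzagWeight_bottom hy h1 h2, max_eq_right (by linarith), max_eq_right (by linarith)]
    grind
  · rw [zigzagWeight_right hz h2 h1, max_eq_left (by linarith), max_eq_right (by linarith)]
    grind

/-- If γ vanishes, the exclusions C or b and c or B leave four cases, and in each a different entry
of the minimum equals α. If γ does not vanish, then C = c = α = 0, x + z - y is negative and the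
outer maximum gives 0. -/
theorem zigzagWeight_eq {x y z b c α B C γ : ℝ} (hb : 0 ≤ b) (hc : 0 ≤ c) (hα : 0 ≤ α)
    (hB : 0 ≤ B) (hC : 0 ≤ C) (hγ : 0 ≤ γ) (hx : x = α + B + C) (hy : y = α + b + γ + B)
    (hz : z = α + b + c) (h1 : C = 0 ∨ b = 0) (h2 : C = 0 ∨ γ = 0) (h3 : c = 0 ∨ B = 0)
    (h4 : c = 0 ∨ γ = 0) (h5 : α = 0 ∨ γ = 0) : zigzagWeight x y z = α := by
  by_cases hγ0 : γ = 0
  · rcases h1 with h1 | h1 <;> rcases h3 with h3 | h3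
    · rw [zigzagWeight_middle] <;> linarith
    · rw [zigzagWeight_left] <;> linarith
    · rw [zigzagWeight_right] <;> linarith
    · rw [zigzagWeight_bottom] <;> linarith
  · have := h2.resolve_right hγ0
    have := h4.resolve_right hγ0
    have := h5.resolve_right hγ0
    rw [zigzagWeight_of_le] <;> linarith

/-- Three weights are positive parts of differences of coordinates, the weight of the only kind
crossing all three arcs is `zigzagWeight`, and the last two follow by subtraction. -/
theorem isChartInverse_zigzagInv : IsChartInverse ![0, 7, 3] zigzagInv := by
  have key : ∀ v ∈ octant, Admissible (zigzagInv v) ∧ (∀ j, zigzagInv v (![0, 7, 3] j) = 0) ∧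
      ∀ j, isect (zigzagInv v) (![0, 7, 3] j) = v j := by
    intro v hv
    obtain ⟨b, c, α, B, C, γ, h1, h2, h3, h4, h5, h6, h⟩ :=
      zigzag_weights (hv.1 0) (hv.1 1) (hv.1 2)
    have hs : zigzagInv v = ![0, C, b, 0, c, B, α, 0, γ] := by
      rw [zigzagInv, h1, h4, h2, h3, h5, h6]
    have t := isect_table (zigzagInv v)
    have hi : ∀ j, isect (zigzagInv v) (![0, 7, 3] j) = v j := by
      intro j
      fin_cases j
      · refine t.1.trans ?_
        rw [hs]
        simp
        linarith
      · refine t.2.2.2.2.2.2.2.1.trans ?_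
        rw [hs]
        simp
        linarith
      · refine t.2.2.2.1.trans ?_
        rw [hs]
        simp
        linarith
    refine ⟨admissible_of_table (fun c => ?_) (fun h0 => hv.2 ?_) ?_, fun j => ?_, hi⟩
    · rw [hs]
      fin_cases c <;> simp <;> grind
    · funext j
      rw [← hi j, h0]
      simp [isect]
    · rw [hs]
      simp
      grind
    · rw [hs]
      fin_cases j <;> rfl
  refine ⟨?_, fun v hv => (key v hv).1, fun v hv => (key v hv).2.1, fun v hv => (key v hv).2.2,
    fun w hw h => ?_⟩
  · refine continuous_pi fun c => ?_
    fin_cases c <;> simp [zigzagInv, zigzagWeight] <;> fun_prop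
  · have w0 : w 0 = 0 := h 0
    have w7 : w 7 = 0 := h 1
    have w3 : w 3 = 0 := h 2
    have t := isect_table w
    have e0 : isect w 0 = w 6 + w 5 + w 1 := by linarith [t.1]
    have e1 : isect w 7 = w 6 + w 2 + w 8 + w 5 := by linarith [t.2.2.2.2.2.2.2.1]
    have e2 : isect w 3 = w 6 + w 2 + w 4 := by linarith [t.2.2.2.1]
    have hn := hw.nonneg
    have hz := fun b c h => hw.eq_zero b c h
    have m1 : max 0 (isect w 0 - isect w 7) = w 1 := by
      rw [e0, e1, show w 6 + w 5 + w 1 - (w 6 + w 2 + w 8 + w 5) = w 1 - w 2 - w 8 - 0 by ring]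
      exact max_zero_sub (hn _) (hn _) (hn _) le_rfl (hz _ _ rfl) (hz _ _ rfl) (Or.inr rfl)
    have m4 : max 0 (isect w 3 - isect w 7) = w 4 := by
      rw [e2, e1, show w 6 + w 2 + w 4 - (w 6 + w 2 + w 8 + w 5) = w 4 - w 5 - w 8 - 0 by ring]
      exact max_zero_sub (hn _) (hn _) (hn _) le_rfl (hz _ _ rfl) (hz _ _ rfl) (Or.inr rfl)
    have m8 : max 0 (isect w 7 - isect w 0 - isect w 3) = w 8 := by
      rw [e0, e1, e2, show w 6 + w 2 + w 8 + w 5 - (w 6 + w 5 + w 1) - (w 6 + w 2 + w 4) =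
        w 8 - w 1 - w 4 - w 6 by ring]
      exact max_zero_sub (hn _) (hn _) (hn _) (hn _) (hz _ _ rfl) (hz _ _ rfl) (hz _ _ rfl)
    have m6 : zigzagWeight (isect w 0) (isect w 7) (isect w 3) = w 6 :=
      zigzagWeight_eq (hn 2) (hn 4) (hn 6) (hn 5) (hn 1) (hn 8) e0 e1 e2 (hz _ _ rfl)
        (hz _ _ rfl) (hz _ _ rfl) (hz _ _ rfl) (hz _ _ rfl)
    have hv : zigzagInv (fun j => isect w (![0, 7, 3] j)) =
        ![0, max 0 (isect w 0 - isect w 7),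
          isect w 3 - zigzagWeight (isect w 0) (isect w 7) (isect w 3) -
            max 0 (isect w 3 - isect w 7), 0, max 0 (isect w 3 - isect w 7),
          isect w 0 - zigzagWeight (isect w 0) (isect w 7) (isect w 3) -
            max 0 (isect w 0 - isect w 7),
          zigzagWeight (isect w 0) (isect w 7) (isect w 3), 0,
          max 0 (isect w 7 - isect w 0 - isect w 3)] := rfl
    rw [hv, m1, m4, m8, m6, e0, e2]
    funext c
    fin_cases c <;> simp [w0, w7, w3] <;> ring

/-! ### Transport of charts along symmetries -/

theorem isect_comp_symm {φ : Equiv.Perm (Fin 9)}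
    (hφ : ∀ b c, crossTable (φ b) (φ c) = crossTable b c) (w : Fin 9 → ℝ) (c : Fin 9) :
    isect (w ∘ φ.symm) (φ c) = isect w c := by
  rw [isect, ← Equiv.sum_comp φ]
  simp only [isect, Function.comp_apply, Equiv.symm_apply_apply, crossing_eq, hφ]

theorem Admissible.comp {φ : Equiv.Perm (Fin 9)}
    (hφ : ∀ b c, crossTable (φ b) (φ c) = crossTable b c) {w : Fin 9 → ℝ} (hw : Admissible w) :
    Admissible (w ∘ φ) := by
  refine ⟨fun c => hw.nonneg _, fun h => hw.ne_zero ?_, fun b c hb hc h => ?_⟩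
  · funext c
    simpa using congrFun h (φ.symm c)
  · rw [cross_iff_crossTable, ← hφ, ← cross_iff_crossTable] at h
    exact hw.not_cross _ _ hb hc h

theorem IsChartInverse.map {d : Fin 3 → Fin 9} {g : (Fin 3 → ℝ) → Fin 9 → ℝ}
    (hg : IsChartInverse d g) {φ : Equiv.Perm (Fin 9)}
    (hφ : ∀ b c, crossTable (φ b) (φ c) = crossTable b c) :
    IsChartInverse (φ ∘ d) fun v => g v ∘ φ.symm where
  continuous := continuous_pi fun c => (continuous_apply _).comp hg.continuous
  admissible v hv := (hg.admissible v hv).comp fun b c => by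
    rw [← hφ, Equiv.apply_symm_apply, Equiv.apply_symm_apply]
  eq_zero v hv j := by simpa using hg.eq_zero v hv j
  isect_eq v hv j := (isect_comp_symm hφ _ _).trans (hg.isect_eq v hv j)
  apply_isect w hw h := by
    have h1 := hg.apply_isect (w ∘ φ) (hw.comp hφ) h
    have h2 : ∀ j, isect (w ∘ φ) (d j) = isect w (φ (d j)) := fun j => by
      rw [← isect_comp_symm hφ, Function.comp_assoc, Equiv.self_comp_symm, Function.comp_id]
    simp only [h2] at h1
    simp only [Function.comp_apply, h1, Function.comp_assoc, Equiv.self_comp_symm,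
      Function.comp_id]

theorem IsChartInverse.reorder {d d' : Fin 3 → Fin 9} {g : (Fin 3 → ℝ) → Fin 9 → ℝ}
    (hg : IsChartInverse d g) (hd : Function.Injective d) (hd' : Function.Injective d')
    (h : Set.range d' = Set.range d) : ∃ g', IsChartInverse d' g' := by
  let τ : Equiv.Perm (Fin 3) :=
    (Equiv.ofInjective d' hd').trans ((Equiv.setCongr h).trans (Equiv.ofInjective d hd).symm)
  have hτ : ∀ j, d (τ j) = d' j := fun j =>
    Equiv.apply_ofInjective_symm hd ((Equiv.setCongr h) (Equiv.ofInjective d' hd' j))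
  have hτ' : ∀ j, d' (τ.symm j) = d j := fun j => by rw [← hτ, Equiv.apply_symm_apply]
  have hoct : ∀ v ∈ octant, v ∘ τ.symm ∈ octant := fun v hv =>
    ⟨fun j => hv.1 _, fun h0 => hv.2 (by
      funext j
      simpa using congrFun h0 (τ j))⟩
  refine ⟨fun v => g (v ∘ τ.symm), ?_, fun v hv => hg.admissible _ (hoct v hv), fun v hv j => ?_,
    fun v hv j => ?_, fun w hw hz => ?_⟩
  · exact hg.continuous.comp (continuous_pi fun j => continuous_apply _)
  · rw [← hτ]
    exact hg.eq_zero _ (hoct v hv) _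
  · rw [← hτ, hg.isect_eq _ (hoct v hv)]
    simp
  · have := hg.apply_isect w hw fun j => by rw [← hτ', hz]
    simpa only [Function.comp_def, hτ'] using this

/-- Move the triple to one of the three standard ones by a symmetry of the crossing table, then
renumber its arcs. -/
theorem IsTriple.exists_isChartInverse {d : Fin 3 → Fin 9} (hd : IsTriple d) :
    ∃ g, IsChartInverse d g := by
  obtain ⟨n, -, m, -, e, he, himg⟩ := triples_symmetric _ hd.image_mem
  have hstd : ∃ d₀ g₀, Function.Injective d₀ ∧ IsChartInverse d₀ g₀ ∧ Finset.univ.image d₀ = e := by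
    simp only [List.mem_cons, List.not_mem_nil, or_false] at he
    rcases he with rfl | rfl | rfl
    · exact ⟨_, _, by decide, isChartInverse_sphereInv, by decide⟩
    · exact ⟨_, _, by decide, isChartInverse_fanInv, by decide⟩
    · exact ⟨_, _, by decide, isChartInverse_zigzagInv, by decide⟩
  obtain ⟨d₀, g₀, hd₀, hg₀, rfl⟩ := hstd
  have hrefl : ∃ φ : Equiv.Perm (Fin 9), (∀ b c, crossTable (φ b) (φ c) = crossTable b c) ∧
      ∀ c, φ c = reflect^[m] c := by
    clear himg
    induction m with
    | zero => exact ⟨Equiv.refl _, fun _ _ => rfl, fun _ => rfl⟩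
    | succ m ih =>
      obtain ⟨φ, h1, h2⟩ := ih
      exact ⟨φ.trans reflect, fun b c => (crossTable_reflect _ _).trans (h1 b c), fun c => by
        rw [Function.iterate_succ_apply', ← h2]
        rfl⟩
  have hrot : ∃ φ : Equiv.Perm (Fin 9), (∀ b c, crossTable (φ b) (φ c) = crossTable b c) ∧
      ∀ c, φ c = rotate^[n] c := by
    clear himg
    induction n with
    | zero => exact ⟨Equiv.refl _, fun _ _ => rfl, fun _ => rfl⟩
    | succ n ih =>
      obtain ⟨φ, h1, h2⟩ := ih
      exact ⟨φ.trans rotate, fun b c => (crossTable_rotate _ _).trans (h1 b c), fun c => by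
        rw [Function.iterate_succ_apply', ← h2]
        rfl⟩
  obtain ⟨φ, hφ, hφe⟩ := hrefl
  obtain ⟨ρ, hρ, hρe⟩ := hrot
  refine ((hg₀.map hφ).map hρ).reorder (ρ.injective.comp (φ.injective.comp hd₀)) hd.1 ?_
  ext c
  have h1 := congrArg (c ∈ ·) himg
  simpa [hφe, hρe] using h1

/-! ### The topology of the space of measured foliations -/

theorem coord_eq_isect (x : MF) (c : ArcClass) : coord x c = isect (wt x) c.kind := coord_eq x c

theorem weight_eq (x : MF) (c : ArcClass) : weight x c = wt x c.kind := by
  rw [wt, classOf_kind]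

theorem isect_nonneg {w : Fin 9 → ℝ} (hw : Admissible w) (c : Fin 9) : 0 ≤ isect w c :=
  Finset.sum_nonneg fun b _ => mul_nonneg (hw.nonneg b) (by unfold crossing; split_ifs <;> norm_num)

theorem isect_smul (r : ℝ) (w : Fin 9 → ℝ) (c : Fin 9) : isect (r • w) c = r * isect w c := by
  simp only [isect, Finset.mul_sum, Pi.smul_apply, smul_eq_mul, mul_assoc]

theorem isect_add (v w : Fin 9 → ℝ) (c : Fin 9) : isect (v + w) c = isect v c + isect w c := by
  simp only [isect, ← Finset.sum_add_distrib, Pi.add_apply, add_mul]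

theorem mul_crossing_le_isect {w : Fin 9 → ℝ} (hw : Admissible w) (b c : Fin 9) :
    w b * crossing b c ≤ isect w c :=
  Finset.single_le_sum (f := fun b => w b * crossing b c) (fun b _ => mul_nonneg (hw.nonneg b)
    (by unfold crossing; split_ifs <;> norm_num)) (Finset.mem_univ b)

theorem isect_pos {w : Fin 9 → ℝ} (hw : Admissible w) {b c : Fin 9} (hb : w b ≠ 0)
    (h : Cross b c) : 0 < isect w c := by
  have h1 := mul_crossing_le_isect hw b c
  rw [crossing, if_pos h, mul_one] at h1
  exact (lt_of_le_of_ne (hw.nonneg b) hb.symm).trans_le h1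

/-- Positive intersection requires leaves of a crossing kind, which exclude leaves parallel to the
arc itself. -/
theorem eq_zero_of_isect_pos {w : Fin 9 → ℝ} (hw : Admissible w) {c : Fin 9}
    (h : 0 < isect w c) : w c = 0 := by
  obtain ⟨b, -, hb⟩ := Finset.exists_ne_zero_of_sum_ne_zero h.ne'
  have h1 : Cross b c := by
    by_contra hc
    exact hb (by rw [crossing, if_neg hc, mul_zero])
  by_contra hc
  exact hw.not_cross b c (left_ne_zero_of_mul hb) hc h1

theorem Admissible.smul {w : Fin 9 → ℝ} (hw : Admissible w) {r : ℝ} (hr : 0 < r) :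
    Admissible (r • w) := by
  refine ⟨fun c => mul_nonneg hr.le (hw.nonneg c), smul_ne_zero hr.ne' hw.ne_zero,
    fun b c hb hc => hw.not_cross b c ?_ ?_⟩
  · exact right_ne_zero_of_mul hb
  · exact right_ne_zero_of_mul hc

theorem inter_ne_top (x : MF) (c : ArcClass) : inter x c ≠ ⊤ := by
  rw [inter_eq]
  exact ENNReal.ofReal_ne_top

theorem continuous_coord (c : ArcClass) : Continuous fun x : MF => coord x c := by
  have h0 : Continuous inter := continuous_induced_dom
  have h : Continuous fun x : MF => inter x c := (continuous_apply c).comp h0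
  exact ENNReal.continuousOn_toReal.comp_continuous h fun x => inter_ne_top x c

/-- The topology is defined by intersection numbers, and `recover` expresses the weights
continuously through them. -/
theorem continuous_wt : Continuous wt := by
  have h : wt = fun x => recover fun c => coord x (classOf c) := by
    funext x
    refine (recover_isect (wt_admissible x)).symm.trans (congrArg recover (funext fun c => ?_))
    rw [coord_eq_isect, kind_classOf]
  rw [h]
  exact continuous_recover.comp (continuous_pi fun c => continuous_coord _)

theorem continuous_isect (c : Fin 9) : Continuous fun w : Fin 9 → ℝ => isect w c := by
  unfold isect
  fun_prop

/-- The class of measured foliations with given weights. -/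
def ofWeight (w : Fin 9 → ℝ) (hw : Admissible w) : MF := (stdFoliation w hw).toMF

theorem wt_ofWeight (w : Fin 9 → ℝ) (hw : Admissible w) : wt (ofWeight w hw) = w :=
  wt_toMF_std w hw

theorem continuous_ofWeight {X : Type*} [TopologicalSpace X] {f : X → Fin 9 → ℝ}
    (hf : Continuous f) (h : ∀ x, Admissible (f x)) : Continuous fun x => ofWeight (f x) (h x) := by
  refine continuous_induced_rng.2 (continuous_pi fun c => ?_)
  have h1 : (fun x => inter (ofWeight (f x) (h x)) c) =
      fun x => ENNReal.ofReal (isect (f x) c.kind) := by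
    funext x
    rw [inter_eq, wt_ofWeight]
    rfl
  show Continuous fun x => inter (ofWeight (f x) (h x)) c
  rw [h1]
  exact ENNReal.continuous_ofReal.comp ((continuous_isect _).comp hf)

theorem isEmbedding_wt : Topology.IsEmbedding wt := by
  have h1 : Continuous fun w : {w : Fin 9 → ℝ // Admissible w} => ofWeight w.1 w.2 :=
    continuous_ofWeight continuous_subtype_val _
  let e : MF ≃ₜ {w : Fin 9 → ℝ // Admissible w} :=
    { toFun := fun x => ⟨wt x, wt_admissible x⟩
      invFun := fun w => ofWeight w.1 w.2
      left_inv := fun x => toMF_std_wt x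
      right_inv := fun w => Subtype.ext (wt_ofWeight _ _)
      continuous_toFun := continuous_wt.subtype_mk _
      continuous_invFun := h1 }
  exact Topology.IsEmbedding.subtypeVal.comp e.isEmbedding

theorem wt_scale (F : MeasuredFoliation) (r : ℝ) (hr : 0 < r) :
    wt (F.scale r hr).toMF = r • wt F.toMF := by
  funext c
  have h1 : wt (F.scale r hr).toMF c = (F.scale r hr).leafMeasure (classOf c) := rfl
  have h2 : (r • wt F.toMF) c = r * F.leafMeasure (classOf c) := rfl
  rw [h1, h2, MeasuredFoliation.leafMeasure_eq, MeasuredFoliation.leafMeasure_eq, Finset.mul_sum]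
  refine Finset.sum_congr rfl fun k _ => ?_
  rw [mul_ite, mul_zero]
  rfl

/-- In terms of weights the relation that defines `PMF` is proportionality. This is already an
equivalence, so the generated equivalence relation is no larger. -/
theorem toPMF_eq_iff {x y : MF} : x.toPMF = y.toPMF ↔ ∃ r : ℝ, 0 < r ∧ wt y = r • wt x := by
  let R : MF → MF → Prop := fun x y => ∃ r : ℝ, 0 < r ∧ wt y = r • wt x
  have hR : Equivalence R := by
    refine ⟨fun x => ⟨1, one_pos, (one_smul _ _).symm⟩, ?_, ?_⟩
    · rintro x y ⟨r, hr, h⟩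
      exact ⟨r⁻¹, inv_pos.2 hr, by rw [h, smul_smul, inv_mul_cancel₀ hr.ne', one_smul]⟩
    · rintro x y z ⟨r, hr, h⟩ ⟨s, hs, h'⟩
      exact ⟨s * r, mul_pos hs hr, by rw [h', h, smul_smul]⟩
  have hrel : ∀ x y : MF, (∃ (F : MeasuredFoliation) (r : ℝ) (hr : 0 < r),
      F.toMF = x ∧ (F.scale r hr).toMF = y) ↔ R x y := by
    intro x y
    constructor
    · rintro ⟨F, r, hr, rfl, rfl⟩
      exact ⟨r, hr, wt_scale F r hr⟩
    · rintro ⟨r, hr, h⟩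
      refine ⟨stdFoliation (wt x) (wt_admissible x), r, hr, toMF_std_wt x, wt_injective ?_⟩
      rw [wt_scale, toMF_std_wt, h]
  constructor
  · intro h
    have h1 := Quot.eqvGen_exact h
    have h2 := Relation.EqvGen.mono (fun a b hab => (hrel a b).1 hab) _ _ h1
    exact hR.eqvGen_iff.1 h2
  · intro h
    exact Quot.sound ((hrel x y).2 h)

theorem isOpenQuotientMap_toPMF : IsOpenQuotientMap MF.toPMF := by
  have hq : Topology.IsQuotientMap MF.toPMF := isQuotientMap_quot_mk
  refine ⟨hq.surjective, hq.continuous, fun U hU => ?_⟩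
  rw [← hq.isOpen_preimage]
  -- The saturation of an open set is the union of its preimages under the scalings, which are
  -- continuous.
  have h1 : MF.toPMF ⁻¹' (MF.toPMF '' U) = ⋃ r : {r : ℝ // 0 < r},
      (fun x => ofWeight (r.1 • wt x) ((wt_admissible x).smul r.2)) ⁻¹' U := by
    ext y
    simp only [Set.mem_preimage, Set.mem_image, Set.mem_iUnion]
    constructor
    · rintro ⟨x, hx, h⟩
      obtain ⟨r, hr, h'⟩ := toPMF_eq_iff.1 h.symm
      refine ⟨⟨r, hr⟩, ?_⟩
      have : ofWeight (r • wt y) ((wt_admissible y).smul hr) = x :=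
        wt_injective (by rw [wt_ofWeight, h'])
      rwa [this]
    · rintro ⟨⟨r, hr⟩, h⟩
      exact ⟨_, h, (toPMF_eq_iff.2 ⟨r, hr, wt_ofWeight _ _⟩).symm⟩
  rw [h1]
  exact isOpen_iUnion fun r => hU.preimage (continuous_ofWeight (continuous_wt.const_smul r.1) _)

/-- Projective classes can be parametrized by normalized representatives. -/
theorem exists_homeomorph_image {S : Set MF}
    (hS : ∀ x y : MF, x.toPMF = y.toPMF → x ∈ S → y ∈ S) {Z : Type*} [TopologicalSpace Z]
    (q : S → Z) (hq : Continuous q) (s : Z → S) (hs : Continuous s) (hqs : ∀ z, q (s z) = z)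
    (hsq : ∀ x : S, (s (q x)).1.toPMF = x.1.toPMF)
    (hc : ∀ x y : S, x.1.toPMF = y.1.toPMF → q x = q y) :
    ∃ e : (MF.toPMF '' S) ≃ₜ Z, ∀ (x : MF) (hx : x ∈ S),
      e ⟨x.toPMF, Set.mem_image_of_mem _ hx⟩ = q ⟨x, hx⟩ := by
  let p : S → MF.toPMF '' S := fun x => ⟨x.1.toPMF, Set.mem_image_of_mem _ x.2⟩
  have hpc : Continuous p :=
    (isOpenQuotientMap_toPMF.continuous.comp continuous_subtype_val).subtype_mk _
  have hps : Function.Surjective p := by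
    rintro ⟨_, x, hx, rfl⟩
    exact ⟨⟨x, hx⟩, rfl⟩
  have hpo : IsOpenMap p := by
    rintro _ ⟨V, hV, rfl⟩
    -- Since `S` is saturated, a point of `V` whose projective class comes from `S` lies itself in
    -- `S`; therefore openness passes to the restriction.
    refine ⟨MF.toPMF '' V, isOpenQuotientMap_toPMF.isOpenMap V hV, ?_⟩
    ext y
    constructor
    · rintro ⟨x, hx, h⟩
      obtain ⟨x', rfl⟩ := hps y
      have hxS : x ∈ S := hS _ _ h.symm x'.2
      exact ⟨⟨x, hxS⟩, hx, Subtype.ext h⟩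
    · rintro ⟨x, hx, rfl⟩
      exact ⟨x.1, hx, rfl⟩
  have hpq : Topology.IsQuotientMap p := hpo.isQuotientMap hpc hps
  let f : MF.toPMF '' S → Z := fun y => q (hps y).choose
  have hf : ∀ x, f (p x) = q x := fun x =>
    hc _ _ (congrArg Subtype.val (hps (p x)).choose_spec)
  refine ⟨⟨⟨f, fun z => p (s z), fun y => ?_, fun z => by rw [hf, hqs]⟩, ?_, hpc.comp hs⟩,
    fun x hx => hf ⟨x, hx⟩⟩
  · obtain ⟨x, rfl⟩ := hps y
    rw [hf]
    exact Subtype.ext (hsq x)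
  · rw [hpq.continuous_iff]
    have : f ∘ p = q := funext hf
    rwa [this]

theorem exists_homeomorph_PMF {Z : Type*} [TopologicalSpace Z]
    (q : MF → Z) (hq : Continuous q) (s : Z → MF) (hs : Continuous s) (hqs : ∀ z, q (s z) = z)
    (hsq : ∀ x, (s (q x)).toPMF = x.toPMF) (hc : ∀ x y, x.toPMF = y.toPMF → q x = q y) :
    ∃ e : PMF ≃ₜ Z, ∀ x : MF, e x.toPMF = q x := by
  obtain ⟨e, he⟩ := exists_homeomorph_image (S := Set.univ) (fun _ _ _ _ => trivial)
    (fun x => q x.1) (hq.comp continuous_subtype_val) (fun z => ⟨s z, trivial⟩)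
    (hs.subtype_mk _) hqs (fun x => hsq x.1) (fun x y => hc x.1 y.1)
  have hu : (Set.univ : Set PMF) = MF.toPMF '' Set.univ :=
    (Set.image_univ_of_surjective isOpenQuotientMap_toPMF.surjective).symm
  exact ⟨(Homeomorph.Set.univ PMF).symm.trans ((Homeomorph.setCongr hu).trans e),
    fun x => he x trivial⟩

/-! ### Charts of the space of measured foliations -/

theorem isArcTriple_iff {d : Fin 3 → ArcClass} :
    IsArcTriple d ↔ IsTriple fun j => (d j).kind := by
  rw [IsArcTriple, IsTriple, isArcSystem_iff]
  refine and_congr ?_ ?_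
  · exact (classEquiv.injective.of_comp_iff d).symm
  · simp only [Set.forall_mem_range]

theorem IsTriple.sum_isect_pos {d : Fin 3 → Fin 9} (hd : IsTriple d) {w : Fin 9 → ℝ}
    (hw : Admissible w) (h : ∀ j, w (d j) = 0) : ∃ j, 0 < isect w (d j) := by
  obtain ⟨b, hb⟩ := Function.ne_iff.1 hw.ne_zero
  obtain ⟨j, hj⟩ := hd.exists_cross (b := b) fun j hj => hb (hj ▸ h j)
  exact ⟨j, isect_pos hw hb hj⟩

theorem IsTriple.isect_mem_octant {d : Fin 3 → Fin 9} (hd : IsTriple d) {w : Fin 9 → ℝ}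
    (hw : Admissible w) (h : ∀ j, w (d j) = 0) : (fun j => isect w (d j)) ∈ octant := by
  refine ⟨fun j => isect_nonneg hw _, fun h0 => ?_⟩
  obtain ⟨j, hj⟩ := hd.sum_isect_pos hw h
  exact hj.ne' (congrFun h0 j)

/-- The condition of a positive coordinate sum is automatic by maximality of arc triples. -/
theorem mem_MFgood_iff {d : Fin 3 → ArcClass} (hd : IsArcTriple d) {x : MF} :
    x ∈ MFgood d ↔ ∀ j, wt x (d j).kind = 0 := by
  have hs : x ∈ MFgood d ↔ 0 < ∑ j, inter x (d j) ∧ ∀ j, ¬ HasLeaf x (d j) := Iff.rfl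
  rw [hs]
  simp only [hasLeaf_iff, not_not, and_iff_right_iff_imp]
  intro h
  obtain ⟨j, hj⟩ := (isArcTriple_iff.1 hd).sum_isect_pos (wt_admissible x) h
  refine lt_of_lt_of_le ?_ (Finset.single_le_sum (f := fun j => inter x (d j))
    (fun _ _ => zero_le) (Finset.mem_univ j))
  rw [inter_eq]
  exact ENNReal.ofReal_pos.2 hj

theorem chart_eq (d : Fin 3 → ArcClass) (x : MF) :
    chart d x = fun j => isect (wt x) (d j).kind := by
  funext j
  exact coord_eq_isect x (d j)

theorem chart_of_smul {x y : MF} {r : ℝ} (h : wt y = r • wt x) (d : Fin 3 → ArcClass) :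
    chart d y = r • chart d x := by
  funext j
  simp only [chart_eq, h, isect_smul, Pi.smul_apply, smul_eq_mul]

theorem continuous_chart (d : Fin 3 → ArcClass) : Continuous (chart d) :=
  continuous_pi fun j => continuous_coord (d j)

theorem MFgood_saturated {d : Fin 3 → ArcClass} (hd : IsArcTriple d) (x y : MF)
    (h : x.toPMF = y.toPMF) (hx : x ∈ MFgood d) : y ∈ MFgood d := by
  obtain ⟨r, hr, h'⟩ := toPMF_eq_iff.1 h
  rw [mem_MFgood_iff hd] at hx ⊢
  intro j
  rw [h', Pi.smul_apply, hx j, smul_zero]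

theorem chart_image_MFgood {d : Fin 3 → ArcClass} (hd : IsArcTriple d) :
    chart d '' MFgood d = octant := by
  have hd' := isArcTriple_iff.1 hd
  obtain ⟨g, hg⟩ := hd'.exists_isChartInverse
  ext v
  constructor
  · rintro ⟨x, hx, rfl⟩
    rw [chart_eq]
    exact hd'.isect_mem_octant (wt_admissible x) ((mem_MFgood_iff hd).1 hx)
  · intro hv
    refine ⟨ofWeight (g v) (hg.admissible v hv), (mem_MFgood_iff hd).2 fun j => ?_, ?_⟩
    · rw [wt_ofWeight]
      exact hg.eq_zero v hv j
    · rw [chart_eq, wt_ofWeight]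
      exact funext (hg.isect_eq v hv)

theorem isEmbedding_chart {d : Fin 3 → ArcClass} (hd : IsArcTriple d) :
    Topology.IsEmbedding fun x : MFgood d => chart d x := by
  obtain ⟨g, hg⟩ := (isArcTriple_iff.1 hd).exists_isChartInverse
  refine Topology.IsEmbedding.of_comp ((continuous_chart d).comp continuous_subtype_val)
    hg.continuous ?_
  have : (g ∘ fun x : MFgood d => chart d x) = wt ∘ Subtype.val := by
    funext x
    simp only [Function.comp_apply, chart_eq]
    exact hg.apply_isect _ (wt_admissible _) ((mem_MFgood_iff hd).1 x.2)
  rw [this]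
  exact isEmbedding_wt.comp Topology.IsEmbedding.subtypeVal

theorem sum_pos_of_mem_octant {v : Fin 3 → ℝ} (hv : v ∈ octant) : 0 < ∑ j, v j := by
  obtain ⟨j, hj⟩ := Function.ne_iff.1 hv.2
  exact Finset.sum_pos' (fun i _ => hv.1 i)
    ⟨j, Finset.mem_univ j, lt_of_le_of_ne (hv.1 j) (Ne.symm hj)⟩

theorem exists_homeomorph_stdSimplex {d : Fin 3 → ArcClass} (hd : IsArcTriple d) :
    ∃ e : PMFgood d ≃ₜ stdSimplex ℝ (Fin 3), ∀ (x : MF) (hx : x ∈ MFgood d) (j : Fin 3),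
      (e ⟨x.toPMF, Set.mem_image_of_mem _ hx⟩ : Fin 3 → ℝ) j = chart d x j / ∑ l, chart d x l := by
  obtain ⟨g, hg⟩ := (isArcTriple_iff.1 hd).exists_isChartInverse
  have hoct : ∀ x ∈ MFgood d, chart d x ∈ octant := fun x hx =>
    chart_image_MFgood hd ▸ Set.mem_image_of_mem _ hx
  have hpos : ∀ x ∈ MFgood d, 0 < ∑ l, chart d x l := fun x hx =>
    sum_pos_of_mem_octant (hoct x hx)
  have hsimp : ∀ v : stdSimplex ℝ (Fin 3), v.1 ∈ octant := fun v =>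
    ⟨v.2.1, fun h => by simpa [h] using v.2.2⟩
  let q : MFgood d → stdSimplex ℝ (Fin 3) := fun x =>
    ⟨fun j => chart d x j / ∑ l, chart d x l,
      fun j => div_nonneg ((hoct x x.2).1 j) (hpos x x.2).le, by
        rw [← Finset.sum_div, div_self (hpos x x.2).ne']⟩
  let s : stdSimplex ℝ (Fin 3) → MFgood d := fun v =>
    ⟨ofWeight (g v.1) (hg.admissible _ (hsimp v)), (mem_MFgood_iff hd).2 fun j => by
      rw [wt_ofWeight]
      exact hg.eq_zero _ (hsimp v) j⟩
  have hchart : ∀ v, chart d (s v) = v.1 := fun v => by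
    rw [chart_eq, wt_ofWeight]
    exact funext (hg.isect_eq _ (hsimp v))
  have hq : Continuous q := by
    refine Continuous.subtype_mk (continuous_pi fun j => ?_) _
    have h1 : ∀ j, Continuous fun x : MFgood d => chart d x j := fun j =>
      (continuous_apply j).comp ((continuous_chart d).comp continuous_subtype_val)
    exact (h1 j).div (continuous_finsetSum _ fun l _ => h1 l) fun x => (hpos x x.2).ne'
  have hs : Continuous s :=
    (continuous_ofWeight (hg.continuous.comp continuous_subtype_val) _).subtype_mk _
  have hqs : ∀ v, q (s v) = v := by
    intro v
    apply Subtype.ext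
    funext j
    show chart d (s v) j / ∑ l, chart d (s v) l = v.1 j
    rw [hchart, v.2.2, div_one]
  have hsq : ∀ x, (s (q x)).1.toPMF = x.1.toPMF := by
    intro x
    have hr := hpos x x.2
    set r := ∑ l, chart d x l with hrdef
    -- No homogeneity of `g` is available, so it is applied to the rescaled weights, whose
    -- coordinates are the normalized ones.
    have h1 := hg.apply_isect (r⁻¹ • wt x) ((wt_admissible _).smul (inv_pos.2 hr)) fun j => by
      rw [Pi.smul_apply, (mem_MFgood_iff hd).1 x.2 j, smul_zero]
    have h2 : (fun j => isect (r⁻¹ • wt x.1) (d j).kind) = (q x).1 := by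
      funext j
      show _ = chart d x j / r
      rw [isect_smul, chart_eq, div_eq_inv_mul]
    rw [h2] at h1
    refine toPMF_eq_iff.2 ⟨r, hr, ?_⟩
    rw [wt_ofWeight, h1, smul_smul, mul_inv_cancel₀ hr.ne', one_smul]
  have hc : ∀ x y : MFgood d, x.1.toPMF = y.1.toPMF → q x = q y := by
    intro x y hxy
    obtain ⟨r, hr, h⟩ := toPMF_eq_iff.1 hxy
    apply Subtype.ext
    funext j
    show chart d x j / ∑ l, chart d x l = chart d y j / ∑ l, chart d y l
    simp only [chart_of_smul h, Pi.smul_apply, smul_eq_mul, ← Finset.mul_sum]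
    rw [mul_div_mul_left _ _ hr.ne']
  obtain ⟨e, he⟩ := exists_homeomorph_image (MFgood_saturated hd) q hq s hs hqs hsq hc
  exact ⟨e, fun x hx j => congrFun (congrArg Subtype.val (he x hx)) j⟩

/-- Zero intersection means that nothing in the support crosses `c`, so leaves of kind `c` can be
added. -/
theorem admissible_add_single {w : Fin 9 → ℝ} (hw : Admissible w) {c : Fin 9}
    (hc : isect w c = 0) {ε : ℝ} (hε : 0 ≤ ε) : Admissible (w + Pi.single c ε) := by
  have hcross : ∀ b, w b ≠ 0 → ¬ Cross b c := fun b hb h => (isect_pos hw hb h).ne' hc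
  have hsup : ∀ b, (w + Pi.single c ε : Fin 9 → ℝ) b ≠ 0 → w b ≠ 0 ∨ b = c := by
    intro b hb
    by_contra! h
    exact hb (by simp [h.1, h.2])
  have hnn : ∀ b, 0 ≤ (Pi.single c ε : Fin 9 → ℝ) b := fun b => by
    by_cases h : b = c
    · subst h; simpa using hε
    · simp [h]
  refine ⟨fun b => add_nonneg (hw.nonneg b) (hnn b), fun h => hw.ne_zero ?_, fun a b ha hb h => ?_⟩
  · funext b
    have h1 := congrFun h b
    simp only [Pi.add_apply, Pi.zero_apply] at h1 ⊢
    linarith [hw.nonneg b, hnn b]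
  · rcases hsup a ha with ha' | ha' <;> rcases hsup b hb with hb' | hb'
    · exact hw.not_cross a b ha' hb' h
    · exact hcross a ha' (hb' ▸ h)
    · exact hcross b hb' ((cross_comm _ _).1 (ha' ▸ h))
    · exact not_cross_self c (by rwa [ha', hb'] at h)

theorem mem_interior_PMFgood_iff {d : Fin 3 → ArcClass} (hd : IsArcTriple d) (x : MF) :
    x.toPMF ∈ interior (PMFgood d) ↔ ∀ j, 0 < chart d x j := by
  have hpre : ∀ y : MF, y.toPMF ∈ PMFgood d → y ∈ MFgood d := by
    rintro y ⟨z, hz, h⟩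
    exact MFgood_saturated hd z y h hz
  constructor
  · intro h j
    have hV : IsOpen (MF.toPMF ⁻¹' interior (PMFgood d)) :=
      isOpen_interior.preimage isOpenQuotientMap_toPMF.continuous
    rw [chart_eq]
    refine lt_of_le_of_ne (isect_nonneg (wt_admissible x) _) fun h0 => ?_
    -- If the coordinate `j` vanishes, adding few leaves parallel to the arc `j` gives foliations
    -- outside the chart that converge to `x`. The absolute value makes this a continuous path
    -- defined on all of ℝ.
    have hadm : ∀ ε : ℝ, Admissible (wt x + Pi.single (d j).kind |ε|) := fun ε =>
      admissible_add_single (wt_admissible x) h0.symm (abs_nonneg ε)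
    let f : ℝ → MF := fun ε => ofWeight _ (hadm ε)
    have hf : Continuous f := by
      refine continuous_ofWeight ?_ hadm
      have : Continuous fun ε : ℝ => (Pi.single (d j).kind |ε| : Fin 9 → ℝ) :=
        (continuous_single _).comp continuous_abs
      fun_prop
    have hf0 : f 0 = x := wt_injective (by
      rw [wt_ofWeight]
      simp)
    have hmem : f ⁻¹' (MF.toPMF ⁻¹' interior (PMFgood d)) ∈ 𝓝 (0 : ℝ) :=
      (hV.preimage hf).mem_nhds (by
        rw [Set.mem_preimage, hf0]
        exact h)
    obtain ⟨ε, hε, hball⟩ := Metric.mem_nhds_iff.1 hmem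
    have h1 : (ε / 2 : ℝ) ∈ Metric.ball (0 : ℝ) ε := by
      rw [mem_ball_zero_iff, Real.norm_eq_abs, abs_of_pos (by linarith)]
      linarith
    have h2 := hpre _ (interior_subset (hball h1))
    have h3 := (mem_MFgood_iff hd).1 h2 j
    rw [wt_ofWeight, Pi.add_apply, Pi.single_eq_same] at h3
    have h4 := (wt_admissible x).nonneg (d j).kind
    have h5 : 0 < |ε / 2| := abs_pos.2 (by linarith)
    linarith
  · intro h
    let U : Set MF := {y | ∀ j, 0 < chart d y j}
    have hU : IsOpen U := by
      have : U = ⋂ j, {y | 0 < chart d y j} := by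
        ext y
        simp [U]
      rw [this]
      exact isOpen_iInter_of_finite fun j =>
        isOpen_lt continuous_const ((continuous_apply j).comp (continuous_chart d))
    have hsub : U ⊆ MFgood d := fun y hy => (mem_MFgood_iff hd).2 fun j => by
      have h1 : 0 < chart d y j := hy j
      rw [chart_eq] at h1
      exact eq_zero_of_isect_pos (wt_admissible y) h1
    exact mem_interior.2 ⟨MF.toPMF '' U, Set.image_mono hsub,
      isOpenQuotientMap_toPMF.isOpenMap U hU, Set.mem_image_of_mem _ h⟩

theorem exists_isArcTriple {t : Finset (Fin 9)} (ht : t ∈ triples) :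
    ∃ d, IsArcTriple d ∧ Set.range d = classOf '' t := by
  obtain ⟨d, hd, h⟩ := exists_isTriple ht
  refine ⟨classOf ∘ d, isArcTriple_iff.2 ?_, by rw [Set.range_comp, h]⟩
  simpa only [Function.comp_apply, kind_classOf] using hd

theorem exists_chart_pos (x : MF) : ∃ d, IsArcTriple d ∧ ∀ j, 0 < chart d x j := by
  obtain ⟨b, hb⟩ := Function.ne_iff.1 (wt_admissible x).ne_zero
  obtain ⟨t, ht, hc⟩ := exists_triple_cross b
  obtain ⟨d, hd, hr⟩ := exists_isArcTriple ht
  refine ⟨d, hd, fun j => ?_⟩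
  rw [chart_eq]
  refine isect_pos (wt_admissible x) hb ((cross_iff_crossTable _ _).2 (hc _ ?_))
  obtain ⟨c, hc, h⟩ : d j ∈ classOf '' t := hr ▸ Set.mem_range_self j
  rw [← h, kind_classOf]
  exact hc

/-! ### Piecewise linearity -/

/-- The intersection numbers with the arcs of kinds `d`, as a linear map on weights. -/
def isectMap (d : Fin 3 → Fin 9) : (Fin 9 → ℝ) →ₗ[ℝ] (Fin 3 → ℝ) where
  toFun w j := isect w (d j)
  map_add' v w := funext fun j => isect_add v w (d j)
  map_smul' r w := funext fun j => isect_smul r w (d j)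

/-- Extension of weights by zero. -/
def extend (τ : Finset (Fin 9)) : (τ → ℝ) →ₗ[ℝ] (Fin 9 → ℝ) where
  toFun u c := if h : c ∈ τ then u ⟨c, h⟩ else 0
  map_add' u v := by
    funext c
    by_cases h : c ∈ τ <;> simp [h]
  map_smul' r u := by
    funext c
    by_cases h : c ∈ τ <;> simp [h]

theorem extend_of_mem {τ : Finset (Fin 9)} (u : τ → ℝ) {c : Fin 9} (h : c ∈ τ) :
    extend τ u c = u ⟨c, h⟩ := dif_pos h

theorem extend_of_notMem {τ : Finset (Fin 9)} (u : τ → ℝ) {c : Fin 9} (h : c ∉ τ) :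
    extend τ u c = 0 := dif_neg h

theorem extend_admissible {τ : Finset (Fin 9)} (hτ : ∀ b ∈ τ, ∀ c ∈ τ, ¬ Cross b c) {u : τ → ℝ}
    (hu : ∀ c, 0 ≤ u c) (hne : u ≠ 0) : Admissible (extend τ u) := by
  have hmem : ∀ c, extend τ u c ≠ 0 → c ∈ τ := fun c hc => by
    by_contra h
    exact hc (extend_of_notMem u h)
  refine ⟨fun c => ?_, fun h => hne ?_, fun b c hb hc => hτ b (hmem b hb) c (hmem c hc)⟩
  · by_cases h : c ∈ τ
    · rw [extend_of_mem u h]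
      exact hu _
    · rw [extend_of_notMem u h]
  · funext c
    rw [← extend_of_mem u c.2, h]
    rfl

/-- On positive weights `g` recovers the vector; a linear map that is injective on the open orthant
is injective. -/
theorem isectMap_extend_injective {d : Fin 3 → Fin 9} {g : (Fin 3 → ℝ) → Fin 9 → ℝ}
    (hg : IsChartInverse d g) {τ : Finset (Fin 9)} (hτ : ∀ b ∈ τ, ∀ c ∈ τ, ¬ Cross b c)
    (hd : ∀ j, d j ∉ τ) : Function.Injective (isectMap d ∘ₗ extend τ) := by
  intro u v huv
  rcases isEmpty_or_nonempty τ with hemp | ⟨⟨c₀⟩⟩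
  · exact Subsingleton.elim u v
  -- Adding the same large vector to `u` and `v` makes both positive without changing the
  -- difference.
  let k : τ → ℝ := fun c => 1 + |u c| + |v c|
  have hpos : ∀ c, 0 < u c + k c ∧ 0 < v c + k c := fun c => by
    have h1 := neg_abs_le (u c)
    have h2 := neg_abs_le (v c)
    have h3 := abs_nonneg (u c)
    have h4 := abs_nonneg (v c)
    constructor <;> simp only [k] <;> linarith
  have key : ∀ z : τ → ℝ, (∀ c, 0 < z c) → g (isectMap d (extend τ z)) = extend τ z := by
    intro z hz
    refine hg.apply_isect _ (extend_admissible hτ (fun c => (hz c).le) fun h => ?_)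
      fun j => extend_of_notMem z (hd j)
    exact (hz c₀).ne' (congrFun h c₀)
  have h1 := key (u + k) fun c => (hpos c).1
  have h2 := key (v + k) fun c => (hpos c).2
  have h3 : isectMap d (extend τ (u + k)) = isectMap d (extend τ (v + k)) := by
    have huv' : isectMap d (extend τ u) = isectMap d (extend τ v) := huv
    rw [map_add, map_add, map_add, map_add, huv']
  rw [h3, h2] at h1
  funext c
  have h4 := congrFun h1 c.1
  rw [extend_of_mem _ c.2, extend_of_mem _ c.2] at h4
  simp only [Pi.add_apply] at h4
  linarith

/-- With a left inverse Ψ, the image of the orthant is cut out by the inequalities Ψv ≥ 0 and the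
equation v = ΦΨv, written as two opposite inequalities per coordinate. -/
theorem exists_polyhedralCone {n : ℕ} {ι : Type*} [Finite ι]
    (Φ : (ι → ℝ) →ₗ[ℝ] (Fin n → ℝ)) (hΦ : Function.Injective Φ) :
    ∃ Ψ : (Fin n → ℝ) →ₗ[ℝ] (ι → ℝ), Ψ ∘ₗ Φ = LinearMap.id ∧
      IsPolyhedralCone (Φ '' {u | ∀ c, 0 ≤ u c}) := by
  classical
  have := Fintype.ofFinite ι
  obtain ⟨Ψ, hΨ⟩ := LinearMap.exists_leftInverse_of_injective Φ (LinearMap.ker_eq_bot.2 hΦ)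
  have hΨ' : ∀ u, Ψ (Φ u) = u := fun u => LinearMap.congr_fun hΨ u
  let l : ι → (Fin n → ℝ) →ₗ[ℝ] ℝ := fun c => LinearMap.proj c ∘ₗ Ψ
  let m : Fin n → (Fin n → ℝ) →ₗ[ℝ] ℝ := fun j => LinearMap.proj j ∘ₗ (LinearMap.id - Φ ∘ₗ Ψ)
  refine ⟨Ψ, hΨ, Finset.univ.image l ∪ (Finset.univ.image m ∪ Finset.univ.image fun j => -m j), ?_⟩
  ext v
  constructor
  · rintro ⟨u, hu, rfl⟩ f hf
    simp only [Finset.mem_union, Finset.mem_image, Finset.mem_univ, true_and] at hf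
    rcases hf with ⟨c, rfl⟩ | ⟨j, rfl⟩ | ⟨j, rfl⟩
    · simpa [l, hΨ'] using hu c
    · simp [m, hΨ']
    · simp [m, hΨ']
  · intro hv
    have h1 : ∀ c, 0 ≤ Ψ v c := fun c => hv (l c) (by simp)
    have h2 : ∀ j, 0 ≤ v j - Φ (Ψ v) j := fun j => hv (m j) (by simp)
    have h3 : ∀ j, 0 ≤ -(v j - Φ (Ψ v) j) := fun j => hv (-m j) (by simp)
    refine ⟨Ψ v, h1, ?_⟩
    funext j
    linarith [h2 j, h3 j]

/-- Each face contributes the cone of its coordinate vectors, on which a linear left inverse returns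
the weights and so agrees with `g`; composing with `N` gives the linear pieces. -/
theorem isPiecewiseLinearOn_faces {d : Fin 3 → Fin 9} (hd : IsTriple d)
    {g : (Fin 3 → ℝ) → Fin 9 → ℝ} (hg : IsChartInverse d g) {V : Type*} [AddCommGroup V]
    [Module ℝ V] (N : (Fin 9 → ℝ) →ₗ[ℝ] V) (𝒯 : Finset (Finset (Fin 9)))
    (h𝒯 : ∀ τ ∈ 𝒯, (∀ b ∈ τ, ∀ c ∈ τ, ¬ Cross b c) ∧ ∀ j, d j ∉ τ) :
    IsPiecewiseLinearOn (fun v => N (g v)) {v | ∃ w, Admissible w ∧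
      (∃ τ ∈ 𝒯, ∀ c, w c ≠ 0 → c ∈ τ) ∧ (fun j => isect w (d j)) = v} := by
  have hinj : ∀ τ : 𝒯, Function.Injective (isectMap d ∘ₗ extend τ.1) := fun τ =>
    isectMap_extend_injective hg (h𝒯 τ.1 τ.2).1 (h𝒯 τ.1 τ.2).2
  choose Ψ hΨ hcone using fun τ => exists_polyhedralCone _ (hinj τ)
  have hvanish : ∀ (τ : 𝒯) (u : τ.1 → ℝ) (j : Fin 3), extend τ.1 u (d j) = 0 := fun τ u j =>
    extend_of_notMem u ((h𝒯 τ.1 τ.2).2 j)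
  refine ⟨𝒯.card, fun k => (isectMap d ∘ₗ extend (𝒯.equivFin.symm k).1) '' {u | ∀ c, 0 ≤ u c},
    fun k => N ∘ₗ extend (𝒯.equivFin.symm k).1 ∘ₗ Ψ (𝒯.equivFin.symm k),
    fun k => hcone _, ?_, ?_⟩
  · ext v
    constructor
    · rintro ⟨w, hw, ⟨τ, hτ, hsupp⟩, rfl⟩
      have hext : extend τ (fun c => w c.1) = w := by
        funext c
        by_cases h : c ∈ τ
        · rw [extend_of_mem _ h]
        · rw [extend_of_notMem _ h]
          by_contra h'
          exact h (hsupp c (Ne.symm h'))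
      refine ⟨Set.mem_iUnion.2 ⟨𝒯.equivFin ⟨τ, hτ⟩, ?_⟩, ?_⟩
      · rw [Equiv.symm_apply_apply]
        refine ⟨fun c => w c.1, fun c => hw.nonneg _, ?_⟩
        rw [LinearMap.comp_apply, hext]
        rfl
      · refine (hd.isect_mem_octant hw fun j => ?_).2
        by_contra h
        exact (h𝒯 τ hτ).2 j (hsupp _ h)
    · rintro ⟨hv, hv0⟩
      obtain ⟨k, u, hu, rfl⟩ := Set.mem_iUnion.1 hv
      refine ⟨extend (𝒯.equivFin.symm k).1 u,
        extend_admissible (h𝒯 _ (𝒯.equivFin.symm k).2).1 hu fun h => hv0 ?_,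
        ⟨_, (𝒯.equivFin.symm k).2, fun c hc => ?_⟩, rfl⟩
      · rw [h, map_zero]
        rfl
      · by_contra h
        exact hc (extend_of_notMem u h)
  · rintro k _ ⟨u, hu, rfl⟩ hv0
    have h1 := hg.apply_isect (extend (𝒯.equivFin.symm k).1 u)
      (extend_admissible (h𝒯 _ (𝒯.equivFin.symm k).2).1 hu fun h => hv0 (by rw [h, map_zero]))
      (hvanish _ u)
    have h2 : Ψ (𝒯.equivFin.symm k) ((isectMap d ∘ₗ extend (𝒯.equivFin.symm k).1) u) = u :=
      LinearMap.congr_fun (hΨ (𝒯.equivFin.symm k)) u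
    show N (g (isectMap d (extend (𝒯.equivFin.symm k).1 u))) =
      N (extend (𝒯.equivFin.symm k).1
        (Ψ (𝒯.equivFin.symm k) ((isectMap d ∘ₗ extend (𝒯.equivFin.symm k).1) u)))
    rw [h2]
    exact congrArg N h1

/-- The sets of kinds of the arc systems that avoid a given set of kinds. -/
def facesAvoiding (A : Finset (Fin 9)) : Finset (Finset (Fin 9)) :=
  {τ | (∀ b ∈ τ, ∀ c ∈ τ, ¬ Cross b c) ∧ Disjoint A τ}

/-- The set `A` prescribes further vanishing weights: the triple of a second chart for coordinate
changes, or nothing for the whole octant. -/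
theorem exists_piecewiseLinear {d : Fin 3 → ArcClass} (hd : IsArcTriple d) {V : Type*}
    [AddCommGroup V] [Module ℝ V] (N : (Fin 9 → ℝ) →ₗ[ℝ] V) (A : Finset (Fin 9)) :
    ∃ f : (Fin 3 → ℝ) → V,
      IsPiecewiseLinearOn f (chart d '' {x | x ∈ MFgood d ∧ ∀ c ∈ A, wt x c = 0}) ∧
      ∀ x ∈ MFgood d, f (chart d x) = N (wt x) := by
  have hd' := isArcTriple_iff.1 hd
  obtain ⟨g, hg⟩ := hd'.exists_isChartInverse
  refine ⟨fun v => N (g v), ?_, fun x hx => ?_⟩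
  · have h := isPiecewiseLinearOn_faces hd' hg N
      (facesAvoiding (A ∪ Finset.univ.image fun j => (d j).kind)) fun τ hτ => by
        obtain ⟨h1, h2⟩ := (Finset.mem_filter.1 hτ).2
        exact ⟨h1, fun j hj => Finset.disjoint_left.1 h2 (by simp) hj⟩
    convert h using 1
    ext v
    constructor
    · rintro ⟨x, ⟨hx, hA⟩, rfl⟩
      refine ⟨wt x, wt_admissible x, ⟨weightSupport (wt x), ?_, fun c hc => ?_⟩,
        (chart_eq d x).symm⟩
      · refine Finset.mem_filter.2 ⟨Finset.mem_univ _, fun b hb c hc => ?_, ?_⟩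
        · exact (wt_admissible x).not_cross b c (Finset.mem_filter.1 hb).2
            (Finset.mem_filter.1 hc).2
        · rw [Finset.disjoint_left]
          intro c hc hc'
          refine (Finset.mem_filter.1 hc').2 ?_
          rcases Finset.mem_union.1 hc with hc | hc
          · exact hA c hc
          · obtain ⟨j, -, rfl⟩ := Finset.mem_image.1 hc
            exact (mem_MFgood_iff hd).1 hx j
      · exact Finset.mem_filter.2 ⟨Finset.mem_univ _, hc⟩
    · rintro ⟨w, hw, ⟨τ, hτ, hs⟩, rfl⟩
      have h2 := (Finset.mem_filter.1 hτ).2.2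
      have h3 : ∀ c ∈ A ∪ Finset.univ.image fun j => (d j).kind, w c = 0 := fun c hc => by
        by_contra h
        exact Finset.disjoint_left.1 h2 hc (hs c h)
      refine ⟨ofWeight w hw, ⟨(mem_MFgood_iff hd).2 fun j => ?_, fun c hc => ?_⟩, ?_⟩
      · rw [wt_ofWeight]
        exact h3 _ (by simp)
      · rw [wt_ofWeight]
        exact h3 _ (Finset.mem_union_left _ hc)
      · rw [chart_eq, wt_ofWeight]
  · show N (g (chart d x)) = N (wt x)
    rw [chart_eq, hg.apply_isect _ (wt_admissible x) ((mem_MFgood_iff hd).1 hx)]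

/-! ### The arc triples -/

theorem range_arcTriple_iff {S : Set ArcClass} :
    (∃ d, IsArcTriple d ∧ Set.range d = S) ↔ ∃ t ∈ triples, classOf '' (t : Set (Fin 9)) = S := by
  constructor
  · rintro ⟨d, hd, rfl⟩
    refine ⟨_, (isArcTriple_iff.1 hd).image_mem, ?_⟩
    ext c
    simp [classOf_kind]
  · rintro ⟨t, ht, rfl⟩
    exact exists_isArcTriple ht

theorem mem_arcTriples_iff (S : Set ArcClass) :
    (∃ d, IsArcTriple d ∧ Set.range d = S) ↔
      S ∈ ({{arc_a, arc_b, arc_c}, {arc_A, arc_B, arc_C},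
        {arc_α, arc_b, arc_c}, {arc_a, arc_β, arc_c}, {arc_a, arc_b, arc_γ},
        {arc_α, arc_B, arc_C}, {arc_A, arc_β, arc_C}, {arc_A, arc_B, arc_γ},
        {arc_a, arc_A, arc_β}, {arc_b, arc_B, arc_α}, {arc_c, arc_C, arc_α},
        {arc_a, arc_A, arc_γ}, {arc_b, arc_B, arc_γ}, {arc_c, arc_C, arc_β}} :
          Set (Set ArcClass)) := by
  rw [range_arcTriple_iff]
  simp only [triples, List.mem_cons, List.not_mem_nil, or_false, exists_eq_or_imp, exists_eq_left,
    Finset.coe_insert, Finset.coe_singleton, Set.image_insert_eq, Set.image_singleton,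
    Set.mem_insert_iff, Set.mem_singleton_iff, eq_comm (b := S)]
  exact Iff.rfl

theorem ncard_arcTriples : (Set.range '' {d : Fin 3 → ArcClass | IsArcTriple d}).ncard = 14 := by
  have h : Set.range '' {d : Fin 3 → ArcClass | IsArcTriple d} =
      (fun t : Finset (Fin 9) => classOf '' (t : Set (Fin 9))) '' (triples.toFinset : Set _) := by
    ext S
    simp only [Set.mem_image, Finset.mem_coe, List.mem_toFinset]
    exact range_arcTriple_iff
  have hinj : Function.Injective fun t : Finset (Fin 9) => classOf '' (t : Set (Fin 9)) :=
    fun s t hst => Finset.coe_injective (classEquiv.symm.injective.image_injective hst)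
  rw [h, Set.ncard_image_of_injective _ hinj, Set.ncard_coe_finset,
    List.toFinset_card_of_nodup triples_nodup]
  rfl

theorem card_arcClass : Nat.card ArcClass = 9 := by
  rw [Nat.card_congr classEquiv, Nat.card_fin]

theorem exists_arcTriple_superset (S : Set ArcClass) (hS : IsArcSystem S) :
    ∃ d, IsArcTriple d ∧ S ⊆ Set.range d := by
  classical
  rw [isArcSystem_iff] at hS
  let s : Finset (Fin 9) := {c | classOf c ∈ S}
  obtain ⟨t, ht, hst⟩ := exists_triple_superset s fun b hb c hc => by
    have h := hS _ (Finset.mem_filter.1 hb).2 _ (Finset.mem_filter.1 hc).2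
    rw [kind_classOf, kind_classOf, cross_iff_crossTable] at h
    simpa using h
  obtain ⟨d, hd, hr⟩ := exists_isArcTriple ht
  refine ⟨d, hd, fun c hc => ?_⟩
  rw [hr]
  exact ⟨c.kind, hst (Finset.mem_filter.2 ⟨Finset.mem_univ _, by rwa [classOf_kind]⟩),
    classOf_kind c⟩

/-! ### The atlas -/

theorem mem_MFgood_of_chart_pos {d : Fin 3 → ArcClass} (hd : IsArcTriple d) {x : MF}
    (h : ∀ j, 0 < chart d x j) : x ∈ MFgood d :=
  (mem_MFgood_iff hd).2 fun j => eq_zero_of_isect_pos (wt_admissible x) (by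
    have := h j
    rwa [chart_eq] at this)

theorem exists_mem_MFgood (x : MF) : ∃ d, IsArcTriple d ∧ x ∈ MFgood d := by
  obtain ⟨d, hd, h⟩ := exists_chart_pos x
  exact ⟨d, hd, mem_MFgood_of_chart_pos hd h⟩

theorem exists_mem_interior_PMFgood (y : PMF) :
    ∃ d, IsArcTriple d ∧ y ∈ interior (PMFgood d) := by
  obtain ⟨x, rfl⟩ := isOpenQuotientMap_toPMF.surjective y
  obtain ⟨d, hd, h⟩ := exists_chart_pos x
  exact ⟨d, hd, (mem_interior_PMFgood_iff hd x).2 h⟩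

theorem exists_coordinateChange {d d' : Fin 3 → ArcClass} (hd : IsArcTriple d)
    (hd' : IsArcTriple d') : ∃ f : (Fin 3 → ℝ) → (Fin 3 → ℝ),
      IsPiecewiseLinearOn f (chart d '' (MFgood d ∩ MFgood d')) ∧
      ∀ x ∈ MFgood d ∩ MFgood d', f (chart d x) = chart d' x := by
  obtain ⟨f, hf, h⟩ := exists_piecewiseLinear hd (isectMap fun j => (d' j).kind)
    (Finset.univ.image fun j => (d' j).kind)
  refine ⟨f, ?_, fun x hx => ?_⟩
  · convert hf using 3
    ext x
    simp [mem_MFgood_iff hd']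
  · rw [h x hx.1, chart_eq]
    rfl

/-! ### Explicit coordinate changes -/

theorem mem_MFgood_classOf {b c d : Fin 9} (h : IsTriple ![b, c, d]) {x : MF} :
    x ∈ MFgood ![classOf b, classOf c, classOf d] ↔ wt x b = 0 ∧ wt x c = 0 ∧ wt x d = 0 := by
  have h' : (fun j => (![classOf b, classOf c, classOf d] j).kind) = ![b, c, d] := by
    funext j
    fin_cases j <;> simp [kind_classOf]
  rw [mem_MFgood_iff (isArcTriple_iff.2 (h'.symm ▸ h))]
  simp [Fin.forall_fin_succ, kind_classOf]

instance (d : Fin 3 → Fin 9) : Decidable (IsTriple d) := by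
  unfold IsTriple
  infer_instance

section Changes

variable {w : Fin 9 → ℝ}

/-- In this and the following four lemmas both sides are linear in the weights, and the exclusions
between crossing kinds leave finitely many cases. For instance, in the chart {a, b, c} one has b + c
- a = 2w(A) + w(β) + w(γ) - w(α), where α excludes the other three kinds. -/
theorem isect_change_abc_αBC (hw : Admissible w) (h : w 0 = 0 ∧ w 2 = 0 ∧ w 4 = 0) :
    ((w 6 = 0 ∧ w 5 = 0 ∧ w 1 = 0) ↔ isect w 0 = 0) ∧
    (isect w 0 = 0 → isect w 4 ≤ isect w 2 →
      isect w 6 = isect w 2 ∧ isect w 5 = isect w 2 - isect w 4 ∧ isect w 1 = 0) ∧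
    (isect w 0 = 0 → isect w 2 ≤ isect w 4 →
      isect w 6 = isect w 4 ∧ isect w 5 = 0 ∧ isect w 1 = isect w 4 - isect w 2) := by
  obtain ⟨e0, e1, e2, e3, e4, e5, e6, e7, e8⟩ := isect_table w
  obtain ⟨⟨h1, h2, h3⟩, ⟨h4, h5⟩, ⟨h6, h7⟩, ⟨h8, h9⟩, ⟨h10, h11⟩, h12, h13, h14, h15⟩ :=
    hw.eq_zero_table
  have n1 := hw.nonneg 1
  have n3 := hw.nonneg 3
  have n5 := hw.nonneg 5
  have n6 := hw.nonneg 6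
  have n7 := hw.nonneg 7
  have n8 := hw.nonneg 8
  clear hw
  grind

theorem isect_change_abc_αbc (hw : Admissible w) (h : w 0 = 0 ∧ w 2 = 0 ∧ w 4 = 0) :
    ((w 6 = 0 ∧ w 2 = 0 ∧ w 4 = 0) ↔ isect w 0 ≤ isect w 2 + isect w 4) ∧
    (isect w 0 ≤ isect w 2 + isect w 4 → isect w 2 ≤ isect w 0 + isect w 4 →
      isect w 4 ≤ isect w 0 + isect w 2 →
      isect w 6 = (isect w 2 + isect w 4 - isect w 0) / 2) ∧
    (isect w 0 + isect w 4 ≤ isect w 2 → isect w 6 = isect w 2 - isect w 0) ∧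
    (isect w 0 + isect w 2 ≤ isect w 4 → isect w 6 = isect w 4 - isect w 0) := by
  obtain ⟨e0, e1, e2, e3, e4, e5, e6, e7, e8⟩ := isect_table w
  obtain ⟨⟨h1, h2, h3⟩, ⟨h4, h5⟩, ⟨h6, h7⟩, ⟨h8, h9⟩, ⟨h10, h11⟩, h12, h13, h14, h15⟩ :=
    hw.eq_zero_table
  have n1 := hw.nonneg 1
  have n3 := hw.nonneg 3
  have n5 := hw.nonneg 5
  have n6 := hw.nonneg 6
  have n7 := hw.nonneg 7
  have n8 := hw.nonneg 8
  clear hw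
  grind

theorem isect_change_abc_βaA (hw : Admissible w) (h : w 0 = 0 ∧ w 2 = 0 ∧ w 4 = 0) :
    ((w 7 = 0 ∧ w 0 = 0 ∧ w 3 = 0) ↔
      isect w 2 + isect w 4 ≤ isect w 0 ∨ (isect w 2 = 0 ∧ isect w 0 ≤ isect w 4)) ∧
    (isect w 2 + isect w 4 ≤ isect w 0 →
      isect w 7 = isect w 0 - isect w 2 ∧ isect w 3 = isect w 0 - isect w 2 - isect w 4) ∧
    (isect w 2 = 0 → isect w 0 ≤ isect w 4 → isect w 7 = isect w 4 ∧ isect w 3 = 0) := by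
  obtain ⟨e0, e1, e2, e3, e4, e5, e6, e7, e8⟩ := isect_table w
  obtain ⟨⟨h1, h2, h3⟩, ⟨h4, h5⟩, ⟨h6, h7⟩, ⟨h8, h9⟩, ⟨h10, h11⟩, h12, h13, h14, h15⟩ :=
    hw.eq_zero_table
  have n1 := hw.nonneg 1
  have n3 := hw.nonneg 3
  have n5 := hw.nonneg 5
  have n6 := hw.nonneg 6
  have n7 := hw.nonneg 7
  have n8 := hw.nonneg 8
  clear hw
  grind

theorem isect_change_αbc_αbB (hw : Admissible w) (h : w 6 = 0 ∧ w 2 = 0 ∧ w 4 = 0) :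
    ((w 6 = 0 ∧ w 2 = 0 ∧ w 5 = 0) ↔ isect w 4 ≤ isect w 6) ∧
    (isect w 4 ≤ isect w 6 → isect w 5 = isect w 6 - isect w 4) := by
  obtain ⟨e0, e1, e2, e3, e4, e5, e6, e7, e8⟩ := isect_table w
  obtain ⟨⟨h1, h2, h3⟩, ⟨h4, h5⟩, ⟨h6, h7⟩, ⟨h8, h9⟩, ⟨h10, h11⟩, h12, h13, h14, h15⟩ :=
    hw.eq_zero_table
  have n0 := hw.nonneg 0
  have n1 := hw.nonneg 1
  have n3 := hw.nonneg 3
  have n5 := hw.nonneg 5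
  have n7 := hw.nonneg 7
  have n8 := hw.nonneg 8
  clear hw
  grind

theorem isect_change_ABC_αbc (hw : Admissible w) (h : w 3 = 0 ∧ w 5 = 0 ∧ w 1 = 0) :
    ((w 6 = 0 ∧ w 2 = 0 ∧ w 4 = 0) ↔ isect w 3 = 0) ∧
    (isect w 3 = 0 → isect w 5 ≤ isect w 1 →
      isect w 6 = isect w 1 ∧ isect w 2 = 0 ∧ isect w 4 = isect w 1 - isect w 5) ∧
    (isect w 3 = 0 → isect w 1 ≤ isect w 5 →
      isect w 6 = isect w 5 ∧ isect w 2 = isect w 5 - isect w 1 ∧ isect w 4 = 0) := by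
  obtain ⟨e0, e1, e2, e3, e4, e5, e6, e7, e8⟩ := isect_table w
  obtain ⟨⟨h1, h2, h3⟩, ⟨h4, h5⟩, ⟨h6, h7⟩, ⟨h8, h9⟩, ⟨h10, h11⟩, h12, h13, h14, h15⟩ :=
    hw.eq_zero_table
  have n0 := hw.nonneg 0
  have n2 := hw.nonneg 2
  have n4 := hw.nonneg 4
  have n6 := hw.nonneg 6
  have n7 := hw.nonneg 7
  have n8 := hw.nonneg 8
  clear hw
  grind

end Changes

theorem coord_classOf (x : MF) (c : Fin 9) : coord x (classOf c) = isect (wt x) c := by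
  rw [coord_eq_isect, kind_classOf]

theorem change_abc_αBC (x : MF) (hx : x ∈ MFgood ![arc_a, arc_b, arc_c]) :
    (x ∈ MFgood ![arc_α, arc_B, arc_C] ↔ coord x arc_a = 0) ∧
    (coord x arc_a = 0 → coord x arc_c ≤ coord x arc_b →
      coord x arc_α = coord x arc_b ∧ coord x arc_B = coord x arc_b - coord x arc_c ∧
      coord x arc_C = 0) ∧
    (coord x arc_a = 0 → coord x arc_b ≤ coord x arc_c →
      coord x arc_α = coord x arc_c ∧ coord x arc_B = 0 ∧
      coord x arc_C = coord x arc_c - coord x arc_b) := by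
  have h := isect_change_abc_αBC (wt_admissible x)
    ((mem_MFgood_classOf (b := 0) (c := 2) (d := 4) (by decide)).1 hx)
  rw [← mem_MFgood_classOf (b := 6) (c := 5) (d := 1) (by decide)] at h
  simp only [← coord_classOf] at h
  exact h

theorem change_abc_αbc (x : MF) (hx : x ∈ MFgood ![arc_a, arc_b, arc_c]) :
    (x ∈ MFgood ![arc_α, arc_b, arc_c] ↔ coord x arc_a ≤ coord x arc_b + coord x arc_c) ∧
    (coord x arc_a ≤ coord x arc_b + coord x arc_c →
      coord x arc_b ≤ coord x arc_a + coord x arc_c →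
      coord x arc_c ≤ coord x arc_a + coord x arc_b →
      coord x arc_α = (coord x arc_b + coord x arc_c - coord x arc_a) / 2) ∧
    (coord x arc_a + coord x arc_c ≤ coord x arc_b →
      coord x arc_α = coord x arc_b - coord x arc_a) ∧
    (coord x arc_a + coord x arc_b ≤ coord x arc_c →
      coord x arc_α = coord x arc_c - coord x arc_a) := by
  have h := isect_change_abc_αbc (wt_admissible x)
    ((mem_MFgood_classOf (b := 0) (c := 2) (d := 4) (by decide)).1 hx)
  rw [← mem_MFgood_classOf (b := 6) (c := 2) (d := 4) (by decide)] at h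
  simp only [← coord_classOf] at h
  exact h

theorem change_abc_βaA (x : MF) (hx : x ∈ MFgood ![arc_a, arc_b, arc_c]) :
    (x ∈ MFgood ![arc_β, arc_a, arc_A] ↔
      coord x arc_b + coord x arc_c ≤ coord x arc_a ∨
        (coord x arc_b = 0 ∧ coord x arc_a ≤ coord x arc_c)) ∧
    (coord x arc_b + coord x arc_c ≤ coord x arc_a →
      coord x arc_β = coord x arc_a - coord x arc_b ∧
      coord x arc_A = coord x arc_a - coord x arc_b - coord x arc_c) ∧
    (coord x arc_b = 0 → coord x arc_a ≤ coord x arc_c →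
      coord x arc_β = coord x arc_c ∧ coord x arc_A = 0) := by
  have h := isect_change_abc_βaA (wt_admissible x)
    ((mem_MFgood_classOf (b := 0) (c := 2) (d := 4) (by decide)).1 hx)
  rw [← mem_MFgood_classOf (b := 7) (c := 0) (d := 3) (by decide)] at h
  simp only [← coord_classOf] at h
  exact h

theorem change_αbc_αbB (x : MF) (hx : x ∈ MFgood ![arc_α, arc_b, arc_c]) :
    (x ∈ MFgood ![arc_α, arc_b, arc_B] ↔ coord x arc_c ≤ coord x arc_α) ∧
    (coord x arc_c ≤ coord x arc_α → coord x arc_B = coord x arc_α - coord x arc_c) := by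
  have h := isect_change_αbc_αbB (wt_admissible x)
    ((mem_MFgood_classOf (b := 6) (c := 2) (d := 4) (by decide)).1 hx)
  rw [← mem_MFgood_classOf (b := 6) (c := 2) (d := 5) (by decide)] at h
  simp only [← coord_classOf] at h
  exact h

theorem change_ABC_αbc (x : MF) (hx : x ∈ MFgood ![arc_A, arc_B, arc_C]) :
    (x ∈ MFgood ![arc_α, arc_b, arc_c] ↔ coord x arc_A = 0) ∧
    (coord x arc_A = 0 → coord x arc_B ≤ coord x arc_C →
      coord x arc_α = coord x arc_C ∧ coord x arc_b = 0 ∧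
      coord x arc_c = coord x arc_C - coord x arc_B) ∧
    (coord x arc_A = 0 → coord x arc_C ≤ coord x arc_B →
      coord x arc_α = coord x arc_B ∧ coord x arc_b = coord x arc_B - coord x arc_C ∧
      coord x arc_c = 0) := by
  have h := isect_change_ABC_αbc (wt_admissible x)
    ((mem_MFgood_classOf (b := 3) (c := 5) (d := 1) (by decide)).1 hx)
  rw [← mem_MFgood_classOf (b := 6) (c := 2) (d := 4) (by decide)] at h
  simp only [← coord_classOf] at h
  exact h

/-! ### The triangulation and the sphere -/

theorem mem_arcCone_iff {w : ArcClass → ℝ} :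
    w ∈ arcCone ↔ Admissible fun c => w (classOf c) := by
  constructor
  · rintro ⟨h0, hne, hs⟩
    rw [isArcSystem_iff] at hs
    refine ⟨fun c => h0 _, fun h => hne ?_, fun b c hb hc => ?_⟩
    · funext c
      have h1 : w (classOf c.kind) = 0 := congrFun h c.kind
      rwa [classOf_kind] at h1
    · simpa only [kind_classOf] using hs _ hb _ hc
  · rintro ⟨h0, hne, hs⟩
    refine ⟨fun c => ?_, fun h => hne (by rw [h]; rfl), (isArcSystem_iff _).2 fun b hb c hc => ?_⟩
    · simpa only [classOf_kind] using h0 c.kind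
    · refine hs _ _ ?_ ?_
      · rwa [classOf_kind]
      · rwa [classOf_kind]

theorem weight_ofWeight (w : ArcClass → ℝ) (h : Admissible fun c => w (classOf c)) :
    weight (ofWeight _ h) = w := by
  funext c
  rw [weight_eq, wt_ofWeight, classOf_kind]

theorem weight_mem_arcCone (x : MF) : weight x ∈ arcCone :=
  mem_arcCone_iff.2 (wt_admissible x)

theorem continuous_weight : Continuous weight := by
  refine continuous_pi fun c => ?_
  have h : (fun x => weight x c) = fun x => wt x c.kind := funext fun x => weight_eq x c
  rw [h]
  exact continuous_pi_iff.1 continuous_wt c.kind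

/-- The triangulation of the space of measured foliations. -/
def arcConeHomeomorph : MF ≃ₜ arcCone where
  toFun x := ⟨weight x, weight_mem_arcCone x⟩
  invFun w := ofWeight _ (mem_arcCone_iff.1 w.2)
  left_inv _ := wt_injective (wt_ofWeight _ _)
  right_inv _ := Subtype.ext (weight_ofWeight _ _)
  continuous_toFun := continuous_weight.subtype_mk _
  continuous_invFun := continuous_ofWeight
    (continuous_pi fun _ => (continuous_apply _).comp continuous_subtype_val) _

theorem weight_smul {x y : MF} {r : ℝ} (h : wt y = r • wt x) : weight y = r • weight x := by
  funext c
  rw [weight_eq, h, Pi.smul_apply, Pi.smul_apply, weight_eq]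

theorem sum_weight_pos (x : MF) : 0 < ∑ c, weight x c := by
  obtain ⟨h0, hne, -⟩ := weight_mem_arcCone x
  obtain ⟨c, hc⟩ := Function.ne_iff.1 hne
  exact Finset.sum_pos' (fun c _ => h0 c) ⟨c, Finset.mem_univ c, lt_of_le_of_ne (h0 c) (Ne.symm hc)⟩

theorem exists_arcComplexHomeomorph : ∃ T : PMF ≃ₜ arcComplex, ∀ (x : MF) (c : ArcClass),
    (T x.toPMF : ArcClass → ℝ) c = weight x c / ∑ᶠ b, weight x b := by
  simp only [finsum_eq_sum_of_fintype]
  have hmem : ∀ x, (∑ b, weight x b)⁻¹ • weight x ∈ arcComplex := fun x => by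
    refine ⟨mem_arcCone_iff.2 ((wt_admissible x).smul (inv_pos.2 (sum_weight_pos x))), ?_⟩
    rw [finsum_eq_sum_of_fintype]
    simp only [Pi.smul_apply, smul_eq_mul, ← Finset.mul_sum]
    exact inv_mul_cancel₀ (sum_weight_pos x).ne'
  have hs : ∀ v : arcComplex, Admissible fun c => v.1 (classOf c) := fun v =>
    mem_arcCone_iff.1 v.2.1
  obtain ⟨T, hT⟩ := exists_homeomorph_PMF (fun x => (⟨_, hmem x⟩ : arcComplex))
    ((((continuous_finsetSum _ fun c _ => (continuous_apply c).comp continuous_weight).inv₀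
      fun x => (sum_weight_pos x).ne').smul continuous_weight).subtype_mk _)
    (fun v => ofWeight _ (hs v)) (continuous_ofWeight
      (continuous_pi fun c => (continuous_apply _).comp continuous_subtype_val) _)
    (fun v => Subtype.ext (by
      have h1 := v.2.2
      rw [finsum_eq_sum_of_fintype] at h1
      show (∑ b, weight (ofWeight _ (hs v)) b)⁻¹ • weight (ofWeight _ (hs v)) = v.1
      rw [weight_ofWeight, h1, inv_one, one_smul]))
    (fun x => toPMF_eq_iff.2 ⟨_, sum_weight_pos x, by
      rw [wt_ofWeight]
      funext c
      exact (mul_inv_cancel_left₀ (sum_weight_pos x).ne' _).symm⟩)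
    (fun x y hxy => Subtype.ext (by
      obtain ⟨r, hr, h⟩ := toPMF_eq_iff.1 hxy
      show (∑ b, weight x b)⁻¹ • weight x = (∑ b, weight y b)⁻¹ • weight y
      simp only [weight_smul h, Pi.smul_apply, smul_eq_mul, ← Finset.mul_sum]
      rw [smul_smul, mul_inv, mul_right_comm, inv_mul_cancel₀ hr.ne', one_mul]))
  refine ⟨T, fun x c => ?_⟩
  rw [hT]
  exact (div_eq_inv_mul _ _).symm

/-- The sphere coordinates, as a linear map into the Euclidean space. -/
def euclideanMap : (Fin 9 → ℝ) →ₗ[ℝ] EuclideanSpace ℝ (Fin 3) :=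
  (WithLp.linearEquiv 2 ℝ (Fin 3 → ℝ)).symm.toLinearMap ∘ₗ sphereMap

/-- If the image of `w` were 0, that of `2 • w` would be 0 too; the left inverse then gives w = 2w,
which is impossible. -/
theorem sphereMap_ne_zero {w : Fin 9 → ℝ} (hw : Admissible w) : sphereMap w ≠ 0 := by
  intro h
  have h1 := sphereInv_sphereMap hw
  have h2 := sphereInv_sphereMap (hw.smul two_pos)
  rw [map_smul, h, smul_zero, ← h, h1, two_smul, left_eq_add] at h2
  exact hw.ne_zero h2

theorem euclideanMap_ne_zero {w : Fin 9 → ℝ} (hw : Admissible w) : euclideanMap w ≠ 0 :=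
  fun h => sphereMap_ne_zero hw
    ((WithLp.linearEquiv 2 ℝ (Fin 3 → ℝ)).symm.map_eq_zero_iff.1 h)

theorem ofLp_ne_zero {v : EuclideanSpace ℝ (Fin 3)} (h : v ≠ 0) : v.ofLp ≠ 0 :=
  fun h' => h ((WithLp.linearEquiv 2 ℝ (Fin 3 → ℝ)).map_eq_zero_iff.1 h')

theorem euclideanMap_sphereInv (v : EuclideanSpace ℝ (Fin 3)) :
    euclideanMap (sphereInv v.ofLp) = v := by
  show WithLp.toLp 2 (sphereMap (sphereInv v.ofLp)) = v
  rw [sphereMap_sphereInv]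

theorem sphereInv_euclideanMap {w : Fin 9 → ℝ} (hw : Admissible w) :
    sphereInv (euclideanMap w).ofLp = w := sphereInv_sphereMap hw

theorem continuous_euclideanMap_wt : Continuous fun x : MF => euclideanMap (wt x) :=
  euclideanMap.continuous_of_finiteDimensional.comp continuous_wt

/-- The piecewise-linear structure of the space of measured foliations. -/
def euclideanHomeomorph : MF ≃ₜ {v : EuclideanSpace ℝ (Fin 3) // v ≠ 0} where
  toFun x := ⟨euclideanMap (wt x), euclideanMap_ne_zero (wt_admissible x)⟩
  invFun v := ofWeight _ (sphereInv_admissible (ofLp_ne_zero v.2))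
  left_inv x := wt_injective (by
    rw [wt_ofWeight]
    exact sphereInv_euclideanMap (wt_admissible x))
  right_inv v := Subtype.ext (by
    show euclideanMap (wt (ofWeight _ _)) = v.1
    rw [wt_ofWeight, euclideanMap_sphereInv])
  continuous_toFun := continuous_euclideanMap_wt.subtype_mk _
  continuous_invFun := continuous_ofWeight (continuous_sphereInv.comp
    ((PiLp.continuous_ofLp 2 _).comp continuous_subtype_val)) _

theorem exists_sphereHomeomorph : ∃ Q : PMF ≃ₜ Metric.sphere (0 : EuclideanSpace ℝ (Fin 3)) 1,
    ∀ x : MF, (Q x.toPMF : EuclideanSpace ℝ (Fin 3)) =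
      ‖euclideanMap (wt x)‖⁻¹ • euclideanMap (wt x) := by
  have hpos : ∀ x : MF, 0 < ‖euclideanMap (wt x)‖ := fun x =>
    norm_pos_iff.2 (euclideanMap_ne_zero (wt_admissible x))
  have hmem : ∀ x : MF, ‖euclideanMap (wt x)‖⁻¹ • euclideanMap (wt x) ∈
      Metric.sphere (0 : EuclideanSpace ℝ (Fin 3)) 1 := fun x => by
    rw [mem_sphere_zero_iff_norm, norm_smul, norm_inv, norm_norm, inv_mul_cancel₀ (hpos x).ne']
  have hs : ∀ v : Metric.sphere (0 : EuclideanSpace ℝ (Fin 3)) 1,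
      Admissible (sphereInv v.1.ofLp) := fun v =>
    sphereInv_admissible (ofLp_ne_zero (ne_zero_of_mem_unit_sphere v))
  obtain ⟨Q, hQ⟩ := exists_homeomorph_PMF
    (fun x => (⟨_, hmem x⟩ : Metric.sphere (0 : EuclideanSpace ℝ (Fin 3)) 1))
    (((continuous_euclideanMap_wt.norm.inv₀ fun x => (hpos x).ne').smul
      continuous_euclideanMap_wt).subtype_mk _)
    (fun v => ofWeight _ (hs v)) (continuous_ofWeight (continuous_sphereInv.comp
      ((PiLp.continuous_ofLp 2 _).comp continuous_subtype_val)) _)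
    (fun v => Subtype.ext (by
      show ‖euclideanMap (wt (ofWeight _ (hs v)))‖⁻¹ • euclideanMap (wt (ofWeight _ (hs v))) = v.1
      rw [wt_ofWeight, euclideanMap_sphereInv, mem_sphere_zero_iff_norm.1 v.2, inv_one, one_smul]))
    -- The nonlinear inverse is applied to the normalized weights, whose image under the linear map
    -- is the unit vector.
    (fun x => toPMF_eq_iff.2 ⟨_, hpos x, by
      have h := sphereInv_euclideanMap ((wt_admissible x).smul (inv_pos.2 (hpos x)))
      rw [map_smul] at h
      rw [wt_ofWeight, h, smul_smul, mul_inv_cancel₀ (hpos x).ne', one_smul]⟩)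
    (fun x y hxy => Subtype.ext (by
      obtain ⟨r, hr, h⟩ := toPMF_eq_iff.1 hxy
      show ‖euclideanMap (wt x)‖⁻¹ • euclideanMap (wt x) =
        ‖euclideanMap (wt y)‖⁻¹ • euclideanMap (wt y)
      rw [h, map_smul, norm_smul, Real.norm_of_nonneg hr.le, smul_smul, mul_inv, mul_right_comm,
        inv_mul_cancel₀ hr.ne', one_mul]))
  exact ⟨Q, fun x => by rw [hQ]⟩

theorem exists_piecewiseLinear_octant {d : Fin 3 → ArcClass} (hd : IsArcTriple d) {V : Type*}
    [AddCommGroup V] [Module ℝ V] (N : (Fin 9 → ℝ) →ₗ[ℝ] V) :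
    ∃ g : (Fin 3 → ℝ) → V, IsPiecewiseLinearOn g octant ∧
      ∀ x ∈ MFgood d, g (chart d x) = N (wt x) := by
  obtain ⟨g, hg, h⟩ := exists_piecewiseLinear hd N ∅
  refine ⟨g, ?_, h⟩
  rw [← chart_image_MFgood hd]
  simpa using hg

theorem coord_eq_finsum (x : MF) (c : ArcClass) :
    coord x c = ∑ᶠ b, weight x b * crossing b.kind c.kind := by
  rw [finsum_eq_sum_of_fintype, coord_eq]
  refine (Equiv.sum_comp classEquiv fun b => wt x b * crossing b c.kind).symm.trans
    (Finset.sum_congr rfl fun b _ => ?_)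
  rw [weight_eq]
  rfl

/-- With `euclideanMap` for `N` this gives the formula for the sphere coordinates on cells; the
vertex vectors are the values on the nine unit weights. -/
theorem map_wt_eq_finsum {V : Type*} [AddCommGroup V] [Module ℝ V] (N : (Fin 9 → ℝ) →ₗ[ℝ] V)
    (x : MF) : N (wt x) = ∑ᶠ b, weight x b • N (Pi.single b.kind 1) := by
  rw [finsum_eq_sum_of_fintype, LinearMap.pi_apply_eq_sum_univ N (wt x)]
  refine (Equiv.sum_comp classEquiv _).symm.trans (Finset.sum_congr rfl fun b _ => ?_)
  rw [weight_eq]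
  congr 2
  funext c
  simp [Pi.single_apply, classEquiv, eq_comm]

end Hexagon

end

/-! ### Assembly of the theorem -/

open Hexagon in
theorem mainTheorem2 :
    -- the arc triples
    (∀ S : Set ArcClass, (∃ d, IsArcTriple d ∧ Set.range d = S) ↔
      S ∈ ({{arc_a, arc_b, arc_c}, {arc_A, arc_B, arc_C},
        {arc_α, arc_b, arc_c}, {arc_a, arc_β, arc_c}, {arc_a, arc_b, arc_γ},
        {arc_α, arc_B, arc_C}, {arc_A, arc_β, arc_C}, {arc_A, arc_B, arc_γ},
        {arc_a, arc_A, arc_β}, {arc_b, arc_B, arc_α}, {arc_c, arc_C, arc_α},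
        {arc_a, arc_A, arc_γ}, {arc_b, arc_B, arc_γ}, {arc_c, arc_C, arc_β}} :
          Set (Set ArcClass))) ∧
    (Set.range '' {d : Fin 3 → ArcClass | IsArcTriple d}).ncard = 14 ∧
    Nat.card ArcClass = 9 ∧
    -- intersection numbers are finite
    (∀ x c, inter x c < ⊤) ∧
    -- the charts
    (∀ d, IsArcTriple d →
      chart d '' MFgood d = octant ∧
      Topology.IsEmbedding (fun x : MFgood d => chart d x) ∧
      (∃ e : PMFgood d ≃ₜ stdSimplex ℝ (Fin 3), ∀ (x : MF) (hx : x ∈ MFgood d) (j : Fin 3),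
        (e ⟨x.toPMF, Set.mem_image_of_mem _ hx⟩ : Fin 3 → ℝ) j = chart d x j / ∑ l, chart d x l) ∧
      (∀ x ∈ MFgood d, x.toPMF ∈ interior (PMFgood d) ↔ ∀ j, 0 < chart d x j)) ∧
    -- they form an atlas
    (∀ x : MF, ∃ d, IsArcTriple d ∧ x ∈ MFgood d) ∧
    (∀ y : PMF, ∃ d, IsArcTriple d ∧ y ∈ interior (PMFgood d)) ∧
    -- with piecewise-linear coordinate changes
    (∀ d d', IsArcTriple d → IsArcTriple d' → ∃ f : (Fin 3 → ℝ) → (Fin 3 → ℝ),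
      IsPiecewiseLinearOn f (chart d '' (MFgood d ∩ MFgood d')) ∧
      ∀ x ∈ MFgood d ∩ MFgood d', f (chart d x) = chart d' x) ∧
    -- the first explicit coordinate change
    (∀ x ∈ MFgood ![arc_a, arc_b, arc_c],
      (x ∈ MFgood ![arc_α, arc_B, arc_C] ↔ coord x arc_a = 0) ∧
      (coord x arc_a = 0 → coord x arc_c ≤ coord x arc_b →
        coord x arc_α = coord x arc_b ∧ coord x arc_B = coord x arc_b - coord x arc_c ∧
        coord x arc_C = 0) ∧
      (coord x arc_a = 0 → coord x arc_b ≤ coord x arc_c →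
        coord x arc_α = coord x arc_c ∧ coord x arc_B = 0 ∧
        coord x arc_C = coord x arc_c - coord x arc_b)) ∧
    -- the second one
    (∀ x ∈ MFgood ![arc_a, arc_b, arc_c],
      (x ∈ MFgood ![arc_α, arc_b, arc_c] ↔ coord x arc_a ≤ coord x arc_b + coord x arc_c) ∧
      (coord x arc_a ≤ coord x arc_b + coord x arc_c →
        coord x arc_b ≤ coord x arc_a + coord x arc_c →
        coord x arc_c ≤ coord x arc_a + coord x arc_b →
        coord x arc_α = (coord x arc_b + coord x arc_c - coord x arc_a) / 2) ∧
      (coord x arc_a + coord x arc_c ≤ coord x arc_b →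
        coord x arc_α = coord x arc_b - coord x arc_a) ∧
      (coord x arc_a + coord x arc_b ≤ coord x arc_c →
        coord x arc_α = coord x arc_c - coord x arc_a)) ∧
    -- the third one
    (∀ x ∈ MFgood ![arc_a, arc_b, arc_c],
      (x ∈ MFgood ![arc_β, arc_a, arc_A] ↔
        coord x arc_b + coord x arc_c ≤ coord x arc_a ∨
          (coord x arc_b = 0 ∧ coord x arc_a ≤ coord x arc_c)) ∧
      (coord x arc_b + coord x arc_c ≤ coord x arc_a →
        coord x arc_β = coord x arc_a - coord x arc_b ∧
        coord x arc_A = coord x arc_a - coord x arc_b - coord x arc_c) ∧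
      (coord x arc_b = 0 → coord x arc_a ≤ coord x arc_c →
        coord x arc_β = coord x arc_c ∧ coord x arc_A = 0)) ∧
    -- the fourth one
    (∀ x ∈ MFgood ![arc_α, arc_b, arc_c],
      (x ∈ MFgood ![arc_α, arc_b, arc_B] ↔ coord x arc_c ≤ coord x arc_α) ∧
      (coord x arc_c ≤ coord x arc_α → coord x arc_B = coord x arc_α - coord x arc_c)) ∧
    -- the fifth one
    (∀ x ∈ MFgood ![arc_A, arc_B, arc_C],
      (x ∈ MFgood ![arc_α, arc_b, arc_c] ↔ coord x arc_A = 0) ∧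
      (coord x arc_A = 0 → coord x arc_B ≤ coord x arc_C →
        coord x arc_α = coord x arc_C ∧ coord x arc_b = 0 ∧
        coord x arc_c = coord x arc_C - coord x arc_B) ∧
      (coord x arc_A = 0 → coord x arc_C ≤ coord x arc_B →
        coord x arc_α = coord x arc_B ∧ coord x arc_b = coord x arc_B - coord x arc_C ∧
        coord x arc_c = 0)) ∧
    -- the natural triangulation, the piecewise-linear sphere
    ∃ (W : MF ≃ₜ arcCone) (T : PMF ≃ₜ arcComplex)
      (P : MF ≃ₜ {v : EuclideanSpace ℝ (Fin 3) // v ≠ 0})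
      (Q : PMF ≃ₜ Metric.sphere (0 : EuclideanSpace ℝ (Fin 3)) 1),
      -- the barycentric coordinates are the transverse measures of the families of parallel leaves
      (∀ (F : MeasuredFoliation) (c : ArcClass), (W F.toMF : ArcClass → ℝ) c = F.leafMeasure c) ∧
      (∀ (x : MF) (c : ArcClass), (T x.toPMF : ArcClass → ℝ) c =
        (W x : ArcClass → ℝ) c / ∑ᶠ b, (W x : ArcClass → ℝ) b) ∧
      -- every cell lies in a triangle, and is linear with respect to the coordinates of the charts
      (∀ S : Set ArcClass, IsArcSystem S → ∃ d, IsArcTriple d ∧ S ⊆ Set.range d) ∧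
      (∃ m : ArcClass → ArcClass → ℝ, ∀ x c,
        coord x c = ∑ᶠ b, (W x : ArcClass → ℝ) b * m b c) ∧
      -- linear on the cells, piecewise linear in the charts, homogeneous, inducing `Q`
      (∃ v : ArcClass → EuclideanSpace ℝ (Fin 3), ∀ x,
        (P x : EuclideanSpace ℝ (Fin 3)) = ∑ᶠ b, (W x : ArcClass → ℝ) b • v b) ∧
      (∀ d, IsArcTriple d → ∃ g : (Fin 3 → ℝ) → EuclideanSpace ℝ (Fin 3),
        IsPiecewiseLinearOn g octant ∧ ∀ x ∈ MFgood d, g (chart d x) = P x) ∧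
      (∀ (F : MeasuredFoliation) (r : ℝ) (hr : 0 < r),
        (P (F.scale r hr).toMF : EuclideanSpace ℝ (Fin 3)) = r • (P F.toMF).1) ∧
      (∀ x : MF, (Q x.toPMF : EuclideanSpace ℝ (Fin 3)) = ‖(P x).1‖⁻¹ • (P x).1) := by
  refine ⟨mem_arcTriples_iff, ncard_arcTriples, card_arcClass,
    fun x c => (inter_ne_top x c).lt_top,
    fun d hd => ⟨chart_image_MFgood hd, isEmbedding_chart hd, exists_homeomorph_stdSimplex hd,
      fun x _ => mem_interior_PMFgood_iff hd x⟩,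
    exists_mem_MFgood, exists_mem_interior_PMFgood,
    fun d d' hd hd' => exists_coordinateChange hd hd',
    change_abc_αBC, change_abc_αbc, change_abc_βaA, change_αbc_αbB, change_ABC_αbc, ?_⟩
  obtain ⟨T, hT⟩ := exists_arcComplexHomeomorph
  obtain ⟨Q, hQ⟩ := exists_sphereHomeomorph
  refine ⟨arcConeHomeomorph, T, euclideanHomeomorph, Q, fun F c => rfl, hT,
    exists_arcTriple_superset, ⟨_, coord_eq_finsum⟩, ⟨_, map_wt_eq_finsum euclideanMap⟩,
    fun d hd => exists_piecewiseLinear_octant hd euclideanMap, fun F r hr => ?_, hQ⟩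
  show euclideanMap (wt (F.scale r hr).toMF) = r • euclideanMap (wt F.toMF)
  rw [wt_scale, map_smul]
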